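/- Let $M$ be an oriented smooth Riemannian $4$-manifold, $p\in M$, and let $(\Sigma_n)$ be a sequence of connected smooth surfaces immersed in $M$ whose only self-intersections (if any) are transverse double points, without boundary near $p$ (i.e. some fixed neighbourhood of $p$ has compact preimage in the parameter surface of $\Sigma_n$ for all large $n$). Assume that the genera and the areas of the $\Sigma_n$ are bounded uniformly in $n$. Let $\Sigma_0$ be a finite union of topologically embedded disks in $M$, each of which passes through $p$, is a smooth immersion away from $p$, and is parametrized near $p$, in suitable local coordinates of $M$ centred at $p$, by $$z\mapsto\big(\mathrm{Re}\,z^N+o_1(|z|^N),\ \mathrm{Im}\,z^N+o_1(|z|^N),\ o_1(|z|^N),\ o_1(|z|^N)\big)$$ for some integer $N\ge 1$ ($N$ depending on the disk), where $o_1(|z|^N)$ is a function that is $o(|z|^N)$ and whose first partial derivatives are $o(|z|^{N-1})$. Assume that $\Sigma_n\to\Sigma_0$ for the Hausdorff distance, and uniformly smoothly on every compact subset of $M$ not containing $p$. Let $K^T_n$ and $K^N_n$ be the curvatures of the tangent bundle $T\Sigma_n$ and of the normal bundle $N\Sigma_n$ (for the connections induced by the Levi-Civita connection of $M$; the sign of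 $K^N_n$ is determined by the orientation of $M$). Let $B(p,\epsilon)$ be the ball of centre $p$ and radius $\epsilon$ for the Euclidean metric obtained by extending the metric of $T_pM$ as a constant metric in positively oriented local coordinates around $p$, and let $$k^T=\frac1{2\pi}\lim_{\epsilon\to0}\lim_{n\to\infty}\int_{\Sigma_n\cap B(p,\epsilon)}K^T_n,\qquad k^N=\frac1{2\pi}\lim_{\epsilon\to0}\lim_{n\to\infty}\int_{\Sigma_n\cap B(p,\epsilon)}K^N_n ,$$ where these limits are assumed to exist. For an immersed surface $\Sigma$ in $M$ and $q\in\Sigma$, let $J_\pm$ be the orthogonal almost complex structure on $T_qM$ with $J_\pm e_1=e_2$ and $J_\pm e_3=\pm e_4$, where $(e_1,e_2)$ and $(e_3,e_4)$ are orthonormal bases of $T_q\Sigma$ and $N_q\Sigma$, $(e_1,e_2)$ is positive for a local orientation of $\Sigma$, and $(e_1,e_2,e_3,e_4)$ is positive in $T_qM$. The surface $\Sigma$ is right (resp. left) superminimal if $J_+$ (resp. $J_-$) is parallel along $\Sigma$ for the Levi-Civita connection of $M$. If all the $\Sigma_n$ are right superminimal, then $k^T=-k^N$. If all the $\Sigma_n$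 are left superminimal, then $k^T=k^N$. -/

import Mathlib

open Set Filter Topology MeasureTheory Manifold Bundle
open scoped ContDiff NNReal ENNReal Asymptotics

noncomputable section

namespace SurfaceSequence

/-- Euclidean space of dimension `d`. -/
abbrev E (d : ℕ) := EuclideanSpace ℝ (Fin d)

/-- The standard basis vectors of `E d`. -/
def e {d : ℕ} (i : Fin d) : E d := EuclideanSpace.single i 1

section Ambient

variable {M : Type*} [TopologicalSpace M] [ChartedSpace (E 4) M]

/-- An orientation of the `4`-manifold `M`: a family of smooth charts that covers `M` and whose
transition maps have positive Jacobian determinant. -/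
structure OrientedAtlas (M : Type*) [TopologicalSpace M] [ChartedSpace (E 4) M] where
  /-- The positively oriented charts. -/
  charts : Set (OpenPartialHomeomorph M (E 4))
  smooth : charts ⊆ IsManifold.maximalAtlas (𝓡 4) ∞ M
  cover : ∀ x : M, ∃ ψ ∈ charts, x ∈ ψ.source
  det_pos : ∀ ψ ∈ charts, ∀ ψ' ∈ charts, ∀ y ∈ (ψ.symm.trans ψ').source,
    0 < (fderiv ℝ (fun y => ψ' (ψ.symm y)) y).det

variable [RiemannianBundle (fun x : M => TangentSpace (𝓡 4) x)]

/-- The Riemannian metric of `M` read in the chart `ψ`, at the point with coordinates `y`. -/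
def chartMetric (ψ : OpenPartialHomeomorph M (E 4)) (y v w : E 4) : ℝ :=
  inner ℝ (mfderiv 𝓘(ℝ, E 4) (𝓡 4) ψ.symm y v : TangentSpace (𝓡 4) (ψ.symm y))
    (mfderiv 𝓘(ℝ, E 4) (𝓡 4) ψ.symm y w : TangentSpace (𝓡 4) (ψ.symm y))

/-- The matrix `(g_ij)` of the metric in the chart `ψ`. -/
def gram (ψ : OpenPartialHomeomorph M (E 4)) (y : E 4) : Matrix (Fin 4) (Fin 4) ℝ :=
  Matrix.of fun i j => chartMetric ψ y (e i) (e j)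

/-- The Christoffel symbols `Γ^k_ij` of the Levi-Civita connection in the chart `ψ`. -/
def christoffel (ψ : OpenPartialHomeomorph M (E 4)) (y : E 4) (k i j : Fin 4) : ℝ :=
  1 / 2 * ∑ l, (gram ψ y)⁻¹ k l *
    (fderiv ℝ (fun y => gram ψ y j l) y (e i) + fderiv ℝ (fun y => gram ψ y i l) y (e j)
      - fderiv ℝ (fun y => gram ψ y i j) y (e l))

/-- The bilinear map `Γ(v, w)` with components `∑ Γ^k_ij v^i w^j`. -/
def christoffelMap (ψ : OpenPartialHomeomorph M (E 4)) (y v w : E 4) : E 4 :=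
  WithLp.toLp 2 fun k => ∑ i, ∑ j, christoffel ψ y k i j * v i * w j

/-- The Euclidean ball `B(p, ε)`: the metric of `T_p M` is extended to the chart domain as a
constant metric in the coordinates `ψ`. -/
def euclideanBall (ψ : OpenPartialHomeomorph M (E 4)) (p : M) (ε : ℝ) : Set M :=
  {q | q ∈ ψ.source ∧ √(chartMetric ψ (ψ p) (ψ q - ψ p) (ψ q - ψ p)) < ε}

/-! ### A parametrized surface `u : E 2 → E 4` in the coordinates `ψ` of `M` -/

/-- The coordinate tangent vector `∂_α u`. -/
def tangentVec (u : E 2 → E 4) (t : E 2) (α : Fin 2) : E 4 := fderiv ℝ u t (e α)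

/-- The covariant derivative in the direction `∂_α` of a vector field `V` along `u`, for the
pull-back by `u` of the Levi-Civita connection. -/
def covDeriv (ψ : OpenPartialHomeomorph M (E 4)) (u V : E 2 → E 4) (α : Fin 2) (t : E 2) : E 4 :=
  fderiv ℝ V t (e α) + christoffelMap ψ (u t) (tangentVec u t α) (V t)

/-- The area of the parallelogram spanned by `∂_0 u` and `∂_1 u`. -/
def areaElement (ψ : OpenPartialHomeomorph M (E 4)) (u : E 2 → E 4) (t : E 2) : ℝ :=
  √(chartMetric ψ (u t) (tangentVec u t 0) (tangentVec u t 0) *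
      chartMetric ψ (u t) (tangentVec u t 1) (tangentVec u t 1) -
    chartMetric ψ (u t) (tangentVec u t 0) (tangentVec u t 1) ^ 2)

/-- The rotation by `+π/2` in the tangent plane of `u`, oriented by `(∂_0 u, ∂_1 u)`, extended by
zero on the normal plane: `e₁ ↦ e₂ ↦ -e₁`, `e₃, e₄ ↦ 0` for an adapted orthonormal basis. -/
def rotT (ψ : OpenPartialHomeomorph M (E 4)) (u : E 2 → E 4) (t : E 2) (v : E 4) : E 4 :=
  (areaElement ψ u t)⁻¹ •
    (chartMetric ψ (u t) (tangentVec u t 0) v • tangentVec u t 1 -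
      chartMetric ψ (u t) (tangentVec u t 1) v • tangentVec u t 0)

/-- The rotation by `+π/2` in the normal plane of `u`, extended by zero on the tangent plane:
`e₃ ↦ e₄ ↦ -e₃`, `e₁, e₂ ↦ 0`, where `(e₁, e₂, e₃, e₄)` is positive for the orientation of the
chart `ψ`. It is the vector with `⟨rotN v, w⟩ = vol(e₁, e₂, v, w)`, where `vol = √(det g) det`. -/
def rotN (ψ : OpenPartialHomeomorph M (E 4)) (u : E 2 → E 4) (t : E 2) (v : E 4) : E 4 :=
  WithLp.toLp 2 fun k => ∑ l, (gram ψ (u t))⁻¹ k l *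
    ((areaElement ψ u t)⁻¹ * √(gram ψ (u t)).det *
      (Matrix.of ![⇑(tangentVec u t 0), ⇑(tangentVec u t 1), ⇑v, ⇑(e l : E 4)]).det)

/-- Let `L` be the oriented plane bundle along `u` whose rotation by `+π/2` is `j` (extended by zero
on the orthogonal complement), so that `-j²` is the orthogonal projection onto `L`. The connection
of `L` is the projection of the ambient one. If `R` is its curvature tensor, then
`R(e₁, e₂) = -K j` on `L`, and this defines the curvature `K = ½ tr (j ∘ R(∂_0, ∂_1)) / area(∂_0, ∂_1)`;
i.e. `K = ⟨R(e₁, e₂) s₂, s₁⟩` for positive orthonormal bases `(e₁, e₂)` of the tangent plane and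
`(s₁, s₂)` of `L`. -/
def bundleCurvature (ψ : OpenPartialHomeomorph M (E 4)) (u : E 2 → E 4)
    (j : E 2 → E 4 → E 4) (t : E 2) : ℝ :=
  let proj : E 2 → E 4 → E 4 := fun s v => -j s (j s v)
  let D : Fin 2 → (E 2 → E 4) → (E 2 → E 4) := fun α V s => proj s (covDeriv ψ u V α s)
  let R : E 4 → E 4 := fun v =>
    D 0 (D 1 fun s => proj s v) t - D 1 (D 0 fun s => proj s v) t
  1 / 2 * (∑ i : Fin 4, (j t (R (e i))) i) / areaElement ψ u t

/-- The orthogonal almost complex structure `J_+` (for `s = 1`) or `J_-` (for `s = -1`) along `u`: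
`e₁ ↦ e₂`, `e₃ ↦ s e₄`, for `(e₁, e₂)` a positive orthonormal basis of the tangent plane and
`(e₃, e₄)` one of the normal plane. This is the point of the twistor space given by
`(P ± ⋆P) / √2`, with `P = e₁ ∧ e₂`. -/
def twistorLift (ψ : OpenPartialHomeomorph M (E 4)) (u : E 2 → E 4) (s : ℝ) (t : E 2) (v : E 4) :
    E 4 :=
  rotT ψ u t v + s • rotN ψ u t v

/-- `∇ J = 0` at `t`, i.e. `∇_α (J v) = J (∇_α v)`, tested on the fields `v` along `u` which are
constant in the coordinates. -/
def LiftParallelAt (ψ : OpenPartialHomeomorph M (E 4)) (u : E 2 → E 4) (s : ℝ) (t : E 2) : Prop :=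
  ∀ (α : Fin 2) (v : E 4),
    covDeriv ψ u (fun t' => twistorLift ψ u s t' v) α t =
      twistorLift ψ u s t (covDeriv ψ u (fun _ => v) α t)

end Ambient

section Surface

variable {M : Type*} [TopologicalSpace M] [ChartedSpace (E 4) M]
  {S : Type*} [TopologicalSpace S] [ChartedSpace (E 2) S]

/-- `f` is a smooth immersion. -/
structure IsSmoothImmersion (f : S → M) : Prop where
  smooth : ContMDiff (𝓡 2) (𝓡 4) ∞ f
  injective_mfderiv : ∀ x, Function.Injective (mfderiv (𝓡 2) (𝓡 4) f x)

/-- The only self-intersections of the immersion `f` are transverse double points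
(there may be none). -/
structure HasOnlyTransverseDoublePoints (f : S → M) : Prop where
  no_triple : ∀ x y z, f x = f y → f y = f z → x = y ∨ y = z ∨ x = z
  transverse : ∀ x y, x ≠ y → f x = f y →
    ((mfderiv (𝓡 2) (𝓡 4) f x : E 2 →L[ℝ] E 4).range ⊔
      (mfderiv (𝓡 2) (𝓡 4) f y : E 2 →L[ℝ] E 4).range : Submodule ℝ (E 4)) = ⊤

/-- The genus of the connected surface `S` is at most `g`: at most `g` pairwise disjoint simple
closed curves can be removed from `S` without disconnecting it. -/
def GenusLE (S : Type*) [TopologicalSpace S] (g : ℕ) : Prop :=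
  ∀ (k : ℕ) (c : Fin k → Circle → S), (∀ i, Continuous (c i)) →
    (∀ i, Function.Injective (c i)) →
    (Pairwise fun i j => Disjoint (range (c i)) (range (c j))) →
    IsConnected (⋃ i, range (c i))ᶜ → k ≤ g

variable [RiemannianBundle (fun x : M => TangentSpace (𝓡 4) x)]

/-- The density of the area of `f` with respect to Lebesgue measure in the chart `φ` of `S`:
the square root of the Gram determinant of the two coordinate tangent vectors. -/
def areaDensity (f : S → M) (φ : OpenPartialHomeomorph S (E 2)) (t : E 2) : ℝ :=
  let X : Fin 2 → TangentSpace (𝓡 4) (f (φ.symm t)) :=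
    fun α => mfderiv 𝓘(ℝ, E 2) (𝓡 4) (fun t => f (φ.symm t)) t (e α)
  √(inner ℝ (X 0) (X 0) * inner ℝ (X 1) (X 1) - inner ℝ (X 0) (X 1) ^ 2)

/-- The area measure of the induced metric on `S`: the smallest measure which, in each chart domain,
dominates the measure given there by the area density (the local measures agree on overlaps, so
it coincides with each of them on the corresponding chart domain). -/
def areaMeasure [MeasurableSpace S] (f : S → M) : Measure S :=
  ⨆ x : S, (((volume : Measure (E 2)).restrict (chartAt (E 2) x).target).withDensity
    fun t => ENNReal.ofReal (areaDensity f (chartAt (E 2) x) t)).map (chartAt (E 2) x).symm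

/-- The immersion `f` read in the charts `φ` of `S` and `ψ` of `M`. -/
def inCharts (ψ : OpenPartialHomeomorph M (E 4)) (φ : OpenPartialHomeomorph S (E 2)) (f : S → M) :
    E 2 → E 4 :=
  fun t => ψ (f (φ.symm t))

/-- The curvature `K^T` of the tangent bundle of the surface at `x`, computed in a chart `ψ` of `M`
around `f x` (its value does not depend on the charts). -/
def tangentCurvature (ψ : OpenPartialHomeomorph M (E 4)) (f : S → M) (x : S) : ℝ :=
  let u := inCharts ψ (chartAt (E 2) x) f
  bundleCurvature ψ u (rotT ψ u) (chartAt (E 2) x x)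

/-- The curvature `K^N` of the normal bundle of the surface at `x`, computed in a positively
oriented chart `ψ` of `M` around `f x` (its value does not depend on the charts; a change of the
orientation of the surface changes both `∂_0 ∧ ∂_1` and the orientation of the normal plane). -/
def normalCurvature (ψ : OpenPartialHomeomorph M (E 4)) (f : S → M) (x : S) : ℝ :=
  let u := inCharts ψ (chartAt (E 2) x) f
  bundleCurvature ψ u (rotN ψ u) (chartAt (E 2) x x)

/-- The lift `J_+` (for `s = 1`) or `J_-` (for `s = -1`) of the immersed surface to the twistor space
is parallel along the surface. The surface is locally oriented by its charts: reversing its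
orientation changes `J_±` into `-J_±`, and parallelism is not affected. -/
def LiftParallel (o : OrientedAtlas M) (s : ℝ) (f : S → M) : Prop :=
  ∀ φ ∈ IsManifold.maximalAtlas (𝓡 2) ∞ S, ∀ ψ ∈ o.charts, ∀ t ∈ φ.target,
    f (φ.symm t) ∈ ψ.source → LiftParallelAt ψ (inCharts ψ φ f) s t

/-- Right superminimal: the lift `J_+` is parallel. -/
def RightSuperminimal (o : OrientedAtlas M) (f : S → M) : Prop := LiftParallel o 1 f

/-- Left superminimal: the lift `J_-` is parallel. -/
def LeftSuperminimal (o : OrientedAtlas M) (f : S → M) : Prop := LiftParallel o (-1) f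

end Surface

section Sequence

variable {M : Type*} [EMetricSpace M] [ChartedSpace (E 4) M]

/-- `F`, restricted to the open unit disk of `ℂ`, is a topologically embedded disk in `M`, immersed
off `0` and with `F 0 = p`, given near `0` in suitable local coordinates of `M` by
`z ↦ (Re z^N + o₁(|z|^N), Im z^N + o₁(|z|^N), o₁(|z|^N), o₁(|z|^N))` for some `N ≥ 1`, where
`o₁(|z|^N)` means: `o(|z|^N)` with first partial derivatives `o(|z|^(N-1))`. -/
structure IsBranchedDisk (p : M) (F : ℂ → M) : Prop where
  embedding : IsEmbedding ((Metric.ball (0 : ℂ) 1).domRestrict F)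
  smooth : ContMDiffOn 𝓘(ℝ, ℂ) (𝓡 4) ∞ F (Metric.ball (0 : ℂ) 1 \ {0})
  injective_mfderiv : ∀ z ∈ Metric.ball (0 : ℂ) 1 \ {0},
    Function.Injective (mfderiv 𝓘(ℝ, ℂ) (𝓡 4) F z)
  center : F 0 = p
  expansion : ∃ ψ ∈ IsManifold.maximalAtlas (𝓡 4) ∞ M, p ∈ ψ.source ∧ ∃ N : ℕ, 1 ≤ N ∧
    ∃ r : ℂ → E 4,
      (∀ z, ψ (F z) = ψ p + WithLp.toLp 2 ![(z ^ N).re, (z ^ N).im, 0, 0] + r z) ∧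
      r =o[𝓝[≠] 0] (fun z => ‖z‖ ^ N) ∧
      (fun z => fderiv ℝ r z) =o[𝓝[≠] 0] (fun z => ‖z‖ ^ (N - 1))

variable {S : ℕ → Type*} [∀ n, TopologicalSpace (S n)] [∀ n, ChartedSpace (E 2) (S n)]

/-- The surfaces `f n` converge smoothly and uniformly, on compact sets `K` not containing `p`, to the
union of the disks `F i`: near `K` the part of the `n`-th surface lying in `K` is reparametrized,
for `n` large, by a fixed neighbourhood of the part of the disks lying in `K`, in such a way that
all the derivatives converge locally uniformly. (Only those `K` are considered which do not
reach the ends of the open disks.) -/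
def ConvergesSmoothlyOff (p : M) (f : ∀ n, S n → M) {m : ℕ} (F : Fin m → ℂ → M) : Prop :=
  ∀ K : Set M, IsCompact K → p ∉ K →
    IsCompact {z : Fin m × ℂ | z.2 ∈ Metric.ball (0 : ℂ) 1 ∧ F z.1 z.2 ∈ K} →
    ∃ (U : Fin m → Set ℂ) (G : ∀ n, Fin m → ℂ → S n),
      (∀ i, IsOpen (U i) ∧ U i ⊆ Metric.ball (0 : ℂ) 1 \ {0}) ∧
      (∀ i, ∀ z ∈ Metric.ball (0 : ℂ) 1, F i z ∈ K → z ∈ U i) ∧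
      (∀ᶠ n in atTop,
        (∀ i, ContMDiffOn 𝓘(ℝ, ℂ) (𝓡 2) ∞ (G n i) (U i)) ∧
        InjOn (fun z : Fin m × ℂ => G n z.1 z.2) {z | z.2 ∈ U z.1} ∧
        f n ⁻¹' K ⊆ ⋃ i, G n i '' U i) ∧
      (∀ i, ∀ z ∈ U i, ∀ ψ ∈ IsManifold.maximalAtlas (𝓡 4) ∞ M, F i z ∈ ψ.source →
        ∀ k : ℕ, ∃ V ∈ 𝓝 z, (∀ᶠ n in atTop, MapsTo (fun w => f n (G n i w)) V ψ.source) ∧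
          TendstoUniformlyOn (fun n => iteratedFDeriv ℝ k fun w => ψ (f n (G n i w)))
            (iteratedFDeriv ℝ k fun w => ψ (F i w)) atTop V)

variable [RiemannianBundle (fun x : M => TangentSpace (𝓡 4) x)] [∀ n, MeasurableSpace (S n)]

/-- The situation studied: immersed surfaces `Σ_n = f n (S n)`, with at most transverse double
points, connected, with bounded genera and areas, and without boundary near `p`, converge to a
finite union `Σ_0` of embedded disks branched at `p`, in the Hausdorff sense and smoothly away
from `p`. -/
structure Degeneration (p : M) (f : ∀ n, S n → M) {m : ℕ} (F : Fin m → ℂ → M) : Prop where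
  immersion : ∀ n, IsSmoothImmersion (f n)
  double_points : ∀ n, HasOnlyTransverseDoublePoints (f n)
  connected : ∀ n, ConnectedSpace (S n)
  genus : ∃ g : ℕ, ∀ n, GenusLE (S n) g
  area : ∃ C : ℝ≥0, ∀ n, areaMeasure (f n) univ ≤ C
  proper_near : ∃ K ∈ 𝓝 p, ∀ᶠ n in atTop, IsCompact (f n ⁻¹' K)
  disks : ∀ i, IsBranchedDisk p (F i)
  hausdorff : Tendsto (fun n => Metric.hausdorffEDist (range (f n))
    (⋃ i, F i '' Metric.ball (0 : ℂ) 1)) atTop (𝓝 0)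
  smooth_off : ConvergesSmoothlyOff p f F

/-- `k = (1 / 2π) lim_{ε → 0} lim_{n → ∞} ∫_{Σ_n ∩ B(p, ε)} K_n dA`, where the limits exist; the ball
is taken in the coordinates `ψ`. -/
def IsFallout (ψ : OpenPartialHomeomorph M (E 4)) (p : M) (f : ∀ n, S n → M)
    (K : ∀ n, S n → ℝ) (k : ℝ) : Prop :=
  ∃ L : ℝ → ℝ,
    (∀ᶠ ε in 𝓝[>] (0 : ℝ), Tendsto (fun n =>
      ∫ x in f n ⁻¹' euclideanBall ψ p ε, K n x ∂(areaMeasure (f n))) atTop (𝓝 (L ε))) ∧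
    Tendsto (fun ε => 1 / (2 * Real.pi) * L ε) (𝓝[>] (0 : ℝ)) (𝓝 k)

/-- `k` is the tangent fallout `k^T` at `p`. -/
def IsTangentFallout (ψ : OpenPartialHomeomorph M (E 4)) (p : M) (f : ∀ n, S n → M) (k : ℝ) :
    Prop :=
  IsFallout ψ p f (fun n => tangentCurvature ψ (f n)) k

/-- `k` is the normal fallout `k^N` at `p`. -/
def IsNormalFallout (ψ : OpenPartialHomeomorph M (E 4)) (p : M) (f : ∀ n, S n → M) (k : ℝ) :
    Prop :=
  IsFallout ψ p f (fun n => normalCurvature ψ (f n)) k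

end Sequence

end SurfaceSequence

end

/-!
Let `J = J_±` be the parallel almost complex structure along a superminimal surface, with `s =
±1`, so that `J = j_T + s j_N` for the rotations `j_T`, `j_N` of the tangent and the normal
planes. The claim is `k^T + s k^N = 0`. It follows from two facts: on superminimal surfaces `K^T +
s K^N` is bounded near `p` by a constant which depends on the ambient manifold only, and the area
of `Σ_n ∩ B(p, ε)` tends to `0` with `ε`, uniformly in `n`.

*The curvature bound.* Let `P = -j_T²` be the projection onto the tangent plane. By the Gauss and
Ricci equations (`bundleCurvature_eq`) the curvature of the bundle with rotation `j` is, up to the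
area factor, `½ tr (j F) + ½ tr (j [∇_0 P, ∇_1 P])`, where `F` is the ambient curvature; the
second fundamental form term is the same for both bundles since `∇(1 - P) = -∇P`. In the
combination with weights `1, s` the rotations add up to `J`. As `J` is parallel and commutes with
`P`, it commutes with `∇_α P`, so that `tr (J [∇_0 P, ∇_1 P]) = 0`, and only the ambient curvature
remains (`curvature_add_of_liftParallel`, `exists_curvature_bound`).

*The area bound.* For a field `V` of ambient vectors along the surface the `1`-form `X ↦ ⟨V, J X⟩`
on the surface has differential `-(div V) dA`, because `J` is parallel and the connection is
metric and torsion free (`fderiv_oneForm`). Hence the divergence of a compactly supported field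
integrates to zero (`integral_divAlong_eq_zero`): superminimal surfaces are minimal. This is
applied to `V = χ(|y|²) y`, where `y` are coordinates centred at `p`. Its divergence is at least
`(2 - C|y|) χ - C |χ'(|y|²)| |y|²` (`exists_surfDiv_radial_bound`); the errors come from the
Christoffel symbols and from comparing the metric with the Euclidean one. With a logarithmic
cut-off (`exists_log_cutoff`) the last term is as small as desired, and the area of the part of
the surface where `χ = 1` is at most a small multiple of the total area (`exists_area_bound`). The
total areas are bounded, and near `p` the surfaces have no boundary, so that `V` has compact
support.

The curvatures and the area measure are defined with the preferred charts of the surface. Their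
independence of the charts (`tangentCurvature_eq`, `normalCurvature_eq`, `areaMeasure_restrict`)
gives the continuity, hence the integrability near `p`, of `K^T` and `K^N` separately, which is
needed to add up their integrals, and the divergence theorem on the whole surface from the one in
a chart.
-/

noncomputable section

namespace SurfaceSequence

-- Instance search on iterated spaces of continuous linear maps is expensive.
set_option synthInstance.maxHeartbeats 200000

/-! ### The metric in a chart as a bilinear form -/

/-- The determinant of four vectors of `E 4`. -/
def vol4 (a b c d : E 4) : ℝ := (Matrix.of ![⇑a, ⇑b, ⇑c, ⇑d]).det

lemma vol4_eq (a b c d : E 4) : vol4 a b c d =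
    (a 0 * b 1 - a 1 * b 0) * (c 2 * d 3 - c 3 * d 2)
      - (a 0 * b 2 - a 2 * b 0) * (c 1 * d 3 - c 3 * d 1)
      + (a 0 * b 3 - a 3 * b 0) * (c 1 * d 2 - c 2 * d 1)
      + (a 1 * b 2 - a 2 * b 1) * (c 0 * d 3 - c 3 * d 0)
      - (a 1 * b 3 - a 3 * b 1) * (c 0 * d 2 - c 2 * d 0)
      + (a 2 * b 3 - a 3 * b 2) * (c 0 * d 1 - c 1 * d 0) := by
  simp [vol4, Matrix.det_succ_row_zero, Fin.sum_univ_succ, Fin.succAbove]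
  ring

lemma e_apply {d : ℕ} (i j : Fin d) : (e i : E d) j = if j = i then 1 else 0 := by
  simp [e]

lemma eq_sum_e {d : ℕ} (v : E d) : v = ∑ i, v i • (e i : E d) := by
  ext j
  simp [e_apply]

section

variable {M : Type*} [TopologicalSpace M] [ChartedSpace (E 4) M]
  [RiemannianBundle (fun x : M => TangentSpace (𝓡 4) x)]
  (ψ : OpenPartialHomeomorph M (E 4)) (y : E 4)

lemma chartMetric_comm (v w : E 4) : chartMetric ψ y v w = chartMetric ψ y w v := by
  unfold chartMetric; exact real_inner_comm _ _

lemma chartMetric_add_left (v w x : E 4) :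
    chartMetric ψ y (v + w) x = chartMetric ψ y v x + chartMetric ψ y w x := by
  unfold chartMetric
  exact (congrArg (fun z : TangentSpace (𝓡 4) (ψ.symm y) => inner ℝ z _)
    (map_add (mfderiv 𝓘(ℝ, E 4) (𝓡 4) ψ.symm y) v w)).trans (inner_add_left _ _ _)

lemma chartMetric_smul_left (c : ℝ) (v x : E 4) :
    chartMetric ψ y (c • v) x = c * chartMetric ψ y v x := by
  unfold chartMetric
  exact (congrArg (fun z : TangentSpace (𝓡 4) (ψ.symm y) => inner ℝ z _)
    (map_smul (mfderiv 𝓘(ℝ, E 4) (𝓡 4) ψ.symm y) c v)).trans (real_inner_smul_left _ _ _)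

/-- The metric read in the chart `ψ`, as a continuous bilinear form. -/
def metricForm : E 4 →L[ℝ] E 4 →L[ℝ] ℝ :=
  ∑ i, ∑ j, gram ψ y i j •
    (EuclideanSpace.proj i : E 4 →L[ℝ] ℝ).smulRight (EuclideanSpace.proj j : E 4 →L[ℝ] ℝ)

lemma metricForm_eq_sum (v w : E 4) :
    metricForm ψ y v w = ∑ i, ∑ j, gram ψ y i j * (v i * w j) := by
  simp [metricForm]

lemma metricForm_apply (v w : E 4) : metricForm ψ y v w = chartMetric ψ y v w := by
  let B : E 4 →ₗ[ℝ] E 4 →ₗ[ℝ] ℝ := LinearMap.mk₂ ℝ (chartMetric ψ y)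
    (chartMetric_add_left ψ y) (chartMetric_smul_left ψ y)
    (fun m n₁ n₂ => by
      rw [chartMetric_comm, chartMetric_add_left, chartMetric_comm ψ y n₁, chartMetric_comm ψ y n₂])
    (fun c m n => by rw [chartMetric_comm, chartMetric_smul_left, chartMetric_comm ψ y n, smul_eq_mul])
  have hB : B v w = chartMetric ψ y v w := rfl
  rw [← hB]
  have h1 : B v w = ∑ i, ∑ j, v i * (w j * B (e i) (e j)) := by
    conv_lhs => rw [eq_sum_e v, eq_sum_e w]
    simp only [map_sum, map_smul, LinearMap.coe_sum, Finset.sum_apply, LinearMap.smul_apply,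
      smul_eq_mul, Finset.mul_sum]
    rw [Finset.sum_comm]
    exact Finset.sum_congr rfl fun i _ => Finset.sum_congr rfl fun j _ => by ring
  rw [metricForm_eq_sum, h1]
  refine Finset.sum_congr rfl fun i _ => Finset.sum_congr rfl fun j _ => ?_
  simp only [gram, B, Matrix.of_apply, LinearMap.mk₂_apply]
  ring

lemma metricForm_comm (v w : E 4) : metricForm ψ y v w = metricForm ψ y w v := by
  simp only [metricForm_apply, chartMetric_comm]

lemma gram_symm (i j : Fin 4) : gram ψ y i j = gram ψ y j i := by
  simp only [gram, Matrix.of_apply, chartMetric_comm]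

/-- The bilinear map `Γ(v, w)` of the Levi-Civita connection in the chart `ψ`, as a continuous
bilinear map; `christoffelForm ψ y v` is the connection matrix in the direction `v`. -/
def christoffelForm : E 4 →L[ℝ] E 4 →L[ℝ] E 4 :=
  ∑ k, ∑ i, ∑ j, christoffel ψ y k i j •
    (EuclideanSpace.proj i : E 4 →L[ℝ] ℝ).smulRight
      ((EuclideanSpace.proj j : E 4 →L[ℝ] ℝ).smulRight (e k : E 4))

lemma christoffelForm_apply (v w : E 4) :
    christoffelForm ψ y v w = christoffelMap ψ y v w := by
  ext k
  simp only [christoffelForm, christoffelMap, sum_apply,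
    smul_apply, ContinuousLinearMap.smulRight_apply, EuclideanSpace.coe_proj,
    WithLp.ofLp_sum, WithLp.ofLp_smul, Finset.sum_apply, Pi.smul_apply, e_apply, smul_eq_mul]
  rw [Finset.sum_eq_single k]
  · refine Finset.sum_congr rfl fun i _ => Finset.sum_congr rfl fun j _ => ?_
    simp; ring
  · intro l _ hl
    simp [hl.symm]
  · simp

lemma christoffel_symm (k i j : Fin 4) : christoffel ψ y k i j = christoffel ψ y k j i := by
  unfold christoffel
  congr 1
  refine Finset.sum_congr rfl fun l _ => ?_
  have : (fun y => gram ψ y i j) = fun y => gram ψ y j i := funext fun y => gram_symm ψ y i j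
  rw [this]
  ring

lemma christoffelForm_comm (v w : E 4) : christoffelForm ψ y v w = christoffelForm ψ y w v := by
  rw [christoffelForm_apply, christoffelForm_apply]
  ext k
  simp only [christoffelMap]
  rw [Finset.sum_comm]
  refine Finset.sum_congr rfl fun i _ => Finset.sum_congr rfl fun j _ => ?_
  rw [christoffel_symm]; ring

end

/-! ### Smoothness and positivity of the metric -/

section

variable {M : Type*} [TopologicalSpace M] [ChartedSpace (E 4) M] [IsManifold (𝓡 4) ∞ M]
  [RiemannianBundle (fun x : M => TangentSpace (𝓡 4) x)]
  {ψ : OpenPartialHomeomorph M (E 4)}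

lemma mdifferentiable_of_mem_maximalAtlas {n : ℕ} {S : Type*} [TopologicalSpace S]
    [ChartedSpace (E n) S] [IsManifold (𝓡 n) ∞ S] {φ : OpenPartialHomeomorph S (E n)}
    (hφ : φ ∈ IsManifold.maximalAtlas (𝓡 n) ∞ S) : φ.MDifferentiable (𝓡 n) (𝓡 n) :=
  ⟨(contMDiffOn_of_mem_maximalAtlas hφ).mdifferentiableOn (by simp),
    (contMDiffOn_symm_of_mem_maximalAtlas hφ).mdifferentiableOn (by simp)⟩

lemma gram_posDef (hψ : ψ ∈ IsManifold.maximalAtlas (𝓡 4) ∞ M) {y : E 4} (hy : y ∈ ψ.target) :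
    (gram ψ y).PosDef := by
  refine Matrix.PosDef.of_dotProduct_mulVec_pos ?_ ?_
  · ext i j
    simpa using gram_symm ψ y j i
  · intro x hx
    have h1 : star x ⬝ᵥ (gram ψ y).mulVec x = metricForm ψ y (WithLp.toLp 2 x) (WithLp.toLp 2 x) := by
      simp only [metricForm_eq_sum, dotProduct, Matrix.mulVec, Finset.mul_sum, Pi.star_apply,
        star_trivial]
      exact Finset.sum_congr rfl fun i _ => Finset.sum_congr rfl fun j _ => by ring
    rw [h1, metricForm_apply]
    unfold chartMetric
    have hinj := (mdifferentiable_of_mem_maximalAtlas hψ).symm.mfderiv_injective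
      (x := y) (by simpa using hy)
    refine real_inner_self_pos.2 fun h0 => hx ?_
    exact congrArg WithLp.ofLp (hinj (h0.trans (map_zero _).symm))

lemma metricForm_pos (hψ : ψ ∈ IsManifold.maximalAtlas (𝓡 4) ∞ M) {y : E 4} (hy : y ∈ ψ.target)
    {v : E 4} (hv : v ≠ 0) : 0 < metricForm ψ y v v := by
  rw [metricForm_apply]
  unfold chartMetric
  have hinj := (mdifferentiable_of_mem_maximalAtlas hψ).symm.mfderiv_injective
    (x := y) (by simpa using hy)
  exact real_inner_self_pos.2 fun h0 => hv (hinj (h0.trans (map_zero _).symm))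

variable [IsContMDiffRiemannianBundle (𝓡 4) ∞ (E 4) (fun x : M => TangentSpace (𝓡 4) x)]

lemma contDiffOn_gram (hψ : ψ ∈ IsManifold.maximalAtlas (𝓡 4) ∞ M) (i j : Fin 4) :
    ContDiffOn ℝ ∞ (fun y => gram ψ y i j) ψ.target := by
  have hs : ∀ v : E 4, ContMDiffOn 𝓘(ℝ, E 4) (𝓡 4).tangent ∞
      (fun y => (⟨ψ.symm y, mfderiv 𝓘(ℝ, E 4) (𝓡 4) ψ.symm y v⟩ : TangentBundle (𝓡 4) M))
      ψ.target := by
    intro v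
    have h1 := (contMDiffOn_symm_of_mem_maximalAtlas hψ).contMDiffOn_tangentMapWithin
      (m := ∞) (by simp) ψ.open_target.uniqueMDiffOn
    have h2 : ContMDiff 𝓘(ℝ, E 4) 𝓘(ℝ, E 4).tangent ∞
        (fun y : E 4 => (⟨y, v⟩ : TangentBundle 𝓘(ℝ, E 4) (E 4))) := by
      rw [contMDiff_vectorSpace_iff_contDiff (V := fun _ => v)]
      exact contDiff_const
    have h3 := h1.comp h2.contMDiffOn (s := ψ.target) (fun y hy => hy)
    refine h3.congr fun y hy => ?_
    simp only [Function.comp, tangentMapWithin]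
    rw [mfderivWithin_of_isOpen ψ.open_target hy]
  have := (hs (e i)).inner_bundle (hs (e j))
  exact contMDiffOn_iff_contDiffOn.1 this

end

/-! ### Adapted orthonormal frames -/

section

variable {M : Type*} [TopologicalSpace M] [ChartedSpace (E 4) M]
  [RiemannianBundle (fun x : M => TangentSpace (𝓡 4) x)]
  {ψ : OpenPartialHomeomorph M (E 4)}

/-- Square root of the metric: it is the pull-back of the Euclidean inner product by a linear
isomorphism. -/
lemma exists_isometry_of_posDef {y : E 4} (hg : (gram ψ y).PosDef) :
    ∃ A : E 4 ≃ₗ[ℝ] E 4, ∀ v w, metricForm ψ y v w = inner ℝ (A v) (A w) := by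
  open scoped MatrixOrder Matrix.Norms.L2Operator in
  obtain ⟨B, hB, hgB⟩ := CStarAlgebra.isStrictlyPositive_iff_eq_star_mul_self.mp
    hg.isStrictlyPositive
  have h1 : B⁻¹ * B = 1 := Matrix.nonsing_inv_mul B ((Matrix.isUnit_iff_isUnit_det B).1 hB)
  have h2 : B * B⁻¹ = 1 := Matrix.mul_nonsing_inv B ((Matrix.isUnit_iff_isUnit_det B).1 hB)
  refine ⟨LinearEquiv.ofLinearMap (Matrix.toLpLin 2 2 B) (Matrix.toLpLin 2 2 B⁻¹) ?_ ?_, fun v w => ?_⟩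
  · rw [← Matrix.toLpLin_mul_same, h2]; simp
  · rw [← Matrix.toLpLin_mul_same, h1]; simp
  · have : metricForm ψ y v w = ⇑v ⬝ᵥ ((gram ψ y).mulVec ⇑w) := by
      simp only [metricForm_eq_sum, dotProduct, Matrix.mulVec, Finset.mul_sum]
      exact Finset.sum_congr rfl fun i _ => Finset.sum_congr rfl fun j _ => by ring
    rw [this, hgB, ← Matrix.mulVec_mulVec, Matrix.dotProduct_mulVec]
    simp [EuclideanSpace.inner_eq_star_dotProduct, Matrix.star_eq_conjTranspose,
      Matrix.vecMul_transpose, dotProduct_comm]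

variable (ψ) in
/-- A positively oriented orthonormal frame `ε` of the ambient tangent space whose first two
vectors span, compatibly with the orientation, the plane spanned by `X₀, X₁`; the numbers `α, β, γ`
are the coefficients of `X₀, X₁` in the frame. -/
structure AdaptedFrame (y X₀ X₁ : E 4) (ε : Fin 4 → E 4) (α β γ : ℝ) : Prop where
  orthonormal : ∀ i j, metricForm ψ y (ε i) (ε j) = if i = j then 1 else 0
  positive : √(gram ψ y).det * vol4 (ε 0) (ε 1) (ε 2) (ε 3) = 1
  pos_left : 0 < α
  pos_right : 0 < γ
  eq_left : X₀ = α • ε 0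
  eq_right : X₁ = β • ε 0 + γ • ε 1

lemma sq_sqrt_det_mul_vol4 {y : E 4} (hg : (gram ψ y).PosDef) {ε : Fin 4 → E 4}
    (h : ∀ i j, metricForm ψ y (ε i) (ε j) = if i = j then 1 else 0) :
    (√(gram ψ y).det * vol4 (ε 0) (ε 1) (ε 2) (ε 3)) ^ 2 = 1 := by
  let V : Matrix (Fin 4) (Fin 4) ℝ := Matrix.of fun i => ⇑(ε i)
  have hV : vol4 (ε 0) (ε 1) (ε 2) (ε 3) = V.det := by
    unfold vol4
    congr 1
    ext i j
    fin_cases i <;> rfl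
  have h1 : V * gram ψ y * V.transpose = 1 := by
    ext i j
    have := h i j
    rw [metricForm_eq_sum] at this
    rw [Matrix.one_apply, ← this, Matrix.mul_apply]
    simp only [Matrix.mul_apply, Matrix.transpose_apply, Finset.sum_mul]
    rw [Finset.sum_comm]
    refine Finset.sum_congr rfl fun k _ => Finset.sum_congr rfl fun l _ => ?_
    simp only [V, Matrix.of_apply]
    ring
  have h2 := congrArg Matrix.det h1
  rw [Matrix.det_mul, Matrix.det_mul, Matrix.det_transpose, Matrix.det_one] at h2
  rw [mul_pow, Real.sq_sqrt hg.det_pos.le, hV, ← h2]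
  ring

/-- Gram-Schmidt applied to the two spanning vectors, followed by a choice of signs. -/
lemma exists_adaptedFrame {y : E 4} (hg : (gram ψ y).PosDef) {X₀ X₁ : E 4}
    (hX : LinearIndependent ℝ ![X₀, X₁]) :
    ∃ ε α β γ, AdaptedFrame ψ y X₀ X₁ ε α β γ := by
  obtain ⟨A, hA⟩ := exists_isometry_of_posDef hg
  have hcard : Module.finrank ℝ (E 4) = Fintype.card (Fin 4) := by simp
  let b : OrthonormalBasis (Fin 4) ℝ (E 4) :=
    InnerProductSpace.gramSchmidtOrthonormalBasis hcard ![A X₀, A X₁, 0, 0]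
  have hb0 : ∀ i : Fin 4, 0 < i → inner ℝ (b i) (A X₀) = 0 := fun i hi =>
    InnerProductSpace.gramSchmidtOrthonormalBasis_inv_triangular hcard
      ![A X₀, A X₁, 0, 0] hi
  have hb1 : ∀ i : Fin 4, 1 < i → inner ℝ (b i) (A X₁) = 0 := fun i hi =>
    InnerProductSpace.gramSchmidtOrthonormalBasis_inv_triangular hcard
      ![A X₀, A X₁, 0, 0] hi
  have hX0 : X₀ = (inner ℝ (b 0) (A X₀)) • A.symm (b 0) := by
    apply A.injective
    conv_lhs => rw [← b.sum_repr' (A X₀)]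
    simp [Fin.sum_univ_four, hb0]
  have hX1 : X₁ = (inner ℝ (b 0) (A X₁)) • A.symm (b 0) + (inner ℝ (b 1) (A X₁)) • A.symm (b 1) := by
    apply A.injective
    conv_lhs => rw [← b.sum_repr' (A X₁)]
    simp [Fin.sum_univ_four, hb1]
  set α := inner ℝ (b 0) (A X₀)
  set β := inner ℝ (b 0) (A X₁)
  set γ := inner ℝ (b 1) (A X₁)
  rw [LinearIndependent.pair_iff] at hX
  have hα : α ≠ 0 := fun h0 => by
    have := hX 1 0 (by rw [hX0, h0]; simp)
    simp at this
  have hγ : γ ≠ 0 := fun h0 => by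
    have := hX (-β) α (by
      conv_lhs => rw [hX1, h0]
      conv_lhs => lhs; rw [hX0]
      module)
    exact hα this.2
  have hort : ∀ i j, metricForm ψ y (A.symm (b i)) (A.symm (b j)) = if i = j then 1 else 0 := by
    intro i j
    rw [hA, A.apply_symm_apply, A.apply_symm_apply]
    exact orthonormal_iff_ite.1 b.orthonormal i j
  have hd := sq_sqrt_det_mul_vol4 hg hort
  set d := √(gram ψ y).det * vol4 (A.symm (b 0)) (A.symm (b 1)) (A.symm (b 2)) (A.symm (b 3)) with hd_def
  -- The signs make the coefficients `α`, `γ` and the orientation positive.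
  let s0 : ℝ := α / |α|
  let s1 : ℝ := γ / |γ|
  have hs0 : s0 * s0 = 1 := by
    simp only [s0]; field_simp; rw [sq_abs]
  have hs1 : s1 * s1 = 1 := by
    simp only [s1]; field_simp; rw [sq_abs]
  have hα' : |α| * s0 = α := by simp only [s0]; field_simp
  have hγ' : |γ| * s1 = γ := by simp only [s1]; field_simp
  let s : Fin 4 → ℝ := ![s0, s1, 1, s0 * s1 * d]
  have hs : ∀ i, s i * s i = 1 := by
    intro i
    fin_cases i
    · exact hs0
    · exact hs1
    · simp [s]
    · change s0 * s1 * d * (s0 * s1 * d) = 1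
      linear_combination (s1 * s1 * d ^ 2) * hs0 + d ^ 2 * hs1 + hd
  refine ⟨fun i => s i • A.symm (b i), |α|, β * s0, |γ|, ?_, ?_, abs_pos.2 hα, abs_pos.2 hγ, ?_, ?_⟩
  · intro i j
    simp only [map_smul, smul_apply, smul_eq_mul, hort]
    split_ifs with hij
    · subst hij; linear_combination hs i
    · simp
  · have : √(gram ψ y).det * vol4 (s 0 • A.symm (b 0)) (s 1 • A.symm (b 1)) (s 2 • A.symm (b 2))
        (s 3 • A.symm (b 3)) = s 0 * s 1 * s 2 * s 3 * d := by
      rw [hd_def, vol4_eq, vol4_eq]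
      simp only [PiLp.smul_apply, smul_eq_mul]
      ring
    rw [this]
    change s0 * s1 * 1 * (s0 * s1 * d) * d = 1
    linear_combination (s1 * s1 * d ^ 2) * hs0 + d ^ 2 * hs1 + hd
  · change X₀ = |α| • s0 • _
    rw [smul_smul, hα']; exact hX0
  · change X₁ = (β * s0) • s0 • _ + |γ| • s1 • _
    rw [smul_smul, smul_smul, hγ', mul_assoc, hs0, mul_one]; exact hX1

namespace AdaptedFrame

variable {y X₀ X₁ : E 4} {ε : Fin 4 → E 4} {α β γ : ℝ} (h : AdaptedFrame ψ y X₀ X₁ ε α β γ)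
include h

lemma linearIndependent : LinearIndependent ℝ ε := by
  rw [Fintype.linearIndependent_iff]
  intro c hc i
  have := congrArg (metricForm ψ y (ε i)) hc
  simpa [h.orthonormal] using this

/-- The adapted frame as a basis. -/
def basis : Module.Basis (Fin 4) ℝ (E 4) :=
  basisOfLinearIndependentOfCardEqFinrank h.linearIndependent (by simp)

lemma basis_apply (i : Fin 4) : h.basis i = ε i := by simp [basis]

lemma repr_apply (v : E 4) (i : Fin 4) : h.basis.repr v i = metricForm ψ y (ε i) v := by
  conv_rhs => rw [← h.basis.sum_repr v]
  simp [h.basis_apply, h.orthonormal]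

lemma sum_eq (v : E 4) : ∑ i, metricForm ψ y (ε i) v • ε i = v := by
  conv_rhs => rw [← h.basis.sum_repr v]
  simp [h.basis_apply, h.repr_apply]

lemma ext {v w : E 4} (hvw : ∀ i, metricForm ψ y (ε i) v = metricForm ψ y (ε i) w) : v = w := by
  rw [← h.sum_eq v, ← h.sum_eq w]; simp [hvw]

lemma ext_clm {A B : E 4 →L[ℝ] E 4} (hAB : ∀ i, A (ε i) = B (ε i)) : A = B := by
  ext1 v
  rw [← h.sum_eq v]
  simp [hAB]

end AdaptedFrame

end

/-- The trace of an endomorphism of `E 4`. -/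
def tr (A : E 4 →L[ℝ] E 4) : ℝ := ∑ i, (A (e i)) i

lemma tr_eq_trace (A : E 4 →L[ℝ] E 4) : tr A = LinearMap.trace ℝ (E 4) A := by
  rw [LinearMap.trace_eq_matrix_trace ℝ (EuclideanSpace.basisFun (Fin 4) ℝ).toBasis]
  simp [tr, Matrix.trace, LinearMap.toMatrix_apply, e]

lemma tr_mul_comm (A B : E 4 →L[ℝ] E 4) : tr (A * B) = tr (B * A) := by
  rw [tr_eq_trace, tr_eq_trace]
  exact LinearMap.trace_mul_comm ℝ (A : E 4 →ₗ[ℝ] E 4) (B : E 4 →ₗ[ℝ] E 4)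

lemma tr_add (A B : E 4 →L[ℝ] E 4) : tr (A + B) = tr A + tr B := by
  simp [tr, Finset.sum_add_distrib]

lemma tr_sub (A B : E 4 →L[ℝ] E 4) : tr (A - B) = tr A - tr B := by
  simp [tr]

lemma tr_smul (c : ℝ) (A : E 4 →L[ℝ] E 4) : tr (c • A) = c * tr A := by
  simp [tr, Finset.mul_sum]

lemma AdaptedFrame.tr_eq {M : Type*} [TopologicalSpace M] [ChartedSpace (E 4) M]
    [RiemannianBundle (fun x : M => TangentSpace (𝓡 4) x)] {ψ : OpenPartialHomeomorph M (E 4)}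
    {y X₀ X₁ : E 4} {ε : Fin 4 → E 4} {α β γ : ℝ} (h : AdaptedFrame ψ y X₀ X₁ ε α β γ)
    (A : E 4 →L[ℝ] E 4) : tr A = ∑ i, metricForm ψ y (ε i) (A (ε i)) := by
  rw [tr_eq_trace, LinearMap.trace_eq_matrix_trace ℝ h.basis]
  simp [Matrix.trace, LinearMap.toMatrix_apply, h.repr_apply, h.basis_apply]

/-! ### The rotations of the tangent and the normal planes -/

section

variable {M : Type*} [TopologicalSpace M] [ChartedSpace (E 4) M]
  [RiemannianBundle (fun x : M => TangentSpace (𝓡 4) x)]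
  (ψ : OpenPartialHomeomorph M (E 4)) (u : E 2 → E 4) (t : E 2)

/-- The rotation `rotT` of the tangent plane as a continuous linear map. -/
def rotTL : E 4 →L[ℝ] E 4 :=
  (areaElement ψ u t)⁻¹ •
    ((metricForm ψ (u t) (tangentVec u t 0)).smulRight (tangentVec u t 1) -
      (metricForm ψ (u t) (tangentVec u t 1)).smulRight (tangentVec u t 0))

lemma rotTL_apply (v : E 4) : rotTL ψ u t v = rotT ψ u t v := by
  simp [rotTL, rotT, metricForm_apply]

lemma rotN_apply (v : E 4) (k : Fin 4) : rotN ψ u t v k = ∑ l, (gram ψ (u t))⁻¹ k l *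
    ((areaElement ψ u t)⁻¹ * √(gram ψ (u t)).det *
      vol4 (tangentVec u t 0) (tangentVec u t 1) v (e l)) := rfl

/-- The rotation `rotN` of the normal plane as a continuous linear map. -/
def rotNL : E 4 →L[ℝ] E 4 :=
  LinearMap.toContinuousLinearMap
    { toFun := rotN ψ u t
      map_add' := fun v w => by
        ext k
        simp only [rotN_apply, PiLp.add_apply, ← Finset.sum_add_distrib, vol4_eq]
        exact Finset.sum_congr rfl fun l _ => by ring
      map_smul' := fun c v => by
        ext k
        simp only [rotN_apply, PiLp.smul_apply, smul_eq_mul, Finset.mul_sum, vol4_eq,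
          RingHom.id_apply]
        exact Finset.sum_congr rfl fun l _ => by ring }

lemma rotNL_apply (v : E 4) : rotNL ψ u t v = rotN ψ u t v := rfl

/-- The normal rotation is dual, under the metric, to the ambient volume form contracted with the
unit tangent `2`-vector. -/
lemma metricForm_rotN (hg : (gram ψ (u t)).PosDef) (v w : E 4) :
    metricForm ψ (u t) w (rotN ψ u t v) = (areaElement ψ u t)⁻¹ * √(gram ψ (u t)).det *
      vol4 (tangentVec u t 0) (tangentVec u t 1) v w := by
  let c : Fin 4 → ℝ := fun l => (areaElement ψ u t)⁻¹ * √(gram ψ (u t)).det *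
      vol4 (tangentVec u t 0) (tangentVec u t 1) v (e l)
  have h1 : ⇑(rotN ψ u t v) = ((gram ψ (u t))⁻¹).mulVec c := by
    ext k; rw [rotN_apply]; rfl
  have h2 : metricForm ψ (u t) w (rotN ψ u t v) = ⇑w ⬝ᵥ (gram ψ (u t)).mulVec ⇑(rotN ψ u t v) := by
    simp only [metricForm_eq_sum, dotProduct, Matrix.mulVec, Finset.mul_sum]
    exact Finset.sum_congr rfl fun i _ => Finset.sum_congr rfl fun j _ => by ring
  rw [h2, h1, Matrix.mulVec_mulVec, Matrix.mul_nonsing_inv _ hg.det_pos.ne'.isUnit,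
    Matrix.one_mulVec]
  simp only [dotProduct, c, vol4_eq, Fin.sum_univ_four, e_apply]
  simp
  ring

end

namespace AdaptedFrame

variable {M : Type*} [TopologicalSpace M] [ChartedSpace (E 4) M]
  [RiemannianBundle (fun x : M => TangentSpace (𝓡 4) x)]
  {ψ : OpenPartialHomeomorph M (E 4)} {u : E 2 → E 4} {t : E 2} {ε : Fin 4 → E 4} {α β γ : ℝ}
  (h : AdaptedFrame ψ (u t) (tangentVec u t 0) (tangentVec u t 1) ε α β γ)
include h

lemma areaElement_eq : areaElement ψ u t = α * γ := by
  rw [areaElement]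
  simp only [← metricForm_apply]
  rw [h.eq_left, h.eq_right]
  simp only [map_add, map_smul, add_apply, smul_apply, smul_eq_mul, h.orthonormal]
  norm_num
  rw [Real.sqrt_eq_iff_mul_self_eq_of_pos (mul_pos h.pos_left h.pos_right)]
  ring

lemma rotTL_zero : rotTL ψ u t (ε 0) = ε 1 := by
  have h1 := h.pos_left.ne'
  have h2 := h.pos_right.ne'
  rw [rotTL, h.areaElement_eq, h.eq_left, h.eq_right]
  simp only [map_add, map_smul, add_apply, smul_apply, sub_apply, h.orthonormal,
    ContinuousLinearMap.smulRight_apply, smul_eq_mul]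
  norm_num
  match_scalars
  · field_simp
    ring
  · field_simp

lemma rotTL_one : rotTL ψ u t (ε 1) = -ε 0 := by
  have h1 := h.pos_left.ne'
  have h2 := h.pos_right.ne'
  rw [rotTL, h.areaElement_eq, h.eq_left, h.eq_right]
  simp only [map_add, map_smul, add_apply, smul_apply, sub_apply, h.orthonormal,
    ContinuousLinearMap.smulRight_apply, smul_eq_mul]
  norm_num
  match_scalars
  field_simp

lemma rotTL_two : rotTL ψ u t (ε 2) = 0 := by
  rw [rotTL, h.eq_left, h.eq_right]
  simp [h.orthonormal]

lemma rotTL_three : rotTL ψ u t (ε 3) = 0 := by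
  rw [rotTL, h.eq_left, h.eq_right]
  simp [h.orthonormal]

variable (hg : (gram ψ (u t)).PosDef)
include hg

lemma metricForm_rotNL (i : Fin 4) (v : E 4) : metricForm ψ (u t) (ε i) (rotNL ψ u t v) =
    √(gram ψ (u t)).det * vol4 (ε 0) (ε 1) v (ε i) := by
  have h1 := h.pos_left.ne'
  have h2 := h.pos_right.ne'
  rw [rotNL_apply, metricForm_rotN ψ u t hg, h.areaElement_eq, h.eq_left, h.eq_right]
  have : vol4 (α • ε 0) (β • ε 0 + γ • ε 1) v (ε i) = α * γ * vol4 (ε 0) (ε 1) v (ε i) := by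
    simp only [vol4_eq, PiLp.add_apply, PiLp.smul_apply, smul_eq_mul]
    ring
  rw [this]
  field_simp

lemma rotNL_zero : rotNL ψ u t (ε 0) = 0 := by
  refine h.ext fun i => ?_
  rw [h.metricForm_rotNL hg, map_zero, vol4_eq]; ring

lemma rotNL_one : rotNL ψ u t (ε 1) = 0 := by
  refine h.ext fun i => ?_
  rw [h.metricForm_rotNL hg, map_zero, vol4_eq]; ring

lemma rotNL_two : rotNL ψ u t (ε 2) = ε 3 := by
  refine h.ext fun i => ?_
  rw [h.metricForm_rotNL hg, h.orthonormal]
  have hp := h.positive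
  simp only [vol4_eq] at hp ⊢
  fin_cases i <;> simp
  · right; ring
  · right; ring
  · right; ring
  · exact hp

lemma rotNL_three : rotNL ψ u t (ε 3) = -ε 2 := by
  refine h.ext fun i => ?_
  rw [h.metricForm_rotNL hg, map_neg, h.orthonormal]
  have hp := h.positive
  simp only [vol4_eq] at hp ⊢
  fin_cases i <;> simp
  · right; ring
  · right; ring
  · linear_combination -hp
  · right; ring

end AdaptedFrame

/-- Two complex structures on complementary subspaces, extended by zero, satisfy `a³ = -a`. -/
lemma mul_mul_self_eq_neg {R : Type*} [Ring R] {a b : R} (h : a * a + b * b = -1)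
    (hab : a * b = 0) : a * a * a = -a := by
  have h := congrArg (a * ·) h
  simp only [mul_add, ← mul_assoc, hab, zero_mul, add_zero, mul_neg, mul_one] at h
  exact h

section

variable {M : Type*} [TopologicalSpace M] [ChartedSpace (E 4) M]
  [RiemannianBundle (fun x : M => TangentSpace (𝓡 4) x)]
  {ψ : OpenPartialHomeomorph M (E 4)} {u : E 2 → E 4} {t : E 2}

section Pointwise

variable (hg : (gram ψ (u t)).PosDef)
include hg

variable (hX : LinearIndependent ℝ ![tangentVec u t 0, tangentVec u t 1])
include hX

lemma areaElement_pos : 0 < areaElement ψ u t := by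
  obtain ⟨ε, α, β, γ, h⟩ := exists_adaptedFrame hg hX
  rw [h.areaElement_eq]
  exact mul_pos h.pos_left h.pos_right

lemma rotTL_mul_rotNL : rotTL ψ u t * rotNL ψ u t = 0 := by
  obtain ⟨ε, α, β, γ, h⟩ := exists_adaptedFrame hg hX
  refine h.ext_clm fun i => ?_
  fin_cases i <;> simp [h.rotTL_two, h.rotTL_three, h.rotNL_zero hg,
    h.rotNL_one hg, h.rotNL_two hg, h.rotNL_three hg]

lemma rotNL_mul_rotTL : rotNL ψ u t * rotTL ψ u t = 0 := by
  obtain ⟨ε, α, β, γ, h⟩ := exists_adaptedFrame hg hX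
  refine h.ext_clm fun i => ?_
  fin_cases i <;> simp [h.rotTL_zero, h.rotTL_one, h.rotTL_two, h.rotTL_three, h.rotNL_zero hg,
    h.rotNL_one hg]

lemma rotTL_sq_add_rotNL_sq :
    rotTL ψ u t * rotTL ψ u t + rotNL ψ u t * rotNL ψ u t = -1 := by
  obtain ⟨ε, α, β, γ, h⟩ := exists_adaptedFrame hg hX
  refine h.ext_clm fun i => ?_
  fin_cases i <;> simp [h.rotTL_zero, h.rotTL_one, h.rotTL_two, h.rotTL_three, h.rotNL_zero hg,
    h.rotNL_one hg, h.rotNL_two hg, h.rotNL_three hg]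

lemma rotTL_cube : rotTL ψ u t * rotTL ψ u t * rotTL ψ u t = -rotTL ψ u t :=
  mul_mul_self_eq_neg (rotTL_sq_add_rotNL_sq hg hX) (rotTL_mul_rotNL hg hX)

lemma rotNL_cube : rotNL ψ u t * rotNL ψ u t * rotNL ψ u t = -rotNL ψ u t :=
  mul_mul_self_eq_neg ((add_comm _ _).trans (rotTL_sq_add_rotNL_sq hg hX)) (rotNL_mul_rotTL hg hX)

end Pointwise

end

/-! ### Smooth dependence on the parameter -/

section

variable {M : Type*} [TopologicalSpace M] [ChartedSpace (E 4) M] [IsManifold (𝓡 4) ∞ M]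
  [RiemannianBundle (fun x : M => TangentSpace (𝓡 4) x)]
  [IsContMDiffRiemannianBundle (𝓡 4) ∞ (E 4) (fun x : M => TangentSpace (𝓡 4) x)]
  {ψ : OpenPartialHomeomorph M (E 4)} (hψ : ψ ∈ IsManifold.maximalAtlas (𝓡 4) ∞ M)

lemma _root_.ContDiffOn.smul_const_right {F V : Type*} [NormedAddCommGroup F] [NormedSpace ℝ F]
    [NormedAddCommGroup V] [NormedSpace ℝ V] {f : F → ℝ} {s : Set F} (h : ContDiffOn ℝ ∞ f s)
    (c : V) : ContDiffOn ℝ ∞ (fun y => f y • c) s :=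
  h.smul contDiffOn_const

lemma contDiffOn_det {F : Type*} [NormedAddCommGroup F] [NormedSpace ℝ F] {n : ℕ} {s : Set F}
    {A : F → Matrix (Fin n) (Fin n) ℝ}
    (h : ∀ i j, ContDiffOn ℝ ∞ (fun y => A y i j) s) : ContDiffOn ℝ ∞ (fun y => (A y).det) s := by
  simp only [Matrix.det_apply]
  refine ContDiffOn.sum fun σ _ => ?_
  exact (contDiffOn_prod fun i _ => h _ _).const_smul _

include hψ

lemma contDiffOn_gram_inv (i j : Fin 4) :
    ContDiffOn ℝ ∞ (fun y => (gram ψ y)⁻¹ i j) ψ.target := by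
  simp only [Matrix.inv_def, Ring.inverse_eq_inv', Matrix.smul_apply, smul_eq_mul,
    Matrix.adjugate_apply]
  refine ContDiffOn.mul (ContDiffOn.inv (contDiffOn_det (contDiffOn_gram hψ))
    fun y hy => (gram_posDef hψ hy).det_pos.ne') (contDiffOn_det fun k l => ?_)
  by_cases hk : k = j
  · subst hk
    simp only [Matrix.updateRow_self]
    exact contDiffOn_const
  · simp only [Matrix.updateRow_ne hk]
    exact contDiffOn_gram hψ k l

lemma contDiffOn_metricForm : ContDiffOn ℝ ∞ (metricForm ψ) ψ.target := by
  unfold metricForm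
  exact ContDiffOn.sum fun i _ => ContDiffOn.sum fun j _ =>
    (contDiffOn_gram hψ i j).smul_const_right _

lemma contDiffOn_christoffel (k i j : Fin 4) :
    ContDiffOn ℝ ∞ (fun y => christoffel ψ y k i j) ψ.target := by
  have hd : ∀ a b c, ContDiffOn ℝ ∞ (fun y => fderiv ℝ (fun y => gram ψ y a b) y (e c)) ψ.target :=
    fun a b c => ((contDiffOn_gram hψ a b).fderiv_of_isOpen ψ.open_target (by simp)).clm_apply
      contDiffOn_const
  unfold christoffel
  refine contDiffOn_const.mul (ContDiffOn.sum fun l _ => ?_)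
  exact (contDiffOn_gram_inv hψ k l).mul (((hd j l i).add (hd i l j)).sub (hd i j l))

lemma contDiffOn_christoffelForm : ContDiffOn ℝ ∞ (christoffelForm ψ) ψ.target := by
  unfold christoffelForm
  exact ContDiffOn.sum fun k _ => ContDiffOn.sum fun i _ => ContDiffOn.sum fun j _ =>
    (contDiffOn_christoffel hψ k i j).smul_const_right _

/-- The Levi-Civita connection is compatible with the metric. -/
lemma fderiv_metricForm {y : E 4} (hy : y ∈ ψ.target) (z v w : E 4) :
    fderiv ℝ (metricForm ψ) y z v w =
      metricForm ψ y (christoffelForm ψ y z v) w + metricForm ψ y v (christoffelForm ψ y z w) := by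
  have hdiff : ∀ a b, DifferentiableAt ℝ (fun y => gram ψ y a b) y := fun a b =>
    ((contDiffOn_gram hψ a b).contDiffAt (ψ.open_target.mem_nhds hy)).differentiableAt (by simp)
  have hmf : DifferentiableAt ℝ (metricForm ψ) y :=
    ((contDiffOn_metricForm hψ).contDiffAt (ψ.open_target.mem_nhds hy)).differentiableAt (by simp)
  -- Lowering the index of the Christoffel symbols.
  have hlow : ∀ c a b, metricForm ψ y (christoffelForm ψ y (e c) (e a)) (e b) =
      1 / 2 * (fderiv ℝ (fun y => gram ψ y a b) y (e c) + fderiv ℝ (fun y => gram ψ y c b) y (e a)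
        - fderiv ℝ (fun y => gram ψ y c a) y (e b)) := by
    intro c a b
    let d : Fin 4 → ℝ := fun l => 1 / 2 * (fderiv ℝ (fun y => gram ψ y a l) y (e c)
      + fderiv ℝ (fun y => gram ψ y c l) y (e a) - fderiv ℝ (fun y => gram ψ y c a) y (e l))
    have h1 : ⇑(christoffelForm ψ y (e c) (e a)) = ((gram ψ y)⁻¹).mulVec d := by
      ext k
      rw [christoffelForm_apply]
      simp only [christoffelMap, e_apply, christoffel]
      rw [Finset.sum_eq_single c, Finset.sum_eq_single a]
      · simp only [if_true, mul_one, Matrix.mulVec, dotProduct, d, Finset.mul_sum]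
        exact Finset.sum_congr rfl fun l _ => by ring
      · intro l _ hl; simp [hl]
      · simp
      · intro l _ hl; simp [hl]
      · simp
    have h2 : metricForm ψ y (e b) (christoffelForm ψ y (e c) (e a)) =
        (gram ψ y).mulVec ⇑(christoffelForm ψ y (e c) (e a)) b := by
      rw [metricForm_eq_sum, Finset.sum_eq_single b]
      · simp [e_apply, Matrix.mulVec, dotProduct]
      · intro l _ hl; simp [e_apply, hl]
      · simp
    rw [metricForm_comm, h2, h1, Matrix.mulVec_mulVec,
      Matrix.mul_nonsing_inv _ (gram_posDef hψ hy).det_pos.ne'.isUnit, Matrix.one_mulVec]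
  have hbasis : ∀ c a b : Fin 4, fderiv ℝ (metricForm ψ) y (e c) (e a) (e b) =
      metricForm ψ y (christoffelForm ψ y (e c) (e a)) (e b) +
        metricForm ψ y (e a) (christoffelForm ψ y (e c) (e b)) := by
    intro c a b
    have h1 : fderiv ℝ (metricForm ψ) y (e c) (e a) (e b) =
        fderiv ℝ (fun y => gram ψ y a b) y (e c) := by
      have h2 : (fun y => gram ψ y a b) = fun y => metricForm ψ y (e a) (e b) := by
        funext y; rw [metricForm_apply]; rfl
      rw [h2]
      rw [fderiv_clm_apply (hmf.clm_apply (differentiableAt_const _)) (differentiableAt_const _),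
        fderiv_clm_apply hmf (differentiableAt_const _)]
      simp
    rw [h1, metricForm_comm ψ y (e a), hlow, hlow]
    have h3 : (fun y => gram ψ y b a) = fun y => gram ψ y a b := funext fun y => gram_symm ψ y b a
    rw [h3]
    ring
  rw [eq_sum_e z, eq_sum_e v, eq_sum_e w]
  simp only [map_sum, map_smul, sum_apply, smul_apply, hbasis, smul_eq_mul,
    Finset.smul_sum, Finset.mul_sum, mul_add, Finset.sum_add_distrib]
  congr 1
  refine Finset.sum_congr rfl fun a _ => ?_
  rw [Finset.sum_comm]
  exact Finset.sum_congr rfl fun b _ => Finset.sum_congr rfl fun c _ => by ring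

end

variable {M : Type*} [TopologicalSpace M] [ChartedSpace (E 4) M]
  [RiemannianBundle (fun x : M => TangentSpace (𝓡 4) x)]

/-- `u` is, on the open set `O`, a smooth immersion into the domain of the coordinates `ψ`. -/
structure IsLocalImmersion (ψ : OpenPartialHomeomorph M (E 4)) (u : E 2 → E 4) (O : Set (E 2)) :
    Prop where
  isOpen : IsOpen O
  smooth : ContDiffOn ℝ ∞ u O
  mapsTo : MapsTo u O ψ.target
  independent : ∀ t ∈ O, LinearIndependent ℝ ![tangentVec u t 0, tangentVec u t 1]

lemma IsLocalImmersion.contDiffOn_tangentVec {M : Type*} [TopologicalSpace M]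
    {ψ : OpenPartialHomeomorph M (E 4)} {u : E 2 → E 4} {O : Set (E 2)}
    (h : IsLocalImmersion ψ u O) (α : Fin 2) :
    ContDiffOn ℝ ∞ (fun t => tangentVec u t α) O :=
  (h.smooth.fderiv_of_isOpen h.isOpen (by simp)).clm_apply contDiffOn_const

/-- The pull-back of the connection form along `u`: `∇_α V = ∂_α V + Γ_α V`. -/
def connForm (ψ : OpenPartialHomeomorph M (E 4)) (u : E 2 → E 4) (α : Fin 2) (t : E 2) :
    E 4 →L[ℝ] E 4 :=
  christoffelForm ψ (u t) (tangentVec u t α)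

lemma covDeriv_eq (ψ : OpenPartialHomeomorph M (E 4)) (u V : E 2 → E 4) (α : Fin 2) (t : E 2) :
    covDeriv ψ u V α t = fderiv ℝ V t (e α) + connForm ψ u α t (V t) := by
  rw [covDeriv, connForm, christoffelForm_apply]

namespace IsLocalImmersion

variable [IsManifold (𝓡 4) ∞ M]
  [IsContMDiffRiemannianBundle (𝓡 4) ∞ (E 4) (fun x : M => TangentSpace (𝓡 4) x)]
  {ψ : OpenPartialHomeomorph M (E 4)}
  {u : E 2 → E 4} {O : Set (E 2)} (h : IsLocalImmersion ψ u O)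
include h

variable (hψ : ψ ∈ IsManifold.maximalAtlas (𝓡 4) ∞ M)
include hψ

lemma contDiffOn_metricForm : ContDiffOn ℝ ∞ (fun t => metricForm ψ (u t)) O :=
  (SurfaceSequence.contDiffOn_metricForm hψ).comp h.smooth h.mapsTo

lemma contDiffOn_connForm (α : Fin 2) : ContDiffOn ℝ ∞ (connForm ψ u α) O :=
  ((contDiffOn_christoffelForm hψ).comp h.smooth h.mapsTo).clm_apply (h.contDiffOn_tangentVec α)

omit [IsContMDiffRiemannianBundle (𝓡 4) ∞ (E 4) (fun x : M => TangentSpace (𝓡 4) x)] in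
lemma posDef {t : E 2} (ht : t ∈ O) : (gram ψ (u t)).PosDef := gram_posDef hψ (h.mapsTo ht)

omit [IsContMDiffRiemannianBundle (𝓡 4) ∞ (E 4) (fun x : M => TangentSpace (𝓡 4) x)] in
lemma areaElement_pos {t : E 2} (ht : t ∈ O) : 0 < areaElement ψ u t :=
  SurfaceSequence.areaElement_pos (h.posDef hψ ht) (h.independent t ht)

lemma contDiffOn_areaElement : ContDiffOn ℝ ∞ (areaElement ψ u) O := by
  have hg : ∀ α β, ContDiffOn ℝ ∞
      (fun t => chartMetric ψ (u t) (tangentVec u t α) (tangentVec u t β)) O := by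
    intro α β
    simp only [← metricForm_apply]
    exact ((h.contDiffOn_metricForm hψ).clm_apply (h.contDiffOn_tangentVec α)).clm_apply
      (h.contDiffOn_tangentVec β)
  refine ContDiffOn.sqrt (((hg 0 0).mul (hg 1 1)).sub ((hg 0 1).pow 2)) fun t ht => ?_
  exact (Real.sqrt_pos.1 (h.areaElement_pos hψ ht)).ne'

lemma contDiffOn_areaElement_inv : ContDiffOn ℝ ∞ (fun t => (areaElement ψ u t)⁻¹) O :=
  (h.contDiffOn_areaElement hψ).inv fun _ ht => (h.areaElement_pos hψ ht).ne'

lemma contDiffOn_rotTL : ContDiffOn ℝ ∞ (rotTL ψ u) O := by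
  rw [contDiffOn_clm_apply]
  intro v
  have hg : ∀ α, ContDiffOn ℝ ∞ (fun t => metricForm ψ (u t) (tangentVec u t α) v) O := fun α =>
    ((h.contDiffOn_metricForm hψ).clm_apply (h.contDiffOn_tangentVec α)).clm_apply contDiffOn_const
  exact (h.contDiffOn_areaElement_inv hψ).smul (((hg 0).smul (h.contDiffOn_tangentVec 1)).sub
    ((hg 1).smul (h.contDiffOn_tangentVec 0)))

lemma contDiffOn_rotNL : ContDiffOn ℝ ∞ (rotNL ψ u) O := by
  rw [contDiffOn_clm_apply]
  intro v
  rw [contDiffOn_euclidean]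
  intro k
  simp only [rotNL_apply, rotN_apply]
  refine ContDiffOn.sum fun l _ => ?_
  refine ((contDiffOn_gram_inv hψ k l).comp h.smooth h.mapsTo).mul
    (((h.contDiffOn_areaElement_inv hψ).mul (ContDiffOn.sqrt
      ((contDiffOn_det (contDiffOn_gram hψ)).comp h.smooth h.mapsTo)
      fun t ht => (h.posDef hψ ht).det_pos.ne')).mul ?_)
  refine contDiffOn_det fun i j => ?_
  have hX : ∀ α, ContDiffOn ℝ ∞ (fun t => tangentVec u t α j) O := fun α =>
    contDiffOn_euclidean.1 (h.contDiffOn_tangentVec α) j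
  fin_cases i
  · exact hX 0
  · exact hX 1
  · exact contDiffOn_const
  · exact contDiffOn_const

end IsLocalImmersion

/-! ### The curvature of a plane subbundle -/

lemma fderiv_fderiv_apply_comm {F V : Type*} [NormedAddCommGroup F] [NormedSpace ℝ F]
    [NormedAddCommGroup V] [NormedSpace ℝ V] {f : F → V} {x : F} (hf : ContDiffAt ℝ ∞ f x)
    (a b : F) :
    fderiv ℝ (fun y => fderiv ℝ f y b) x a = fderiv ℝ (fun y => fderiv ℝ f y a) x b := by
  have hd : DifferentiableAt ℝ (fderiv ℝ f) x :=
    (hf.fderiv_right (m := ∞) (by simp)).differentiableAt (by simp)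
  rw [fderiv_clm_apply hd (differentiableAt_const _),
    fderiv_clm_apply hd (differentiableAt_const _)]
  simpa using hf.isSymmSndFDerivAt (by simpa using ENat.LEInfty.out) a b

lemma fderiv_mul_apply {F A : Type*} [NormedAddCommGroup F] [NormedSpace ℝ F] [NormedRing A]
    [NormedAlgebra ℝ A] {f g : F → A} {t : F} (hf : DifferentiableAt ℝ f t)
    (hg : DifferentiableAt ℝ g t) (a : F) :
    fderiv ℝ (fun s => f s * g s) t a = fderiv ℝ f t a * g t + f t * fderiv ℝ g t a := by
  have : fderiv ℝ (fun s => f s * g s) t = _ := (hf.hasFDerivAt.mul' hg.hasFDerivAt).fderiv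
  rw [this]
  simp [add_comm]

section

variable {F V : Type*} [NormedAddCommGroup F] [NormedSpace ℝ F] [NormedAddCommGroup V]
  [NormedSpace ℝ V]

/-- The covariant derivative `P ∇_a W`, projected by `P`, of a field `W`; here `G` is the connection
matrix in the direction `a`. -/
def projDeriv (P G : F → V →L[ℝ] V) (a : F) (W : F → V) (s : F) : V :=
  P s (fderiv ℝ W s a + G s (W s))

/-- The iterated projected derivative of the field `P v`, `v` constant, expanded by the Leibniz
rule. -/
lemma projDeriv_projDeriv {P G G' : F → V →L[ℝ] V} {O : Set F} (hO : IsOpen O)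
    (hP : ContDiffOn ℝ ∞ P O) (hG : ContDiffOn ℝ ∞ G O)
    {t : F} (ht : t ∈ O) (a b : F) (v : V) :
    projDeriv P G' a (projDeriv P G b fun s => P s v) t =
      (P t * (fderiv ℝ P t a * (fderiv ℝ P t b + G t * P t) +
        P t * (fderiv ℝ (fun s => fderiv ℝ P s b) t a + (fderiv ℝ G t a * P t +
          G t * fderiv ℝ P t a)) + G' t * (P t * (fderiv ℝ P t b + G t * P t)))) v := by
  have hdP : ∀ s ∈ O, DifferentiableAt ℝ P s := fun s hs =>
    (hP.contDiffAt (hO.mem_nhds hs)).differentiableAt (by simp)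
  have hdG : DifferentiableAt ℝ G t := (hG.contDiffAt (hO.mem_nhds ht)).differentiableAt (by simp)
  have hddP : DifferentiableAt ℝ (fun s => fderiv ℝ P s b) t :=
    (((hP.contDiffAt (hO.mem_nhds ht)).fderiv_right (m := ∞) (by simp)).differentiableAt
      (by simp)).clm_apply (differentiableAt_const _)
  let Q : F → V →L[ℝ] V := fun s => P s * (fderiv ℝ P s b + G s * P s)
  have hQ : ∀ s ∈ O, projDeriv P G b (fun s => P s v) s = Q s v := by
    intro s hs
    rw [projDeriv, fderiv_clm_apply (hdP s hs) (differentiableAt_const _)]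
    simp [Q]
  have hev : projDeriv P G b (fun s => P s v) =ᶠ[𝓝 t] fun s => Q s v := by
    filter_upwards [hO.mem_nhds ht] with s hs using hQ s hs
  have hGP : DifferentiableAt ℝ (fun s => G s * P s) t := hdG.mul (hdP t ht)
  have hQ1 : DifferentiableAt ℝ (fun s => fderiv ℝ P s b + G s * P s) t :=
    hddP.add hGP
  have hQd : DifferentiableAt ℝ Q t := (hdP t ht).mul hQ1
  have hQt : fderiv ℝ Q t a = fderiv ℝ P t a * (fderiv ℝ P t b + G t * P t) +
      P t * (fderiv ℝ (fun s => fderiv ℝ P s b) t a + (fderiv ℝ G t a * P t +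
          G t * fderiv ℝ P t a)) := by
    rw [fderiv_mul_apply (hdP t ht) hQ1, fderiv_fun_add hddP hGP, add_apply,
      fderiv_mul_apply hdG (hdP t ht)]
  rw [projDeriv, hev.fderiv_eq, hev.eq_of_nhds,
    fderiv_clm_apply hQd (differentiableAt_const _)]
  simp only [fderiv_const_apply, ContinuousLinearMap.comp_zero, zero_add,
    ContinuousLinearMap.flip_apply, hQt, mul_add]
  simp [Q, mul_add]

end

/-- The algebraic identity behind the Gauss and Ricci equations: `p` is a projection, `p₀, p₁` are
its derivatives, `G₀, G₁` the connection forms and `H₀₁, H₁₀` their derivatives. -/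
lemma gauss_ricci_identity {R : Type*} [Ring R] {p p₀ p₁ G₀ G₁ H₀₁ H₁₀ q : R} (hp : p * p = p)
    (h₀ : p₀ * p + p * p₀ = p₀) (h₁ : p₁ * p + p * p₁ = p₁) :
    p * (p₀ * (p₁ + G₁ * p) + p * (q + (H₀₁ * p + G₁ * p₀)) + G₀ * (p * (p₁ + G₁ * p))) -
      p * (p₁ * (p₀ + G₀ * p) + p * (q + (H₁₀ * p + G₀ * p₁)) + G₁ * (p * (p₀ + G₀ * p))) =
    p * (H₀₁ - H₁₀ + (G₀ * G₁ - G₁ * G₀)) * p +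
      ((p₀ + G₀ * p - p * G₀) * (p₁ + G₁ * p - p * G₁) -
        (p₁ + G₁ * p - p * G₁) * (p₀ + G₀ * p - p * G₀)) * p := by
  have h₀' : p₀ * p = p₀ - p * p₀ := by rw [← h₀]; abel_nf; simp [h₀]
  have h₁' : p₁ * p = p₁ - p * p₁ := by rw [← h₁]; abel_nf; simp [h₁]
  have r1 : ∀ x, p * (p * x) = p * x := fun x => by rw [← mul_assoc, hp]
  have r2 : ∀ x, p₀ * (p * x) = p₀ * x - p * (p₀ * x) := fun x => by
    rw [← mul_assoc, h₀', sub_mul, mul_assoc]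
  have r3 : ∀ x, p₁ * (p * x) = p₁ * x - p * (p₁ * x) := fun x => by
    rw [← mul_assoc, h₁', sub_mul, mul_assoc]
  simp only [mul_add, add_mul, mul_sub, sub_mul, mul_assoc, hp, h₀', h₁', r1, r2, r3]
  abel

/-- `j` acts on the image of `p` and vanishes on the complement, so that compressing to the image of
`p` does not change traces against `j`. -/
lemma tr_compression {j p F : E 4 →L[ℝ] E 4} (h1 : j * p = j) (h2 : p * j = j)
    (C : E 4 →L[ℝ] E 4) : tr (j * (p * F * p + C * p)) = tr (j * F) + tr (j * C) := by
  have e1 : j * (p * F * p + C * p) = (j * F) * p + (j * C) * p := by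
    have : j * (p * F * p + C * p) = (j * p) * F * p + (j * C) * p := by noncomm_ring
    rw [this, h1]
  rw [e1, tr_add, tr_mul_comm, tr_mul_comm (j * C), ← mul_assoc, ← mul_assoc, h2]

section

variable {V : Type*} [NormedAddCommGroup V] [NormedSpace ℝ V]

/-- The covariant derivative in the direction `a` of a field of endomorphisms, for the connection
form `G`. -/
def covEnd (G A : E 2 → V →L[ℝ] V) (a t : E 2) : V →L[ℝ] V :=
  fderiv ℝ A t a + G t * A t - A t * G t

/-- The curvature endomorphism `R(∂_0, ∂_1)` of the connection with forms `G₀, G₁`. -/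
def connCurv (G : Fin 2 → E 2 → V →L[ℝ] V) (t : E 2) : V →L[ℝ] V :=
  fderiv ℝ (G 1) t (e 0) - fderiv ℝ (G 0) t (e 1) + (G 0 t * G 1 t - G 1 t * G 0 t)

/-- The commutator of the covariant derivatives of `A`; for the projection onto a plane subbundle
this is the second fundamental form term of the Gauss and Ricci equations. -/
def fundTerm (G : Fin 2 → E 2 → V →L[ℝ] V) (A : E 2 → V →L[ℝ] V) (t : E 2) : V →L[ℝ] V :=
  covEnd (G 0) A (e 0) t * covEnd (G 1) A (e 1) t -
    covEnd (G 1) A (e 1) t * covEnd (G 0) A (e 0) t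

/-- The curvature of the connection induced on the image of the field of projections `P`. -/
lemma projDeriv_commutator {P : E 2 → V →L[ℝ] V} {G : Fin 2 → E 2 → V →L[ℝ] V} {O : Set (E 2)}
    (hO : IsOpen O) (hP : ContDiffOn ℝ ∞ P O) (hG : ∀ α, ContDiffOn ℝ ∞ (G α) O)
    (hPP : ∀ s ∈ O, P s * P s = P s) {t : E 2} (ht : t ∈ O) (v : V) :
    projDeriv P (G 0) (e 0) (projDeriv P (G 1) (e 1) fun s => P s v) t -
      projDeriv P (G 1) (e 1) (projDeriv P (G 0) (e 0) fun s => P s v) t =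
    (P t * connCurv G t * P t + fundTerm G P t * P t) v := by
  have hdP : DifferentiableAt ℝ P t :=
    (hP.contDiffAt (hO.mem_nhds ht)).differentiableAt (by simp)
  have hdd : ∀ a, fderiv ℝ P t a * P t + P t * fderiv ℝ P t a = fderiv ℝ P t a := by
    intro a
    have h1 : (fun s => P s * P s) =ᶠ[𝓝 t] P := by
      filter_upwards [hO.mem_nhds ht] with s hs using hPP s hs
    rw [← fderiv_mul_apply hdP hdP, h1.fderiv_eq]
  rw [projDeriv_projDeriv hO hP (hG 1) ht, projDeriv_projDeriv hO hP (hG 0) ht,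
    fderiv_fderiv_apply_comm (hP.contDiffAt (hO.mem_nhds ht)) (e 1) (e 0), ← sub_apply,
    gauss_ricci_identity (hPP t ht) (hdd (e 0)) (hdd (e 1))]
  rfl

end

section

variable {M : Type*} [TopologicalSpace M] [ChartedSpace (E 4) M]
  [RiemannianBundle (fun x : M => TangentSpace (𝓡 4) x)]

variable [IsManifold (𝓡 4) ∞ M]
  [IsContMDiffRiemannianBundle (𝓡 4) ∞ (E 4) (fun x : M => TangentSpace (𝓡 4) x)]
  {ψ : OpenPartialHomeomorph M (E 4)}
  {u : E 2 → E 4} {O : Set (E 2)} (h : IsLocalImmersion ψ u O)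
  (hψ : ψ ∈ IsManifold.maximalAtlas (𝓡 4) ∞ M)
include h hψ

/-- The Gauss (for `j = rotT`) and Ricci (for `j = rotN`) equations: the curvature of the plane
bundle is the sum of an ambient curvature term and a term in the covariant derivative of the
projection `-j²`, which is the second fundamental form. -/
lemma bundleCurvature_eq {j : E 2 → E 4 →L[ℝ] E 4} (hj : ContDiffOn ℝ ∞ j O)
    (hcube : ∀ s ∈ O, j s * j s * j s = -j s) {t : E 2} (ht : t ∈ O) :
    bundleCurvature ψ u (fun s v => j s v) t =
      1 / 2 * (tr (j t * connCurv (connForm ψ u) t) +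
        tr (j t * fundTerm (connForm ψ u) (fun s => -(j s * j s)) t)) / areaElement ψ u t := by
  set P : E 2 → E 4 →L[ℝ] E 4 := fun s => -(j s * j s) with hPdef
  have hP : ContDiffOn ℝ ∞ P O := (hj.clm_comp hj).neg
  have hjP : ∀ s ∈ O, j s * P s = j s := fun s hs => by
    have := hcube s hs
    rw [hPdef]
    exact (mul_neg (j s) (j s * j s)).trans (by rw [← mul_assoc, this]; exact neg_neg _)
  have hPj : ∀ s ∈ O, P s * j s = j s := fun s hs => by
    have := hcube s hs
    rw [hPdef]
    exact (neg_mul (j s * j s) (j s)).trans (by rw [this]; exact neg_neg _)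
  have hPP : ∀ s ∈ O, P s * P s = P s := fun s hs => by
    conv_lhs => lhs; rw [hPdef]
    exact (neg_mul (j s * j s) (P s)).trans (by rw [mul_assoc, hjP s hs])
  rw [← tr_compression (F := connCurv (connForm ψ u) t) (hjP t ht) (hPj t ht)
    (fundTerm (connForm ψ u) P t), tr]
  have hproj : ∀ (s : E 2) (v : E 4), -j s (j s v) = P s v := fun _ _ => rfl
  have hcov : ∀ (V : E 2 → E 4) (α : Fin 2) (s : E 2), P s (covDeriv ψ u V α s) =
      projDeriv P (connForm ψ u α) (e α) V s := by
    intro V α s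
    rw [covDeriv_eq, projDeriv]
  simp only [bundleCurvature, hproj, hcov]
  congr 2
  refine Finset.sum_congr rfl fun i _ => ?_
  rw [mul_apply_eq_comp,
    ← projDeriv_commutator h.isOpen hP (h.contDiffOn_connForm hψ) hPP ht (e i)]

end

/-! ### The sum of the curvatures along a parallel lift -/

section

variable {V : Type*} [NormedAddCommGroup V] [NormedSpace ℝ V]

/-- A parallel field of endomorphisms which commutes with `P` commutes with the covariant
derivatives of `P`. -/
lemma commute_covEnd {G J P : E 2 → V →L[ℝ] V} {t : E 2} {a : E 2} (hJ : DifferentiableAt ℝ J t)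
    (hP : DifferentiableAt ℝ P t) (hJP : (fun s => J s * P s) =ᶠ[𝓝 t] fun s => P s * J s)
    (hJ0 : covEnd G J a t = 0) : J t * covEnd G P a t = covEnd G P a t * J t := by
  have h1 : fderiv ℝ J t a = J t * G t - G t * J t := by
    have : fderiv ℝ J t a = covEnd G J a t + (J t * G t - G t * J t) := by
      unfold covEnd; abel
    rw [this, hJ0, zero_add]
  have h2 := DFunLike.congr_fun (hJP.fderiv_eq (𝕜 := ℝ)) a
  simp only [fderiv_mul_apply hJ hP, fderiv_mul_apply hP hJ] at h2
  have h3 : J t * P t = P t * J t := hJP.eq_of_nhds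
  rw [h1] at h2
  have h4 : J t * fderiv ℝ P t a = fderiv ℝ P t a * J t + P t * (J t * G t - G t * J t) -
      (J t * G t - G t * J t) * P t := by rw [← h2]; abel
  have h5 : J t * P t * G t = P t * J t * G t := by rw [h3]
  have h6 : G t * J t * P t = G t * P t * J t := by rw [mul_assoc, h3, mul_assoc]
  unfold covEnd
  calc J t * (fderiv ℝ P t a + G t * P t - P t * G t)
      = J t * fderiv ℝ P t a + J t * G t * P t - J t * P t * G t := by noncomm_ring
    _ = fderiv ℝ P t a * J t + G t * J t * P t - P t * G t * J t := by
        rw [h4, h5]; noncomm_ring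
    _ = _ := by rw [h6]; noncomm_ring

lemma covEnd_neg_sub {G P Q : E 2 → V →L[ℝ] V} {t a : E 2}
    (h : Q =ᶠ[𝓝 t] fun s => 1 - P s) : covEnd G Q a t = -covEnd G P a t := by
  unfold covEnd
  rw [h.fderiv_eq, h.eq_of_nhds, fderiv_const_sub, neg_apply]
  noncomm_ring

/-- The tangent and the normal bundles have the same second fundamental form term. -/
lemma fundTerm_compl {G : Fin 2 → E 2 → V →L[ℝ] V} {P Q : E 2 → V →L[ℝ] V} {t : E 2}
    (h : Q =ᶠ[𝓝 t] fun s => 1 - P s) : fundTerm G Q t = fundTerm G P t := by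
  unfold fundTerm
  rw [covEnd_neg_sub h, covEnd_neg_sub h]
  noncomm_ring

/-- If `J` commutes with the covariant derivatives of `P` then `J` times their commutator is again
a commutator, hence has trace zero. -/
lemma mul_fundTerm {G : Fin 2 → E 2 → V →L[ℝ] V} {P : E 2 → V →L[ℝ] V} {t : E 2} {J : V →L[ℝ] V}
    (hJ : J * covEnd (G 1) P (e 1) t = covEnd (G 1) P (e 1) t * J) :
    J * fundTerm G P t = J * covEnd (G 0) P (e 0) t * covEnd (G 1) P (e 1) t -
      covEnd (G 1) P (e 1) t * (J * covEnd (G 0) P (e 0) t) := by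
  rw [fundTerm, mul_sub, ← mul_assoc, ← mul_assoc, hJ, mul_assoc (covEnd (G 1) P (e 1) t)]

lemma lift_mul_neg_sq {a b : V →L[ℝ] V} (hab : a * b = 0) (hba : b * a = 0) (s : ℝ) :
    (a + s • b) * -(a * a) = -(a * a) * (a + s • b) := by
  have h3 : b * (a * a) = 0 := by rw [← mul_assoc, hba, zero_mul]
  have h4 : a * a * b = 0 := by rw [mul_assoc, hab, mul_zero]
  rw [mul_neg, neg_mul, add_mul, mul_add, smul_mul_assoc, h3, mul_smul_comm, h4, mul_assoc]

lemma lift_mul (a b C : V →L[ℝ] V) (s : ℝ) : (a + s • b) * C = a * C + s • (b * C) := by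
  rw [add_mul, smul_mul_assoc]

lemma neg_sq_eq_of_add_eq {a b : V →L[ℝ] V} (h : a * a + b * b = -1) :
    -(b * b) = 1 - -(a * a) := by
  rw [eq_sub_of_add_eq' h]
  abel

end

section

variable {M : Type*} [TopologicalSpace M] [ChartedSpace (E 4) M]
  [RiemannianBundle (fun x : M => TangentSpace (𝓡 4) x)]

/-- The twistor lift as a field of continuous linear maps. -/
def liftL (ψ : OpenPartialHomeomorph M (E 4)) (u : E 2 → E 4) (s : ℝ) (t : E 2) :
    E 4 →L[ℝ] E 4 :=
  rotTL ψ u t + s • rotNL ψ u t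

lemma liftL_apply (ψ : OpenPartialHomeomorph M (E 4)) (u : E 2 → E 4) (s : ℝ) (t : E 2) (v : E 4) :
    liftL ψ u s t v = twistorLift ψ u s t v := by
  simp [liftL, twistorLift, rotTL_apply, rotNL_apply]

lemma rotT_eq (ψ : OpenPartialHomeomorph M (E 4)) (u : E 2 → E 4) :
    rotT ψ u = fun t v => rotTL ψ u t v := by
  funext t v; rw [rotTL_apply]

lemma rotN_eq (ψ : OpenPartialHomeomorph M (E 4)) (u : E 2 → E 4) :
    rotN ψ u = fun t v => rotNL ψ u t v := rfl

variable [IsManifold (𝓡 4) ∞ M]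
  [IsContMDiffRiemannianBundle (𝓡 4) ∞ (E 4) (fun x : M => TangentSpace (𝓡 4) x)]
  {ψ : OpenPartialHomeomorph M (E 4)}
  {u : E 2 → E 4} {O : Set (E 2)} (h : IsLocalImmersion ψ u O)
  (hψ : ψ ∈ IsManifold.maximalAtlas (𝓡 4) ∞ M) {t : E 2} (ht : t ∈ O)
include h hψ ht

lemma differentiableAt_rotTL : DifferentiableAt ℝ (rotTL ψ u) t :=
  ((h.contDiffOn_rotTL hψ).contDiffAt (h.isOpen.mem_nhds ht)).differentiableAt (by simp)

lemma differentiableAt_rotNL : DifferentiableAt ℝ (rotNL ψ u) t :=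
  ((h.contDiffOn_rotNL hψ).contDiffAt (h.isOpen.mem_nhds ht)).differentiableAt (by simp)

lemma differentiableAt_liftL (s : ℝ) : DifferentiableAt ℝ (liftL ψ u s) t :=
  (differentiableAt_rotTL h hψ ht).add ((differentiableAt_rotNL h hψ ht).const_smul s)

/-- Parallelism of the twistor lift, tested on constant fields, as an equation between
endomorphisms. -/
lemma covEnd_liftL {s : ℝ} (hs : LiftParallelAt ψ u s t) (α : Fin 2) :
    covEnd (connForm ψ u α) (liftL ψ u s) (e α) t = 0 := by
  ext1 v
  have h1 := hs α v
  simp only [covDeriv_eq, ← liftL_apply] at h1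
  rw [fderiv_clm_apply (differentiableAt_liftL h hψ ht s) (differentiableAt_const _)] at h1
  simp only [fderiv_const_apply, ContinuousLinearMap.comp_zero, zero_add, zero_apply,
    ContinuousLinearMap.flip_apply] at h1
  simp only [covEnd, sub_apply, add_apply, mul_apply_eq_comp, zero_apply]
  rw [h1, sub_self]

/-- Along a parallel lift the second fundamental form terms of the Gauss and Ricci equations cancel,
and only the ambient curvature contributes to `K^T + s K^N`. -/
lemma curvature_add_of_liftParallel {s : ℝ} (hs : LiftParallelAt ψ u s t) :
    bundleCurvature ψ u (rotT ψ u) t + s * bundleCurvature ψ u (rotN ψ u) t =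
      1 / 2 * tr (liftL ψ u s t * connCurv (connForm ψ u) t) / areaElement ψ u t := by
  have hc : ∀ r ∈ O, -(rotNL ψ u r * rotNL ψ u r) = 1 - -(rotTL ψ u r * rotTL ψ u r) := by
    intro r hr
    exact neg_sq_eq_of_add_eq (rotTL_sq_add_rotNL_sq (h.posDef hψ hr) (h.independent r hr))
  have hf : fundTerm (connForm ψ u) (fun r => -(rotNL ψ u r * rotNL ψ u r)) t =
      fundTerm (connForm ψ u) (fun r => -(rotTL ψ u r * rotTL ψ u r)) t :=
    fundTerm_compl (by filter_upwards [h.isOpen.mem_nhds ht] with r hr using hc r hr)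
  rw [rotT_eq, rotN_eq, bundleCurvature_eq h hψ (h.contDiffOn_rotTL hψ)
    (fun r hr => rotTL_cube (h.posDef hψ hr) (h.independent r hr)) ht,
    bundleCurvature_eq h hψ (h.contDiffOn_rotNL hψ)
    (fun r hr => rotNL_cube (h.posDef hψ hr) (h.independent r hr)) ht, hf]
  set B := fundTerm (connForm ψ u) (fun r => -(rotTL ψ u r * rotTL ψ u r)) t with hB
  have hcomm : (fun r => liftL ψ u s r * -(rotTL ψ u r * rotTL ψ u r)) =ᶠ[𝓝 t]
      fun r => -(rotTL ψ u r * rotTL ψ u r) * liftL ψ u s r := by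
    filter_upwards [h.isOpen.mem_nhds ht] with r hr
    have h1 := rotTL_mul_rotNL (h.posDef hψ hr) (h.independent r hr)
    have h2 := rotNL_mul_rotTL (h.posDef hψ hr) (h.independent r hr)
    exact lift_mul_neg_sq h1 h2 s
  have hPd : DifferentiableAt ℝ (fun r => -(rotTL ψ u r * rotTL ψ u r)) t :=
    ((differentiableAt_rotTL h hψ ht).mul (differentiableAt_rotTL h hψ ht)).neg
  have h0 : tr (liftL ψ u s t * B) = 0 := by
    rw [hB, mul_fundTerm (commute_covEnd (differentiableAt_liftL h hψ ht s) hPd hcomm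
      (covEnd_liftL h hψ ht hs 1)), tr_sub, tr_mul_comm, sub_self]
  have h1 : ∀ C, tr (liftL ψ u s t * C) = tr (rotTL ψ u t * C) + s * tr (rotNL ψ u t * C) := by
    intro C
    rw [liftL, lift_mul, tr_add, tr_smul]
  rw [h1] at h0
  rw [h1]
  linear_combination (1 / 2 * (areaElement ψ u t)⁻¹) * h0

end

/-! ### The ambient curvature -/

section

variable {V : Type*} [NormedAddCommGroup V] [NormedSpace ℝ V]

/-- The curvature `R_y(v, w)` of the linear connection with Christoffel form `G`. -/
def curvForm (G : V → V →L[ℝ] V →L[ℝ] V) (y v w : V) : V →L[ℝ] V :=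
  fderiv ℝ G y v w - fderiv ℝ G y w v + (G y v * G y w - G y w * G y v)

/-- The curvature of the pulled back connection is the pulled back curvature. -/
lemma connCurv_pullback {G : V → V →L[ℝ] V →L[ℝ] V} {u : E 2 → V} {t : E 2}
    (hu : ContDiffAt ℝ ∞ u t) (hG : DifferentiableAt ℝ G (u t)) :
    connCurv (fun α s => G (u s) (fderiv ℝ u s (e α))) t =
      curvForm G (u t) (fderiv ℝ u t (e 0)) (fderiv ℝ u t (e 1)) := by
  have hud : DifferentiableAt ℝ u t := hu.differentiableAt (by simp)
  have hdd : ∀ α, DifferentiableAt ℝ (fun s => fderiv ℝ u s (e α)) t := fun α =>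
    ((hu.fderiv_right (m := ∞) (by simp)).differentiableAt (by simp)).clm_apply
      (differentiableAt_const _)
  have hGu : DifferentiableAt ℝ (fun s => G (u s)) t :=
    DifferentiableAt.comp (G := V →L[ℝ] V →L[ℝ] V) (g := G) t hG hud
  have h1 : ∀ α (a : E 2), fderiv ℝ (fun s => G (u s) (fderiv ℝ u s (e α))) t a =
      fderiv ℝ G (u t) (fderiv ℝ u t a) (fderiv ℝ u t (e α)) +
        G (u t) (fderiv ℝ (fun s => fderiv ℝ u s (e α)) t a) := by
    intro α a
    have h2 : fderiv ℝ (fun s => G (u s)) t a = fderiv ℝ G (u t) (fderiv ℝ u t a) := by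
      have : fderiv ℝ (G ∘ u) t = _ :=
        fderiv_comp (G := V →L[ℝ] V →L[ℝ] V) (g := G) t hG hud
      exact DFunLike.congr_fun this a
    rw [fderiv_clm_apply hGu (hdd α), ← h2]
    simp [add_comm]
  unfold connCurv curvForm
  rw [h1, h1, fderiv_fderiv_apply_comm hu (e 0) (e 1)]
  abel

lemma curvForm_comb (G : V → V →L[ℝ] V →L[ℝ] V) (y v w : V) (a b c d : ℝ) :
    curvForm G y (a • v + b • w) (c • v + d • w) = (a * d - b * c) • curvForm G y v w := by
  unfold curvForm
  simp only [map_add, map_smul, add_apply, smul_apply, mul_add, add_mul, smul_mul_assoc,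
    mul_smul_comm, smul_add, smul_sub, smul_smul]
  module

/-- `smul_mul_assoc` for endomorphisms; stated for a general normed space, where instance search
is cheap. -/
lemma smul_clm_mul (c : ℝ) (A B : V →L[ℝ] V) : (c • A) * B = c • (A * B) := smul_mul_assoc c A B

lemma continuousOn_curvForm {G : V → V →L[ℝ] V →L[ℝ] V} {O : Set V} (hO : IsOpen O)
    (hG : ContDiffOn ℝ ∞ G O) :
    ContinuousOn (fun q : V × V × V => curvForm G q.1 q.2.1 q.2.2) (O ×ˢ univ) := by
  have h1 : ContinuousOn (fun q : V × V × V => G q.1) (O ×ˢ univ) :=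
    ContinuousOn.comp (γ := V →L[ℝ] V →L[ℝ] V) (g := G) hG.continuousOn continuousOn_fst
      fun q hq => hq.1
  have h2 : ContinuousOn (fun q : V × V × V => fderiv ℝ G q.1) (O ×ˢ univ) :=
    ContinuousOn.comp (γ := V →L[ℝ] V →L[ℝ] V →L[ℝ] V) (g := fderiv ℝ G)
      (hG.continuousOn_fderiv_of_isOpen hO (by simp)) continuousOn_fst fun q hq => hq.1
  have hv : ContinuousOn (fun q : V × V × V => q.2.1) (O ×ˢ univ) := by fun_prop
  have hw : ContinuousOn (fun q : V × V × V => q.2.2) (O ×ˢ univ) := by fun_prop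
  exact (((h2.clm_apply hv).clm_apply hw).sub ((h2.clm_apply hw).clm_apply hv)).add
    (((h1.clm_apply hv).mul (h1.clm_apply hw)).sub ((h1.clm_apply hw).mul (h1.clm_apply hv)))

end

section

variable {M : Type*} [TopologicalSpace M] [ChartedSpace (E 4) M] [IsManifold (𝓡 4) ∞ M]
  [RiemannianBundle (fun x : M => TangentSpace (𝓡 4) x)]
  [IsContMDiffRiemannianBundle (𝓡 4) ∞ (E 4) (fun x : M => TangentSpace (𝓡 4) x)]
  {ψ : OpenPartialHomeomorph M (E 4)} (hψ : ψ ∈ IsManifold.maximalAtlas (𝓡 4) ∞ M)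
include hψ

lemma connCurv_connForm {u : E 2 → E 4} {O : Set (E 2)} (h : IsLocalImmersion ψ u O) {t : E 2}
    (ht : t ∈ O) : connCurv (connForm ψ u) t =
      curvForm (christoffelForm ψ) (u t) (tangentVec u t 0) (tangentVec u t 1) :=
  connCurv_pullback (h.smooth.contDiffAt (h.isOpen.mem_nhds ht))
    (((contDiffOn_christoffelForm hψ).contDiffAt
      (ψ.open_target.mem_nhds (h.mapsTo ht))).differentiableAt (by simp))

/-! ### Uniform estimates on compact sets of the coordinate domain -/

/-- On a compact set of coordinates the metric is uniformly comparable to the Euclidean one. -/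
lemma exists_metricForm_bounds {K : Set (E 4)} (hK : IsCompact K) (hKt : K ⊆ ψ.target) :
    ∃ Λ : ℝ, 0 < Λ ∧ (∀ y ∈ K, ∀ v w, |metricForm ψ y v w| ≤ Λ * ‖v‖ * ‖w‖) ∧
      (∀ y ∈ K, ∀ v, metricForm ψ y v v = 1 → ‖v‖ ≤ Λ) := by
  have hc : ContinuousOn (metricForm ψ) K := (contDiffOn_metricForm hψ).continuousOn.mono hKt
  obtain ⟨Λ₁, hΛ₁⟩ := hK.exists_bound_of_continuousOn (E := E 4 →L[ℝ] E 4 →L[ℝ] ℝ) hc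
  -- The minimum of the metric on the unit sphere over `K` is positive.
  have hlow : ∃ l : ℝ, 0 < l ∧ ∀ y ∈ K, ∀ v : E 4, ‖v‖ = 1 → l ≤ metricForm ψ y v v := by
    rcases (K ×ˢ Metric.sphere (0 : E 4) 1).eq_empty_or_nonempty with he | hne
    · refine ⟨1, one_pos, fun y hy v hv => ?_⟩
      have : (y, v) ∈ K ×ˢ Metric.sphere (0 : E 4) 1 := ⟨hy, by simpa using hv⟩
      rw [he] at this
      exact this.elim
    · have hc2 : ContinuousOn (fun q : E 4 × E 4 => metricForm ψ q.1 q.2 q.2)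
          (K ×ˢ Metric.sphere (0 : E 4) 1) := by
        have h1 : ContinuousOn (fun q : E 4 × E 4 => metricForm ψ q.1)
            (K ×ˢ Metric.sphere (0 : E 4) 1) :=
          hc.comp continuousOn_fst fun q hq => hq.1
        exact (h1.clm_apply continuousOn_snd).clm_apply continuousOn_snd
      obtain ⟨q, hq, hmin⟩ := (hK.prod (isCompact_sphere (0 : E 4) 1)).exists_isMinOn hne hc2
      refine ⟨metricForm ψ q.1 q.2 q.2, metricForm_pos hψ (hKt hq.1) ?_, fun y hy v hv => ?_⟩
      · have := hq.2
        rw [mem_sphere_zero_iff_norm] at this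
        intro h0
        rw [h0, norm_zero] at this
        exact zero_ne_one this
      · exact hmin (a := (y, v)) ⟨hy, by simpa using hv⟩
  obtain ⟨l, hl, hlow⟩ := hlow
  refine ⟨max Λ₁ 0 + (√l)⁻¹, by positivity, fun y hy v w => ?_, fun y hy v hv => ?_⟩
  · calc |metricForm ψ y v w| = ‖metricForm ψ y v w‖ := (Real.norm_eq_abs _).symm
      _ ≤ ‖metricForm ψ y v‖ * ‖w‖ := (metricForm ψ y v).le_opNorm w
      _ ≤ (‖metricForm ψ y‖ * ‖v‖) * ‖w‖ := by
        gcongr; exact (metricForm ψ y).le_opNorm v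
      _ ≤ _ := by
        gcongr
        have := hΛ₁ y hy
        have h2 : 0 < (√l)⁻¹ := by positivity
        exact (this.trans (le_max_left _ _)).trans (le_add_of_nonneg_right h2.le)
  · have hv0 : 0 < ‖v‖ := norm_pos_iff.2 fun h0 => by simp [h0] at hv
    have h1 := hlow y hy (‖v‖⁻¹ • v) (by rw [norm_smul, norm_inv, norm_norm]; field_simp)
    simp only [map_smul, smul_apply, smul_eq_mul, hv, mul_one] at h1
    have h2 : l * ‖v‖ ^ 2 ≤ 1 := by
      have h3 : ‖v‖⁻¹ * ‖v‖⁻¹ * ‖v‖ ^ 2 = 1 := by field_simp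
      calc l * ‖v‖ ^ 2 ≤ ‖v‖⁻¹ * ‖v‖⁻¹ * ‖v‖ ^ 2 := by gcongr
        _ = 1 := h3
    have h4 : ‖v‖ ≤ (√l)⁻¹ := by
      rw [le_inv_comm₀ hv0 (Real.sqrt_pos.2 hl)]
      refine Real.sqrt_le_iff.2 ⟨by positivity, ?_⟩
      rw [inv_pow, le_inv_comm₀ hl (by positivity), ← one_div, le_div_iff₀ hl]
      rwa [mul_comm]
    exact h4.trans (le_add_of_nonneg_left (le_max_right _ _))

/-- Along a parallel lift, `K^T + s K^N` is bounded on compact sets by the ambient geometry alone: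
the bound does not depend on the surface. -/
lemma exists_curvature_bound {K : Set (E 4)} (hK : IsCompact K) (hKt : K ⊆ ψ.target) {s : ℝ}
    (hs1 : |s| ≤ 1) : ∃ C : ℝ, 0 ≤ C ∧ ∀ (u : E 2 → E 4) (O : Set (E 2)) (t : E 2),
      IsLocalImmersion ψ u O → t ∈ O → u t ∈ K → LiftParallelAt ψ u s t →
      |bundleCurvature ψ u (rotT ψ u) t + s * bundleCurvature ψ u (rotN ψ u) t| ≤ C := by
  obtain ⟨Λ, hΛ, hup, hunit⟩ := exists_metricForm_bounds hψ hK hKt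
  obtain ⟨C, hC⟩ := ((hK.prod ((isCompact_closedBall (0 : E 4) Λ).prod
    (isCompact_closedBall (0 : E 4) Λ)))).exists_bound_of_continuousOn
    ((continuousOn_curvForm ψ.open_target (contDiffOn_christoffelForm hψ)).mono
      (prod_mono hKt (subset_univ _)))
  refine ⟨4 * (Λ * Λ * (|C| * Λ)), by positivity,
    fun u O t h ht hut hs => ?_⟩
  have hg := h.posDef hψ ht
  obtain ⟨ε, α, β, γ, hε⟩ := exists_adaptedFrame hg (h.independent t ht)
  have harea := hε.areaElement_eq
  have hα := hε.pos_left
  have hγ := hε.pos_right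
  have hF : connCurv (connForm ψ u) t =
      (α * γ) • curvForm (christoffelForm ψ) (u t) (ε 0) (ε 1) := by
    have := curvForm_comb (christoffelForm ψ) (u t) (ε 0) (ε 1) α 0 β γ
    rw [connCurv_connForm hψ h ht, hε.eq_left, hε.eq_right]
    simpa using this
  set F := curvForm (christoffelForm ψ) (u t) (ε 0) (ε 1) with hFdef
  have hεn : ∀ i, ‖ε i‖ ≤ Λ := fun i => hunit _ hut _ (by simp [hε.orthonormal])
  have hFn : ‖F‖ ≤ |C| := (hC (u t, ε 0, ε 1) ⟨hut, by simpa using hεn 0, by simpa using hεn 1⟩).trans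
    (le_abs_self C)
  have hJn : ∀ i, ‖liftL ψ u s t (ε i)‖ ≤ Λ := by
    intro i
    have h2 : ∀ k, ‖s • ε k‖ ≤ Λ := fun k => by
      rw [norm_smul, Real.norm_eq_abs]
      calc _ ≤ 1 * Λ := mul_le_mul hs1 (hεn k) (norm_nonneg _) zero_le_one
        _ = Λ := one_mul _
    fin_cases i
    · simpa [liftL, hε.rotTL_zero, hε.rotNL_zero hg] using hεn 1
    · simpa [liftL, hε.rotTL_one, hε.rotNL_one hg] using hεn 0
    · simpa [liftL, hε.rotTL_two, hε.rotNL_two hg] using h2 3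
    · simpa [liftL, hε.rotTL_three, hε.rotNL_three hg] using h2 2
  have hterm : ∀ i, |metricForm ψ (u t) (ε i) (F (liftL ψ u s t (ε i)))| ≤
      Λ * Λ * (|C| * Λ) := by
    intro i
    refine (hup _ hut _ _).trans ?_
    gcongr
    · exact hεn i
    · exact (F.le_opNorm _).trans (mul_le_mul hFn (hJn i) (norm_nonneg _) (abs_nonneg _))
  have htr : |tr (F * liftL ψ u s t)| ≤
      4 * (Λ * Λ * (|C| * Λ)) := by
    rw [hε.tr_eq]
    simp only [mul_apply_eq_comp]
    refine (Finset.abs_sum_le_sum_abs _ _).trans ((Finset.sum_le_sum fun i _ => hterm i).trans ?_)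
    simp
  have hval : bundleCurvature ψ u (rotT ψ u) t + s * bundleCurvature ψ u (rotN ψ u) t =
      1 / 2 * tr (F * liftL ψ u s t) := by
    rw [curvature_add_of_liftParallel h hψ ht hs, hF, harea, tr_mul_comm, smul_clm_mul, tr_smul]
    have h0 : α * γ ≠ 0 := (mul_pos hα hγ).ne'
    generalize tr (F * liftL ψ u s t) = x
    field_simp
  rw [hval, abs_mul]
  calc |(1 / 2 : ℝ)| * |tr (F * liftL ψ u s t)| ≤ 1 * |tr (F * liftL ψ u s t)| := by
        gcongr; norm_num
    _ ≤ _ := by rw [one_mul]; exact htr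

end

/-! ### Change of parameters -/

/-- The Jacobian determinant of a map of the parameter plane. -/
def jac (τ : E 2 → E 2) (t : E 2) : ℝ :=
  fderiv ℝ τ t (e 0) 0 * fderiv ℝ τ t (e 1) 1 - fderiv ℝ τ t (e 0) 1 * fderiv ℝ τ t (e 1) 0

lemma clm_eq_comb {W : Type*} [AddCommGroup W] [Module ℝ W] [TopologicalSpace W]
    (L : E 2 →L[ℝ] W) (v : E 2) :
    L v = v 0 • L (e 0) + v 1 • L (e 1) := by
  conv_lhs => rw [eq_sum_e v]
  simp [Fin.sum_univ_two]

lemma fderiv_comp_e {W : Type*} [NormedAddCommGroup W] [NormedSpace ℝ W] {f f' : E 2 → W}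
    {τ : E 2 → E 2} {t : E 2} (hτ : DifferentiableAt ℝ τ t) (hf : DifferentiableAt ℝ f (τ t))
    (hf' : f' =ᶠ[𝓝 t] f ∘ τ) (a : E 2) :
    fderiv ℝ f' t a = (fderiv ℝ τ t a) 0 • fderiv ℝ f (τ t) (e 0) +
      (fderiv ℝ τ t a) 1 • fderiv ℝ f (τ t) (e 1) := by
  rw [hf'.fderiv_eq, fderiv_comp t hf hτ, ContinuousLinearMap.comp_apply, clm_eq_comb]

section

variable {V : Type*} [NormedAddCommGroup V] [NormedSpace ℝ V] {τ : E 2 → E 2} {t : E 2}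

lemma contDiffOn_covEnd {G P : E 2 → V →L[ℝ] V} {O : Set (E 2)} (hO : IsOpen O)
    (hG : ContDiffOn ℝ ∞ G O) (hP : ContDiffOn ℝ ∞ P O) (a : E 2) :
    ContDiffOn ℝ ∞ (covEnd G P a) O :=
  (((hP.fderiv_of_isOpen hO (by simp)).clm_apply contDiffOn_const).add (hG.clm_comp hP)).sub
    (hP.clm_comp hG)

lemma contDiffOn_fundTerm {G : Fin 2 → E 2 → V →L[ℝ] V} {P : E 2 → V →L[ℝ] V} {O : Set (E 2)}
    (hO : IsOpen O) (hG : ∀ α, ContDiffOn ℝ ∞ (G α) O) (hP : ContDiffOn ℝ ∞ P O) :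
    ContDiffOn ℝ ∞ (fundTerm G P) O :=
  have h := fun α => contDiffOn_covEnd hO (hG α) hP
  ((h 0 _).clm_comp (h 1 _)).sub ((h 1 _).clm_comp (h 0 _))

lemma contDiffOn_connCurv {G : Fin 2 → E 2 → V →L[ℝ] V} {O : Set (E 2)}
    (hO : IsOpen O) (hG : ∀ α, ContDiffOn ℝ ∞ (G α) O) : ContDiffOn ℝ ∞ (connCurv G) O :=
  have h := fun α (a : E 2) => ((hG α).fderiv_of_isOpen hO (m := ∞) (by simp)).clm_apply
    (contDiffOn_const (c := a))
  ((h 1 _).sub (h 0 _)).add (((hG 0).clm_comp (hG 1)).sub ((hG 1).clm_comp (hG 0)))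

lemma smul_mul_smul_clm (c d : ℝ) (A B : V →L[ℝ] V) : (c • A) * (d • B) = (c * d) • (A * B) :=
  smul_mul_smul_comm c A d B

lemma fundTerm_comp {G G' : Fin 2 → E 2 → V →L[ℝ] V} {P P' : E 2 → V →L[ℝ] V}
    (hτ : DifferentiableAt ℝ τ t) (hP : DifferentiableAt ℝ P (τ t)) (hP' : P' =ᶠ[𝓝 t] P ∘ τ)
    (hG : ∀ α, G' α t = (fderiv ℝ τ t (e α)) 0 • G 0 (τ t) +
      (fderiv ℝ τ t (e α)) 1 • G 1 (τ t)) :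
    fundTerm G' P' t = jac τ t • fundTerm G P (τ t) := by
  have h1 : ∀ α, covEnd (G' α) P' (e α) t =
      (fderiv ℝ τ t (e α)) 0 • covEnd (G 0) P (e 0) (τ t) +
      (fderiv ℝ τ t (e α)) 1 • covEnd (G 1) P (e 1) (τ t) := by
    intro α
    unfold covEnd
    rw [fderiv_comp_e hτ hP hP', hG, hP'.eq_of_nhds, Function.comp_apply]
    simp only [add_mul, mul_add, smul_mul_assoc, mul_smul_comm]
    module
  unfold fundTerm jac
  rw [h1, h1]
  simp only [add_mul, mul_add, smul_mul_assoc, mul_smul_comm, smul_add, smul_smul]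
  module

end

section

variable {M : Type*} [TopologicalSpace M] [ChartedSpace (E 4) M]
  [RiemannianBundle (fun x : M => TangentSpace (𝓡 4) x)]
  {ψ : OpenPartialHomeomorph M (E 4)} {u u' : E 2 → E 4} {O O' : Set (E 2)}
  {τ : E 2 → E 2} {t : E 2}

lemma tangentVec_comp (hτ : DifferentiableAt ℝ τ t) (hu : DifferentiableAt ℝ u (τ t))
    (hu' : u' =ᶠ[𝓝 t] u ∘ τ) (α : Fin 2) :
    tangentVec u' t α = (fderiv ℝ τ t (e α)) 0 • tangentVec u (τ t) 0 +
      (fderiv ℝ τ t (e α)) 1 • tangentVec u (τ t) 1 :=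
  fderiv_comp_e hτ hu hu' _

lemma connForm_comp (hτ : DifferentiableAt ℝ τ t) (hu : DifferentiableAt ℝ u (τ t))
    (hu' : u' =ᶠ[𝓝 t] u ∘ τ) (α : Fin 2) :
    connForm ψ u' α t = (fderiv ℝ τ t (e α)) 0 • connForm ψ u 0 (τ t) +
      (fderiv ℝ τ t (e α)) 1 • connForm ψ u 1 (τ t) := by
  unfold connForm
  rw [tangentVec_comp hτ hu hu', hu'.eq_of_nhds, Function.comp_apply, map_add, map_smul, map_smul]

lemma areaElement_comp (hτ : DifferentiableAt ℝ τ t) (hu : DifferentiableAt ℝ u (τ t))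
    (hu' : u' =ᶠ[𝓝 t] u ∘ τ) : areaElement ψ u' t = |jac τ t| * areaElement ψ u (τ t) := by
  unfold areaElement
  rw [← Real.sqrt_sq_eq_abs, ← Real.sqrt_mul (sq_nonneg _)]
  simp only [← metricForm_apply]
  rw [tangentVec_comp hτ hu hu', tangentVec_comp hτ hu hu', hu'.eq_of_nhds, Function.comp_apply]
  simp only [map_add, map_smul, add_apply, smul_apply, smul_eq_mul, jac,
    metricForm_comm ψ _ (tangentVec u (τ t) 1) (tangentVec u (τ t) 0)]
  congr 1
  ring

/-- The tangential rotation changes sign when the parameters reverse the orientation. -/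
lemma rotTL_comp (hτ : DifferentiableAt ℝ τ t) (hu : DifferentiableAt ℝ u (τ t))
    (hu' : u' =ᶠ[𝓝 t] u ∘ τ) : rotTL ψ u' t = (jac τ t / |jac τ t|) • rotTL ψ u (τ t) := by
  ext1 v
  rw [rotTL, rotTL, areaElement_comp hτ hu hu', tangentVec_comp hτ hu hu',
    tangentVec_comp hτ hu hu', hu'.eq_of_nhds, Function.comp_apply, mul_inv]
  simp only [map_add, map_smul, add_apply, smul_apply, sub_apply, smul_eq_mul,
    ContinuousLinearMap.smulRight_apply, div_eq_mul_inv]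
  generalize |jac τ t|⁻¹ = c
  unfold jac
  module

lemma rotNL_comp (hτ : DifferentiableAt ℝ τ t) (hu : DifferentiableAt ℝ u (τ t))
    (hu' : u' =ᶠ[𝓝 t] u ∘ τ) : rotNL ψ u' t = (jac τ t / |jac τ t|) • rotNL ψ u (τ t) := by
  ext v k
  rw [smul_apply, PiLp.smul_apply, rotNL_apply, rotNL_apply, rotN_apply, rotN_apply,
    areaElement_comp hτ hu hu', tangentVec_comp hτ hu hu',
    tangentVec_comp hτ hu hu', hu'.eq_of_nhds, Function.comp_apply, mul_inv, smul_eq_mul,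
    Finset.mul_sum]
  refine Finset.sum_congr rfl fun l _ => ?_
  simp only [vol4_eq, PiLp.add_apply, PiLp.smul_apply, smul_eq_mul, div_eq_mul_inv]
  generalize |jac τ t|⁻¹ = c
  unfold jac
  ring

variable [IsManifold (𝓡 4) ∞ M]
  [IsContMDiffRiemannianBundle (𝓡 4) ∞ (E 4) (fun x : M => TangentSpace (𝓡 4) x)]
  (hψ : ψ ∈ IsManifold.maximalAtlas (𝓡 4) ∞ M)
  (h : IsLocalImmersion ψ u O) (h' : IsLocalImmersion ψ u' O') (ht' : t ∈ O')
  (hτO : τ t ∈ O) (hτ : ∀ᶠ s in 𝓝 t, DifferentiableAt ℝ τ s) (hu' : u' =ᶠ[𝓝 t] u ∘ τ)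
include hψ h h' ht' hτO hτ hu'

omit [IsContMDiffRiemannianBundle (𝓡 4) ∞ (E 4) (fun x : M => TangentSpace (𝓡 4) x)] in
lemma jac_ne_zero : jac τ t ≠ 0 := by
  intro h0
  have h1 := h'.areaElement_pos hψ ht'
  rw [areaElement_comp hτ.self_of_nhds
    ((h.smooth.contDiffAt (h.isOpen.mem_nhds hτO)).differentiableAt (by simp)) hu', h0] at h1
  simp at h1

omit [IsContMDiffRiemannianBundle (𝓡 4) ∞ (E 4) (fun x : M => TangentSpace (𝓡 4) x)] in
/-- The data of a change of parameters at `t` is also one at the nearby points. -/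
lemma eventually_comp : ∀ᶠ s in 𝓝 t, DifferentiableAt ℝ τ s ∧ DifferentiableAt ℝ u (τ s) ∧
    u' =ᶠ[𝓝 s] u ∘ τ ∧ jac τ s / |jac τ s| * (jac τ s / |jac τ s|) = 1 := by
  have h2 : ∀ᶠ s in 𝓝 t, τ s ∈ O := hτ.self_of_nhds.continuousAt.eventually (h.isOpen.mem_nhds hτO)
  filter_upwards [eventually_eventually_nhds.2 hτ, h2, eventually_eventually_nhds.2 hu', h'.isOpen.mem_nhds ht'] with s a b c d
  have := jac_ne_zero hψ h h' d b a c
  refine ⟨a.self_of_nhds,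
    (h.smooth.contDiffAt (h.isOpen.mem_nhds b)).differentiableAt (by simp), c, ?_⟩
  rw [div_mul_div_comm, abs_mul_abs_self, div_self (mul_self_ne_zero.2 this)]

/-- The curvature of a plane subbundle does not depend on the parameters of the surface: a reversal
of their orientation changes the signs of `j` and of the curvature endomorphism. -/
lemma bundleCurvature_comp {j j' : E 2 → E 4 →L[ℝ] E 4} (hj : ContDiffOn ℝ ∞ j O)
    (hj' : ContDiffOn ℝ ∞ j' O') (hcube : ∀ s ∈ O, j s * j s * j s = -j s)
    (hcube' : ∀ s ∈ O', j' s * j' s * j' s = -j' s)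
    (hjj' : ∀ᶠ s in 𝓝 t, j' s = (jac τ s / |jac τ s|) • j (τ s)) :
    bundleCurvature ψ u' (fun s v => j' s v) t = bundleCurvature ψ u (fun s v => j s v) (τ t) := by
  have hev := eventually_comp hψ h h' ht' hτO hτ hu'
  obtain ⟨hd, hdu, -, hsq⟩ := hev.self_of_nhds
  have hjd : DifferentiableAt ℝ j (τ t) :=
    (hj.contDiffAt (h.isOpen.mem_nhds hτO)).differentiableAt (by simp)
  have hPd : DifferentiableAt ℝ (fun s => -(j s * j s)) (τ t) := (hjd.mul hjd).neg
  have hP : (fun s => -(j' s * j' s)) =ᶠ[𝓝 t] (fun s => -(j s * j s)) ∘ τ := by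
    filter_upwards [hev, hjj'] with s hs1 hs2
    have h3 : j' s * j' s = j (τ s) * j (τ s) := by
      rw [hs2, smul_mul_smul_clm, hs1.2.2.2, one_smul]
    exact congrArg Neg.neg h3
  rw [bundleCurvature_eq h' hψ hj' hcube' ht', bundleCurvature_eq h hψ hj hcube hτO,
    fundTerm_comp hd hPd hP (connForm_comp hd hdu hu'), connCurv_connForm hψ h' ht',
    connCurv_connForm hψ h hτO, tangentVec_comp hd hdu hu', tangentVec_comp hd hdu hu',
    curvForm_comb, hu'.eq_of_nhds, Function.comp_apply, hjj'.self_of_nhds,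
    areaElement_comp hd hdu hu', smul_mul_smul_clm, tr_smul, smul_mul_smul_clm, tr_smul]
  have hj0 := jac_ne_zero hψ h h' ht' hτO hτ hu'
  have ha := (h.areaElement_pos hψ hτO).ne'
  change 1 / 2 * (jac τ t / |jac τ t| * jac τ t * _ + _) / _ = _
  have hsq' : jac τ t / |jac τ t| * jac τ t = |jac τ t| := by
    rw [div_mul_eq_mul_div, ← abs_mul_abs_self, mul_div_assoc, div_self (abs_ne_zero.2 hj0),
      mul_one]
  have hj1 := abs_ne_zero.2 hj0
  rw [hsq', ← mul_add]
  field_simp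

lemma tangentCurvature_comp :
    bundleCurvature ψ u' (rotT ψ u') t = bundleCurvature ψ u (rotT ψ u) (τ t) := by
  rw [rotT_eq, rotT_eq]
  refine bundleCurvature_comp hψ h h' ht' hτO hτ hu' (h.contDiffOn_rotTL hψ)
    (h'.contDiffOn_rotTL hψ) (fun r hr => rotTL_cube (h.posDef hψ hr) (h.independent r hr))
    (fun r hr => rotTL_cube (h'.posDef hψ hr) (h'.independent r hr)) ?_
  filter_upwards [eventually_comp hψ h h' ht' hτO hτ hu'] with s hs
  exact rotTL_comp hs.1 hs.2.1 hs.2.2.1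

lemma normalCurvature_comp :
    bundleCurvature ψ u' (rotN ψ u') t = bundleCurvature ψ u (rotN ψ u) (τ t) := by
  rw [rotN_eq, rotN_eq]
  refine bundleCurvature_comp hψ h h' ht' hτO hτ hu' (h.contDiffOn_rotNL hψ)
    (h'.contDiffOn_rotNL hψ) (fun r hr => rotNL_cube (h.posDef hψ hr) (h.independent r hr))
    (fun r hr => rotNL_cube (h'.posDef hψ hr) (h'.independent r hr)) ?_
  filter_upwards [eventually_comp hψ h h' ht' hτO hτ hu'] with s hs
  exact rotNL_comp hs.1 hs.2.1 hs.2.2.1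

end

section

variable {M : Type*} [TopologicalSpace M] [ChartedSpace (E 4) M] [IsManifold (𝓡 4) ∞ M]
  [RiemannianBundle (fun x : M => TangentSpace (𝓡 4) x)]
  [IsContMDiffRiemannianBundle (𝓡 4) ∞ (E 4) (fun x : M => TangentSpace (𝓡 4) x)]
  {ψ : OpenPartialHomeomorph M (E 4)} {u : E 2 → E 4} {O : Set (E 2)}
  (hψ : ψ ∈ IsManifold.maximalAtlas (𝓡 4) ∞ M) (h : IsLocalImmersion ψ u O)
include hψ h

omit hψ h in
lemma contDiffOn_tr {A : E 2 → E 4 →L[ℝ] E 4} (hA : ContDiffOn ℝ ∞ A O) :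
    ContDiffOn ℝ ∞ (fun t => tr (A t)) O :=
  ContDiffOn.sum fun i _ => contDiffOn_euclidean.1 (hA.clm_apply contDiffOn_const) i

lemma continuousOn_bundleCurvature {j : E 2 → E 4 →L[ℝ] E 4} (hj : ContDiffOn ℝ ∞ j O)
    (hcube : ∀ s ∈ O, j s * j s * j s = -j s) :
    ContinuousOn (bundleCurvature ψ u fun s v => j s v) O := by
  have hP : ContDiffOn ℝ ∞ (fun s => -(j s * j s)) O := (hj.clm_comp hj).neg
  have hfund : ContDiffOn ℝ ∞ (fundTerm (connForm ψ u) (fun s => -(j s * j s))) O :=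
    contDiffOn_fundTerm h.isOpen (h.contDiffOn_connForm hψ) hP
  have hcurv : ContDiffOn ℝ ∞ (connCurv (connForm ψ u)) O :=
    contDiffOn_connCurv h.isOpen (h.contDiffOn_connForm hψ)
  have hmain : ContinuousOn (fun t => 1 / 2 * (tr (j t * connCurv (connForm ψ u) t) +
        tr (j t * fundTerm (connForm ψ u) (fun s => -(j s * j s)) t)) / areaElement ψ u t) O :=
    ((contDiffOn_const.mul ((contDiffOn_tr (hj.clm_comp hcurv)).add
      (contDiffOn_tr (hj.clm_comp hfund)))).div (h.contDiffOn_areaElement hψ)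
        fun t ht => (h.areaElement_pos hψ ht).ne').continuousOn
  exact hmain.congr fun t ht => bundleCurvature_eq h hψ hj hcube ht

lemma continuousOn_tangentCurvature : ContinuousOn (bundleCurvature ψ u (rotT ψ u)) O := by
  rw [rotT_eq]
  exact continuousOn_bundleCurvature hψ h (h.contDiffOn_rotTL hψ)
    (fun r hr => rotTL_cube (h.posDef hψ hr) (h.independent r hr))

lemma continuousOn_normalCurvature : ContinuousOn (bundleCurvature ψ u (rotN ψ u)) O := by
  rw [rotN_eq]
  exact continuousOn_bundleCurvature hψ h (h.contDiffOn_rotNL hψ)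
    (fun r hr => rotNL_cube (h.posDef hψ hr) (h.independent r hr))

end

/-! ### The tangential divergence of a vector field along the surface -/

section

variable {M : Type*} [TopologicalSpace M] [ChartedSpace (E 4) M]
  [RiemannianBundle (fun x : M => TangentSpace (𝓡 4) x)]

/-- The divergence `∑ ⟨∇_{ε_i} V, ε_i⟩` (over an orthonormal basis of the tangent plane) of a field
`V` of ambient vectors along `u`. It is written here with the coordinate tangent vectors and the
tangential rotation, which makes its smoothness and Stokes' formula immediate. -/
def surfDiv (ψ : OpenPartialHomeomorph M (E 4)) (u V : E 2 → E 4) (t : E 2) : ℝ :=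
  (areaElement ψ u t)⁻¹ *
    (metricForm ψ (u t) (covDeriv ψ u V 1 t) (rotTL ψ u t (tangentVec u t 0)) -
      metricForm ψ (u t) (covDeriv ψ u V 0 t) (rotTL ψ u t (tangentVec u t 1)))

variable {ψ : OpenPartialHomeomorph M (E 4)} {u u' V V' : E 2 → E 4} {O O' : Set (E 2)}
  {τ : E 2 → E 2} {t : E 2}

lemma surfDiv_congr (hV : V =ᶠ[𝓝 t] V') : surfDiv ψ u V t = surfDiv ψ u V' t := by
  simp only [surfDiv, covDeriv_eq, hV.fderiv_eq, hV.eq_of_nhds]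

lemma surfDiv_zero : surfDiv ψ u (fun _ => 0) t = 0 := by
  simp [surfDiv, covDeriv_eq]

lemma surfDiv_add (hV : DifferentiableAt ℝ V t) (hV' : DifferentiableAt ℝ V' t) :
    surfDiv ψ u (fun s => V s + V' s) t = surfDiv ψ u V t + surfDiv ψ u V' t := by
  simp only [surfDiv, covDeriv_eq, fderiv_fun_add hV hV', map_add, add_apply]
  ring

/-- If the covariant derivative of `V` is tensorial, given by `B`, then the divergence is the trace
of `B` over the tangent plane. -/
lemma AdaptedFrame.surfDiv_eq {ε : Fin 4 → E 4} {α β γ : ℝ}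
    (hε : AdaptedFrame ψ (u t) (tangentVec u t 0) (tangentVec u t 1) ε α β γ)
    (B : E 4 →L[ℝ] E 4) (hB : ∀ i, covDeriv ψ u V i t = B (tangentVec u t i)) :
    surfDiv ψ u V t = metricForm ψ (u t) (B (ε 0)) (ε 0) + metricForm ψ (u t) (B (ε 1)) (ε 1) := by
  have h1 := hε.pos_left.ne'
  have h2 := hε.pos_right.ne'
  rw [surfDiv, hB, hB, hε.areaElement_eq, hε.eq_left, hε.eq_right]
  simp only [map_add, map_smul, add_apply, smul_apply, smul_eq_mul, hε.rotTL_zero, hε.rotTL_one,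
    map_neg]
  field_simp
  ring

variable [IsManifold (𝓡 4) ∞ M]
  [IsContMDiffRiemannianBundle (𝓡 4) ∞ (E 4) (fun x : M => TangentSpace (𝓡 4) x)]
  (hψ : ψ ∈ IsManifold.maximalAtlas (𝓡 4) ∞ M)
  (h : IsLocalImmersion ψ u O)
include hψ h

omit [IsContMDiffRiemannianBundle (𝓡 4) ∞ (E 4) (fun x : M => TangentSpace (𝓡 4) x)] in
lemma surfDiv_comp (h' : IsLocalImmersion ψ u' O') (ht' : t ∈ O')
    (hτO : τ t ∈ O) (hτ : ∀ᶠ s in 𝓝 t, DifferentiableAt ℝ τ s) (hu' : u' =ᶠ[𝓝 t] u ∘ τ)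
    (hV : DifferentiableAt ℝ V (τ t)) (hV' : V' =ᶠ[𝓝 t] V ∘ τ) :
    surfDiv ψ u' V' t = surfDiv ψ u V (τ t) := by
  obtain ⟨hd, hdu, -, hsq⟩ := (eventually_comp hψ h h' ht' hτO hτ hu').self_of_nhds
  have hcov : ∀ α, covDeriv ψ u' V' α t = (fderiv ℝ τ t (e α)) 0 • covDeriv ψ u V 0 (τ t) +
      (fderiv ℝ τ t (e α)) 1 • covDeriv ψ u V 1 (τ t) := by
    intro α
    rw [covDeriv_eq, covDeriv_eq, covDeriv_eq, fderiv_comp_e hd hV hV', connForm_comp hd hdu hu',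
      hV'.eq_of_nhds]
    simp only [add_apply, smul_apply, Function.comp_apply]
    module
  have hj0 := jac_ne_zero hψ h h' ht' hτO hτ hu'
  have ha := (h.areaElement_pos hψ hτO).ne'
  have hj1 := abs_ne_zero.2 hj0
  have hsq' : |jac τ t|⁻¹ * (jac τ t / |jac τ t|) * jac τ t = 1 := by
    field_simp
    rw [sq_abs]
  rw [surfDiv, surfDiv, hcov, hcov, tangentVec_comp hd hdu hu', tangentVec_comp hd hdu hu',
    rotTL_comp hd hdu hu', areaElement_comp hd hdu hu', hu'.eq_of_nhds, Function.comp_apply, mul_inv]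
  simp only [map_add, map_smul, add_apply, smul_apply, smul_eq_mul]
  unfold jac at hsq' ⊢
  linear_combination ((areaElement ψ u (τ t))⁻¹ *
    (metricForm ψ (u (τ t)) (covDeriv ψ u V 1 (τ t)) (rotTL ψ u (τ t) (tangentVec u (τ t) 0)) -
      metricForm ψ (u (τ t)) (covDeriv ψ u V 0 (τ t)) (rotTL ψ u (τ t) (tangentVec u (τ t) 1)))) *
    hsq'

lemma contDiffOn_surfDiv (hV : ContDiffOn ℝ ∞ V O) : ContDiffOn ℝ ∞ (surfDiv ψ u V) O := by
  have hcov : ∀ α, ContDiffOn ℝ ∞ (covDeriv ψ u V α) O := fun α => by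
    have : covDeriv ψ u V α = fun t => fderiv ℝ V t (e α) + connForm ψ u α t (V t) :=
      funext fun t => covDeriv_eq ψ u V α t
    rw [this]
    exact ((hV.fderiv_of_isOpen h.isOpen (by simp)).clm_apply contDiffOn_const).add
      ((h.contDiffOn_connForm hψ α).clm_apply hV)
  have hrot : ∀ α, ContDiffOn ℝ ∞ (fun t => rotTL ψ u t (tangentVec u t α)) O := fun α =>
    (h.contDiffOn_rotTL hψ).clm_apply (h.contDiffOn_tangentVec α)
  have hg := h.contDiffOn_metricForm hψ
  exact (h.contDiffOn_areaElement_inv hψ).mul (((hg.clm_apply (hcov 1)).clm_apply (hrot 0)).sub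
    ((hg.clm_apply (hcov 0)).clm_apply (hrot 1)))

/-- The `1`-form `α(X) = ⟨V, J X⟩` has exterior derivative `-(div V) dA`, because `J` is parallel and
the Levi-Civita connection is metric and torsion free. -/
lemma fderiv_oneForm {s : ℝ} (hs : ∀ t ∈ O, LiftParallelAt ψ u s t) (ht : t ∈ O)
    (hV : DifferentiableAt ℝ V t) :
    fderiv ℝ (fun r => metricForm ψ (u r) (V r) (rotTL ψ u r (tangentVec u r 1))) t (e 0) -
      fderiv ℝ (fun r => metricForm ψ (u r) (V r) (rotTL ψ u r (tangentVec u r 0))) t (e 1) =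
    -(areaElement ψ u t * surfDiv ψ u V t) := by
  have hud : DifferentiableAt ℝ u t :=
    (h.smooth.contDiffAt (h.isOpen.mem_nhds ht)).differentiableAt (by simp)
  have hXd : ∀ α, DifferentiableAt ℝ (fun r => tangentVec u r α) t := fun α =>
    ((h.contDiffOn_tangentVec α).contDiffAt (h.isOpen.mem_nhds ht)).differentiableAt (by simp)
  have hJd := differentiableAt_liftL h hψ ht s
  have hgd : DifferentiableAt ℝ (metricForm ψ) (u t) :=
    ((contDiffOn_metricForm hψ).contDiffAt
      (ψ.open_target.mem_nhds (h.mapsTo ht))).differentiableAt (by simp)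
  -- `J` agrees with the tangential rotation on the tangent plane.
  have hJX : ∀ r ∈ O, ∀ α, rotTL ψ u r (tangentVec u r α) = liftL ψ u s r (tangentVec u r α) := by
    intro r hr α
    obtain ⟨ε, a, b, c, hε⟩ := exists_adaptedFrame (h.posDef hψ hr) (h.independent r hr)
    have h0 : rotNL ψ u r (tangentVec u r α) = 0 := by
      fin_cases α
      · change rotNL ψ u r (tangentVec u r 0) = 0
        rw [hε.eq_left, map_smul, hε.rotNL_zero (h.posDef hψ hr), smul_zero]
      · change rotNL ψ u r (tangentVec u r 1) = 0
        rw [hε.eq_right, map_add, map_smul, map_smul, hε.rotNL_zero (h.posDef hψ hr),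
          hε.rotNL_one (h.posDef hψ hr), smul_zero, smul_zero, add_zero]
    simp [liftL, h0]
  have hJ : ∀ α, fderiv ℝ (liftL ψ u s) t (e α) =
      liftL ψ u s t * connForm ψ u α t - connForm ψ u α t * liftL ψ u s t := by
    intro α
    have := covEnd_liftL h hψ ht (hs t ht) α
    unfold covEnd at this
    rw [← sub_eq_zero, ← this]
    abel
  -- Derivative of the coefficient `⟨V, J ∂_β⟩` in the direction `∂_α`.
  have hder : ∀ α β, fderiv ℝ (fun r => metricForm ψ (u r) (V r)
      (rotTL ψ u r (tangentVec u r β))) t (e α) =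
      metricForm ψ (u t) (covDeriv ψ u V α t) (liftL ψ u s t (tangentVec u t β)) +
      metricForm ψ (u t) (V t) (liftL ψ u s t (fderiv ℝ (fun r => tangentVec u r β) t (e α) +
        connForm ψ u α t (tangentVec u t β))) := by
    intro α β
    have hev : (fun r => metricForm ψ (u r) (V r) (rotTL ψ u r (tangentVec u r β))) =ᶠ[𝓝 t]
        fun r => metricForm ψ (u r) (V r) (liftL ψ u s r (tangentVec u r β)) := by
      filter_upwards [h.isOpen.mem_nhds ht] with r hr
      rw [hJX r hr]
    have hgu : DifferentiableAt ℝ (fun r => metricForm ψ (u r)) t :=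
      DifferentiableAt.comp (G := E 4 →L[ℝ] E 4 →L[ℝ] ℝ) (g := metricForm ψ) t hgd hud
    have hgu' : fderiv ℝ (fun r => metricForm ψ (u r)) t (e α) =
        fderiv ℝ (metricForm ψ) (u t) (tangentVec u t α) := by
      have : fderiv ℝ (metricForm ψ ∘ u) t = _ :=
        fderiv_comp (G := E 4 →L[ℝ] E 4 →L[ℝ] ℝ) (g := metricForm ψ) t hgd hud
      exact DFunLike.congr_fun this (e α)
    have e1 : fderiv ℝ (fun r => liftL ψ u s r (tangentVec u r β)) t (e α) =
        liftL ψ u s t (fderiv ℝ (fun r => tangentVec u r β) t (e α)) +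
          fderiv ℝ (liftL ψ u s) t (e α) (tangentVec u t β) := by
      rw [fderiv_clm_apply hJd (hXd β)]; simp
    have e2 : fderiv ℝ (fun r => metricForm ψ (u r) (V r)) t (e α) =
        metricForm ψ (u t) (fderiv ℝ V t (e α)) +
          fderiv ℝ (metricForm ψ) (u t) (tangentVec u t α) (V t) := by
      rw [fderiv_clm_apply hgu hV, ← hgu']; simp
    rw [hev.fderiv_eq, fderiv_clm_apply (hgu.clm_apply hV) (hJd.clm_apply (hXd β))]
    simp only [add_apply, ContinuousLinearMap.comp_apply, ContinuousLinearMap.flip_apply, e1, e2]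
    rw [fderiv_metricForm hψ (h.mapsTo ht), hJ, covDeriv_eq]
    have hconn : christoffelForm ψ (u t) (tangentVec u t α) = connForm ψ u α t := rfl
    simp only [hconn, map_add, add_apply, sub_apply, mul_apply_eq_comp, map_sub]
    ring
  have hsymm : fderiv ℝ (fun r => tangentVec u r 1) t (e 0) =
      fderiv ℝ (fun r => tangentVec u r 0) t (e 1) :=
    fderiv_fderiv_apply_comm (h.smooth.contDiffAt (h.isOpen.mem_nhds ht)) (e 0) (e 1)
  have htor : connForm ψ u 0 t (tangentVec u t 1) = connForm ψ u 1 t (tangentVec u t 0) :=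
    christoffelForm_comm ψ _ _ _
  have ha := (h.areaElement_pos hψ ht).ne'
  rw [hder, hder, hsymm, htor, surfDiv, hJX t ht, hJX t ht]
  field_simp
  ring

/-- The divergence theorem for a compactly supported field in one chart of a superminimal surface.
The field need not be tangent: there is no mean curvature term, as superminimal surfaces are
minimal. -/
lemma integral_surfDiv_eq_zero {s : ℝ} (hs : ∀ t ∈ O, LiftParallelAt ψ u s t)
    (hV : ContDiffOn ℝ ∞ V O) (hVc : HasCompactSupport V) (hVO : tsupport V ⊆ O) :
    ∫ t in O, areaElement ψ u t * surfDiv ψ u V t = 0 := by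
  let w : Fin 2 → E 2 → ℝ := fun α r => metricForm ψ (u r) (V r) (rotTL ψ u r (tangentVec u r α))
  have hw0 : ∀ α r, V r = 0 → w α r = 0 := fun α r hr => by simp [w, hr]
  have hwO : ∀ α, ContDiffOn ℝ ∞ (w α) O := fun α =>
    ((h.contDiffOn_metricForm hψ).clm_apply hV).clm_apply
      ((h.contDiffOn_rotTL hψ).clm_apply (h.contDiffOn_tangentVec α))
  have hout : ∀ t ∉ tsupport V, V =ᶠ[𝓝 t] fun _ => 0 := fun t ht => by
    have := (isClosed_tsupport V).isOpen_compl.mem_nhds ht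
    filter_upwards [this] with r hr using image_eq_zero_of_notMem_tsupport hr
  have hw : ∀ α, ContDiff ℝ ∞ (w α) := fun α => by
    rw [contDiff_iff_contDiffAt]
    intro t
    by_cases ht : t ∈ O
    · exact (hwO α).contDiffAt (h.isOpen.mem_nhds ht)
    · refine (contDiffAt_const (c := (0 : ℝ))).congr_of_eventuallyEq ?_
      filter_upwards [hout t fun h' => ht (hVO h')] with r hr using hw0 α r hr
  have hwc : ∀ α, HasCompactSupport (w α) := fun α =>
    hVc.mono fun r hr h0 => hr (hw0 α r h0)
  have hint : ∀ α (a : E 2), Integrable (fun t => fderiv ℝ (w α) t a) ∧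
      ∫ t, fderiv ℝ (w α) t a = 0 := by
    intro α a
    have hc : Continuous fun t => fderiv ℝ (w α) t a :=
      ((hw α).continuous_fderiv (by simp)).clm_apply continuous_const
    have h1 : Integrable (fun t => fderiv ℝ (w α) t a) :=
      hc.integrable_of_hasCompactSupport ((hwc α).fderiv_apply ℝ a)
    refine ⟨h1, ?_⟩
    have := integral_mul_fderiv_eq_neg_fderiv_mul_of_integrable (μ := (volume : Measure (E 2)))
      (f := fun _ => (1 : ℝ)) (g := w α) (v := a) (by simp)
      (by simpa using h1)
      (by simpa using (hw α).continuous.integrable_of_hasCompactSupport (hwc α))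
      (fun x _ => differentiableAt_const _) (fun x _ => (hw α).differentiable (by simp) x)
    simpa using this
  have hzero : ∀ t ∉ O, areaElement ψ u t * surfDiv ψ u V t = 0 := fun t ht => by
    rw [surfDiv_congr (hout t fun h' => ht (hVO h')), surfDiv_zero, mul_zero]
  rw [setIntegral_eq_integral_of_forall_compl_eq_zero hzero]
  have hpt : ∀ t, areaElement ψ u t * surfDiv ψ u V t =
      fderiv ℝ (w 0) t (e 1) - fderiv ℝ (w 1) t (e 0) := by
    intro t
    by_cases ht : t ∈ O
    · have := fderiv_oneForm hψ h hs ht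
        ((hV.contDiffAt (h.isOpen.mem_nhds ht)).differentiableAt (by simp))
      linarith
    · have hwz : ∀ α, w α =ᶠ[𝓝 t] fun _ => (0 : ℝ) := fun α => by
        filter_upwards [hout t fun h' => ht (hVO h')] with r hr using hw0 α r hr
      rw [hzero t ht, (hwz 0).fderiv_eq, (hwz 1).fderiv_eq]
      simp
  simp only [hpt]
  rw [integral_sub (hint 0 _).1 (hint 1 _).1, (hint 0 _).2, (hint 1 _).2, sub_zero]

end

/-! ### The divergence of radial fields -/

section

variable {M : Type*} [TopologicalSpace M] [ChartedSpace (E 4) M] [IsManifold (𝓡 4) ∞ M]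
  [RiemannianBundle (fun x : M => TangentSpace (𝓡 4) x)]
  [IsContMDiffRiemannianBundle (𝓡 4) ∞ (E 4) (fun x : M => TangentSpace (𝓡 4) x)]
  {ψ : OpenPartialHomeomorph M (E 4)} (hψ : ψ ∈ IsManifold.maximalAtlas (𝓡 4) ∞ M)
include hψ

/-- A cut-off radial field in the coordinates has tangential divergence at least `2χ` up to an
error of first order in the distance to the centre and the error due to the cut-off. -/
lemma exists_surfDiv_radial_bound {K : Set (E 4)} (hK : IsCompact K) (hKt : K ⊆ ψ.target)
    (y₀ : E 4) : ∃ C : ℝ, 0 ≤ C ∧ ∀ (u : E 2 → E 4) (O : Set (E 2)) (t : E 2) (χ : ℝ → ℝ),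
      IsLocalImmersion ψ u O → t ∈ O → u t ∈ K → DifferentiableAt ℝ χ (‖u t - y₀‖ ^ 2) →
      0 ≤ χ (‖u t - y₀‖ ^ 2) →
      (2 - C * ‖u t - y₀‖) * χ (‖u t - y₀‖ ^ 2) -
        C * (|deriv χ (‖u t - y₀‖ ^ 2)| * ‖u t - y₀‖ ^ 2) ≤
      surfDiv ψ u (fun s => χ (‖u s - y₀‖ ^ 2) • (u s - y₀)) t := by
  obtain ⟨Λ, hΛ, hup, hunit⟩ := exists_metricForm_bounds hψ hK hKt
  obtain ⟨G, hG⟩ := hK.exists_bound_of_continuousOn (E := E 4 →L[ℝ] E 4 →L[ℝ] E 4)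
    ((contDiffOn_christoffelForm hψ).continuousOn.mono hKt)
  refine ⟨4 * Λ ^ 3 + 2 * |G| * Λ ^ 3, by positivity, fun u O t χ h ht hut hχ hχ0 => ?_⟩
  obtain ⟨ε, α, β, γ, hε⟩ := exists_adaptedFrame (h.posDef hψ ht) (h.independent t ht)
  set x := u t - y₀ with hx
  have hud : DifferentiableAt ℝ u t :=
    (h.smooth.contDiffAt (h.isOpen.mem_nhds ht)).differentiableAt (by simp)
  have hsq : HasFDerivAt (fun s => ‖u s - y₀‖ ^ 2)
      (2 • (innerSL ℝ x).comp (fderiv ℝ u t)) t :=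
    (hud.hasFDerivAt.sub_const y₀).norm_sq
  have hV : HasFDerivAt (fun s => χ (‖u s - y₀‖ ^ 2) • (u s - y₀)) _ t :=
    (hχ.hasDerivAt.comp_hasFDerivAt t hsq).smul (hud.hasFDerivAt.sub_const y₀)
  set c := χ (‖x‖ ^ 2) with hc
  set c' := deriv χ (‖x‖ ^ 2) with hc'
  -- The covariant derivative of the radial field in a tangent direction `v` is `B v`.
  let B : E 4 →L[ℝ] E 4 := c • ContinuousLinearMap.id ℝ (E 4) +
    (2 * c') • (innerSL ℝ x).smulRight x + c • (christoffelForm ψ (u t)).flip x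
  have hBv : ∀ v, B v = c • v + (2 * c' * inner ℝ x v) • x + c • christoffelForm ψ (u t) v x := by
    intro v
    simp only [B, add_apply, smul_apply, ContinuousLinearMap.id_apply,
      ContinuousLinearMap.smulRight_apply, innerSL_apply_apply, ContinuousLinearMap.flip_apply,
      smul_smul]
  have hB : ∀ i, covDeriv ψ u (fun s => χ (‖u s - y₀‖ ^ 2) • (u s - y₀)) i t =
      B (tangentVec u t i) := by
    intro i
    have hconn : connForm ψ u i t = christoffelForm ψ (u t) (tangentVec u t i) := rfl
    rw [covDeriv_eq, hV.fderiv, hBv, hconn, map_smul]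
    congr 1
    simp only [add_apply, smul_apply, ContinuousLinearMap.smulRight_apply,
      ContinuousLinearMap.comp_apply, innerSL_apply_apply, Function.comp_apply]
    rw [← hx, ← hc]
    congr 1
    change (c' • 2 • inner ℝ x (tangentVec u t i)) • x = _
    rw [nsmul_eq_mul, smul_eq_mul]
    congr 1
    push_cast
    ring
  have hεn : ∀ i, ‖ε i‖ ≤ Λ := fun i => hunit _ hut _ (by simp [hε.orthonormal])
  have hterm : ∀ i, c - 2 * |c'| * (Λ ^ 3 * ‖x‖ ^ 2) - c * (|G| * Λ ^ 3 * ‖x‖) ≤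
      metricForm ψ (u t) (B (ε i)) (ε i) := by
    intro i
    have h0 := norm_nonneg x
    have e1 : |inner ℝ x (ε i) * metricForm ψ (u t) x (ε i)| ≤ Λ ^ 3 * ‖x‖ ^ 2 := by
      rw [abs_mul]
      calc _ ≤ (‖x‖ * ‖ε i‖) * (Λ * ‖x‖ * ‖ε i‖) := by
            gcongr
            · exact abs_real_inner_le_norm _ _
            · exact hup _ hut _ _
        _ ≤ (‖x‖ * Λ) * (Λ * ‖x‖ * Λ) := by
            gcongr
            · exact hεn i
            · exact hεn i
        _ = _ := by ring
    have e2 : |metricForm ψ (u t) (christoffelForm ψ (u t) (ε i) x) (ε i)| ≤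
        |G| * Λ ^ 3 * ‖x‖ := by
      have e3 : ‖christoffelForm ψ (u t) (ε i) x‖ ≤ |G| * Λ * ‖x‖ := by
        refine ((christoffelForm ψ (u t) (ε i)).le_opNorm x).trans ?_
        gcongr
        refine ((christoffelForm ψ (u t)).le_opNorm (ε i)).trans ?_
        exact mul_le_mul ((hG _ hut).trans (le_abs_self G)) (hεn i) (norm_nonneg _) (abs_nonneg _)
      calc _ ≤ Λ * ‖christoffelForm ψ (u t) (ε i) x‖ * ‖ε i‖ := hup _ hut _ _
        _ ≤ Λ * (|G| * Λ * ‖x‖) * Λ := by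
            gcongr
            exact hεn i
        _ = _ := by ring
    rw [hBv]
    simp only [map_add, map_smul, add_apply, smul_apply, smul_eq_mul, hε.orthonormal, if_true,
      mul_one]
    have e4 : |c' * (inner ℝ x (ε i) * metricForm ψ (u t) x (ε i))| ≤
        |c'| * (Λ ^ 3 * ‖x‖ ^ 2) := by
      rw [abs_mul]
      gcongr
    have e5 := neg_le_of_abs_le e4
    have e6 := mul_le_mul_of_nonneg_left (neg_le_of_abs_le e2) hχ0
    linarith
  rw [hε.surfDiv_eq B hB]
  have := add_le_add (hterm 0) (hterm 1)
  refine le_trans ?_ this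
  have h1 : 0 ≤ |c'| * ‖x‖ ^ 2 * (|G| * Λ ^ 3) := by positivity
  have h2 : 0 ≤ c * ‖x‖ * Λ ^ 3 := by positivity
  linarith

end

/-! ### Immersed surfaces read in charts -/

section

variable {M : Type*} [TopologicalSpace M] [ChartedSpace (E 4) M]
  {S : Type*} [TopologicalSpace S] [ChartedSpace (E 2) S]
  {ψ : OpenPartialHomeomorph M (E 4)} {φ : OpenPartialHomeomorph S (E 2)} {f : S → M} {x : S}

/-- The part of the image of the chart `φ` on which `f` can be read in the chart `ψ`. -/
def paramDomain (ψ : OpenPartialHomeomorph M (E 4)) (φ : OpenPartialHomeomorph S (E 2))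
    (f : S → M) : Set (E 2) :=
  φ.target ∩ φ.symm ⁻¹' (f ⁻¹' ψ.source)

omit [ChartedSpace (E 4) M] [ChartedSpace (E 2) S] in
lemma mem_paramDomain (hx : x ∈ φ.source) (hfx : f x ∈ ψ.source) : φ x ∈ paramDomain ψ φ f := by
  refine ⟨φ.map_source hx, ?_⟩
  simpa [φ.left_inv hx] using hfx

omit [ChartedSpace (E 4) M] [ChartedSpace (E 2) S] in
lemma isOpen_paramDomain (hf : Continuous f) : IsOpen (paramDomain ψ φ f) :=
  φ.isOpen_inter_preimage_symm (ψ.open_source.preimage hf)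

variable (hψ : ψ ∈ IsManifold.maximalAtlas (𝓡 4) ∞ M) (hφ : φ ∈ IsManifold.maximalAtlas (𝓡 2) ∞ S)
  (hf : IsSmoothImmersion f)

include hφ in
lemma contDiffOn_comp_symm {n : ℕ} {V : S → E n} {U : Set S}
    (hV : ContMDiffOn (𝓡 2) (𝓡 n) ∞ V U) :
    ContDiffOn ℝ ∞ (fun t => V (φ.symm t)) (φ.target ∩ φ.symm ⁻¹' U) :=
  contMDiffOn_iff_contDiffOn.1 <| hV.comp
    ((contMDiffOn_symm_of_mem_maximalAtlas hφ).mono inter_subset_left) fun _ ht => ht.2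

include hψ hf in
lemma contMDiffOn_chart_comp :
    ContMDiffOn (𝓡 2) (𝓡 4) ∞ (fun x => ψ (f x)) (f ⁻¹' ψ.source) :=
  (contMDiffOn_of_mem_maximalAtlas hψ).comp hf.smooth.contMDiffOn fun _ hx => hx

variable [IsManifold (𝓡 4) ∞ M] [IsManifold (𝓡 2) ∞ S]
include hψ hφ hf

lemma isLocalImmersion_inCharts : IsLocalImmersion ψ (inCharts ψ φ f) (paramDomain ψ φ f) where
  isOpen := isOpen_paramDomain hf.smooth.continuous
  smooth := contDiffOn_comp_symm hφ (contMDiffOn_chart_comp hψ hf)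
  mapsTo t ht := ψ.map_source ht.2
  independent t ht := by
    have h1 := (mdifferentiable_of_mem_maximalAtlas hφ).symm.mfderiv_injective
      (x := t) (by simpa using ht.1)
    have h2 := (mdifferentiable_of_mem_maximalAtlas hψ).mfderiv_injective ht.2
    have h3 := hf.injective_mfderiv (φ.symm t)
    have d1 : MDifferentiableAt (𝓡 2) (𝓡 2) φ.symm t :=
      (mdifferentiable_of_mem_maximalAtlas hφ).mdifferentiableAt_symm ht.1
    have d2 : MDifferentiableAt (𝓡 4) (𝓡 4) ψ (f (φ.symm t)) :=
      (mdifferentiable_of_mem_maximalAtlas hψ).mdifferentiableAt ht.2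
    have d3 : MDifferentiableAt (𝓡 2) (𝓡 4) f (φ.symm t) :=
      hf.smooth.mdifferentiableAt (by simp)
    have hcomp : HasMFDerivAt (𝓡 2) (𝓡 4) (ψ ∘ f ∘ φ.symm) t _ :=
      d2.hasMFDerivAt.comp t (d3.hasMFDerivAt.comp t d1.hasMFDerivAt)
    let A : E 2 →L[ℝ] E 4 := (mfderiv (𝓡 4) (𝓡 4) ψ (f (φ.symm t))).comp
      ((mfderiv (𝓡 2) (𝓡 4) f (φ.symm t)).comp (mfderiv (𝓡 2) (𝓡 2) φ.symm t))
    have hfd : HasFDerivAt (inCharts ψ φ f) A t := hasMFDerivAt_iff_hasFDerivAt.1 hcomp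
    have hinj : Function.Injective (fderiv ℝ (inCharts ψ φ f) t) := by
      rw [hfd.fderiv]
      exact h2.comp (h3.comp h1)
    have hli : LinearIndependent ℝ ![(e 0 : E 2), e 1] := by
      rw [LinearIndependent.pair_iff]
      intro a b hab
      have h0 := congrArg (fun v : E 2 => v 0) hab
      have h1 := congrArg (fun v : E 2 => v 1) hab
      simp [e] at h0 h1
      exact ⟨h0, h1⟩
    have hcomb : ![tangentVec (inCharts ψ φ f) t 0, tangentVec (inCharts ψ φ f) t 1] =
        (fderiv ℝ (inCharts ψ φ f) t : E 2 →ₗ[ℝ] E 4) ∘ ![e 0, e 1] := by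
      ext i
      fin_cases i <;> rfl
    rw [hcomb]
    exact hli.map' _ (LinearMap.ker_eq_bot.2 hinj)

end

section

variable {M : Type*} [TopologicalSpace M]
  {S : Type*} [TopologicalSpace S] [ChartedSpace (E 2) S]
  {ψ : OpenPartialHomeomorph M (E 4)} {φ φ' : OpenPartialHomeomorph S (E 2)} {f : S → M} {x : S}

lemma eventually_differentiableAt_transition [IsManifold (𝓡 2) ∞ S]
    (hφ : φ ∈ IsManifold.maximalAtlas (𝓡 2) ∞ S)
    (hφ' : φ' ∈ IsManifold.maximalAtlas (𝓡 2) ∞ S) (hx : x ∈ φ.source) (hx' : x ∈ φ'.source) :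
    ∀ᶠ r in 𝓝 (φ' x), DifferentiableAt ℝ (φ ∘ φ'.symm) r := by
  have hO : IsOpen (φ'.target ∩ φ'.symm ⁻¹' φ.source) :=
    φ'.isOpen_inter_preimage_symm φ.open_source
  have hd : ContDiffOn ℝ ∞ (φ ∘ φ'.symm) (φ'.target ∩ φ'.symm ⁻¹' φ.source) :=
    contDiffOn_comp_symm hφ' (contMDiffOn_of_mem_maximalAtlas hφ)
  filter_upwards [hO.mem_nhds ⟨φ'.map_source hx', by simpa [φ'.left_inv hx'] using hx⟩] with r hr
  exact (hd.contDiffAt (hO.mem_nhds hr)).differentiableAt (by simp)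

omit [ChartedSpace (E 2) S] in
lemma eventuallyEq_comp_transition {W : Type*} (V : S → W) (hx : x ∈ φ.source)
    (hx' : x ∈ φ'.source) :
    (fun r => V (φ'.symm r)) =ᶠ[𝓝 (φ' x)] (fun r => V (φ.symm r)) ∘ (φ ∘ φ'.symm) := by
  have hO : IsOpen (φ'.target ∩ φ'.symm ⁻¹' φ.source) :=
    φ'.isOpen_inter_preimage_symm φ.open_source
  filter_upwards [hO.mem_nhds ⟨φ'.map_source hx', by simpa [φ'.left_inv hx'] using hx⟩] with r hr
  simp only [Function.comp_apply]
  rw [φ.left_inv hr.2]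

end

section

variable {M : Type*} [TopologicalSpace M] [ChartedSpace (E 4) M]
  [RiemannianBundle (fun x : M => TangentSpace (𝓡 4) x)]
  {S : Type*} [TopologicalSpace S] [ChartedSpace (E 2) S]

/-- The tangential divergence of a field `V : S → E 4` of ambient vectors, given in the
coordinates `ψ`, along the immersion `f`. -/
def divAlong (ψ : OpenPartialHomeomorph M (E 4)) (f : S → M) (V : S → E 4) (x : S) : ℝ :=
  surfDiv ψ (inCharts ψ (chartAt (E 2) x) f) (fun t => V ((chartAt (E 2) x).symm t))
    (chartAt (E 2) x x)

variable [IsManifold (𝓡 4) ∞ M]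
  [IsContMDiffRiemannianBundle (𝓡 4) ∞ (E 4) (fun x : M => TangentSpace (𝓡 4) x)]
  [IsManifold (𝓡 2) ∞ S]
  {ψ : OpenPartialHomeomorph M (E 4)} {φ : OpenPartialHomeomorph S (E 2)} {f : S → M} {x : S}
  (hψ : ψ ∈ IsManifold.maximalAtlas (𝓡 4) ∞ M) (hf : IsSmoothImmersion f)
include hψ hf

section

variable (hφ : φ ∈ IsManifold.maximalAtlas (𝓡 2) ∞ S) (hx : x ∈ φ.source) (hfx : f x ∈ ψ.source)
include hφ hx hfx

omit [RiemannianBundle (fun x : M => TangentSpace (𝓡 4) x)]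
  [IsContMDiffRiemannianBundle (𝓡 4) ∞ (E 4) (fun x : M => TangentSpace (𝓡 4) x)] in
/-- A function on the surface, computed in the preferred chart at each point by an expression which
does not depend on the parameters, has the same expression in every chart. -/
lemma eq_of_comp_invariant {W : Type*} (V : S → W)
    (Q : (E 2 → E 4) → (E 2 → W) → E 2 → ℝ)
    (hQ : ∀ {u u' : E 2 → E 4} {v v' : E 2 → W} {O O' : Set (E 2)} {τ : E 2 → E 2} {t : E 2},
      IsLocalImmersion ψ u O → IsLocalImmersion ψ u' O' → t ∈ O' → τ t ∈ O →
      (∀ᶠ s in 𝓝 t, DifferentiableAt ℝ τ s) → u' =ᶠ[𝓝 t] u ∘ τ → v' =ᶠ[𝓝 t] v ∘ τ →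
      v = (fun r => V (φ.symm r)) → τ t = φ x → Q u' v' t = Q u v (τ t)) :
    Q (inCharts ψ (chartAt (E 2) x) f) (fun r => V ((chartAt (E 2) x).symm r))
      (chartAt (E 2) x x) = Q (inCharts ψ φ f) (fun r => V (φ.symm r)) (φ x) := by
  have hx' := mem_chart_source (E 2) x
  have hφ' := IsManifold.chart_mem_maximalAtlas (I := 𝓡 2) (n := ∞) x
  have hval : (φ ∘ (chartAt (E 2) x).symm) (chartAt (E 2) x x) = φ x := by
    simp [(chartAt (E 2) x).left_inv hx']
  have := hQ (τ := φ ∘ (chartAt (E 2) x).symm) (t := chartAt (E 2) x x)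
    (isLocalImmersion_inCharts hψ hφ hf) (isLocalImmersion_inCharts hψ hφ' hf)
    (mem_paramDomain hx' hfx) (by rw [hval]; exact mem_paramDomain hx hfx)
    (eventually_differentiableAt_transition hφ hφ' hx hx')
    (eventuallyEq_comp_transition (fun y => ψ (f y)) hx hx')
    (eventuallyEq_comp_transition V hx hx') rfl hval
  rw [this, hval]

lemma tangentCurvature_eq : tangentCurvature ψ f x =
    bundleCurvature ψ (inCharts ψ φ f) (rotT ψ (inCharts ψ φ f)) (φ x) :=
  eq_of_comp_invariant hψ hf hφ hx hfx (fun _ => (0 : ℝ))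
    (fun u _ t => bundleCurvature ψ u (rotT ψ u) t)
    fun h h' ht' hτO hτ hu' _ _ _ => tangentCurvature_comp hψ h h' ht' hτO hτ hu'

lemma normalCurvature_eq : normalCurvature ψ f x =
    bundleCurvature ψ (inCharts ψ φ f) (rotN ψ (inCharts ψ φ f)) (φ x) :=
  eq_of_comp_invariant hψ hf hφ hx hfx (fun _ => (0 : ℝ))
    (fun u _ t => bundleCurvature ψ u (rotN ψ u) t)
    fun h h' ht' hτO hτ hu' _ _ _ => normalCurvature_comp hψ h h' ht' hτO hτ hu'

omit [IsContMDiffRiemannianBundle (𝓡 4) ∞ (E 4) (fun x : M => TangentSpace (𝓡 4) x)] in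
lemma divAlong_eq {V : S → E 4} (hV : ContMDiff (𝓡 2) (𝓡 4) ∞ V) : divAlong ψ f V x =
    surfDiv ψ (inCharts ψ φ f) (fun t => V (φ.symm t)) (φ x) := by
  have hd : DifferentiableAt ℝ (fun t => V (φ.symm t)) (φ x) :=
    ((contDiffOn_comp_symm hφ hV.contMDiffOn (U := univ)).contDiffAt
      ((φ.isOpen_inter_preimage_symm isOpen_univ).mem_nhds
        ⟨φ.map_source hx, mem_univ _⟩)).differentiableAt (by simp)
  refine eq_of_comp_invariant hψ hf hφ hx hfx V (fun u v t => surfDiv ψ u v t) ?_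
  intro u u' v v' O O' τ t h h' ht' hτO hτ hu' hv' hv hτt
  exact surfDiv_comp hψ h h' ht' hτO hτ hu' (by rw [hv, hτt]; exact hd) hv'

end

omit [RiemannianBundle (fun x : M => TangentSpace (𝓡 4) x)] [IsManifold (𝓡 4) ∞ M]
  [IsContMDiffRiemannianBundle (𝓡 4) ∞ (E 4) (fun x : M => TangentSpace (𝓡 4) x)] hψ in
/-- A function which is given in each chart of the surface by a continuous function of the
coordinates is continuous. -/
lemma continuousOn_of_charts {g : S → ℝ} {q : OpenPartialHomeomorph S (E 2) → E 2 → ℝ}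
    (hq : ∀ φ ∈ IsManifold.maximalAtlas (𝓡 2) ∞ S, ContinuousOn (q φ) (paramDomain ψ φ f))
    (hg : ∀ φ ∈ IsManifold.maximalAtlas (𝓡 2) ∞ S, ∀ x ∈ φ.source, f x ∈ ψ.source →
      g x = q φ (φ x)) : ContinuousOn g (f ⁻¹' ψ.source) := by
  intro x hfx
  have hx := mem_chart_source (E 2) x
  have hφ := IsManifold.chart_mem_maximalAtlas (I := 𝓡 2) (n := ∞) x
  set φ := chartAt (E 2) x
  have hW : IsOpen (φ.source ∩ f ⁻¹' ψ.source) :=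
    φ.open_source.inter (ψ.open_source.preimage hf.smooth.continuous)
  have hc : ContinuousOn (q φ ∘ φ) (φ.source ∩ f ⁻¹' ψ.source) :=
    (hq φ hφ).comp (φ.continuousOn.mono inter_subset_left)
      fun y hy => mem_paramDomain hy.1 hy.2
  refine ContinuousAt.continuousWithinAt ?_
  refine (hc.continuousAt (hW.mem_nhds ⟨hx, hfx⟩)).congr ?_
  filter_upwards [hW.mem_nhds ⟨hx, hfx⟩] with y hy
  exact (hg φ hφ y hy.1 hy.2).symm

lemma continuousOn_tangentCurvature_surface :
    ContinuousOn (tangentCurvature ψ f) (f ⁻¹' ψ.source) :=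
  continuousOn_of_charts hf
    (fun _ hφ => continuousOn_tangentCurvature hψ (isLocalImmersion_inCharts hψ hφ hf))
    fun _ hφ _ hx hfx => tangentCurvature_eq hψ hf hφ hx hfx

lemma continuousOn_normalCurvature_surface :
    ContinuousOn (normalCurvature ψ f) (f ⁻¹' ψ.source) :=
  continuousOn_of_charts hf
    (fun _ hφ => continuousOn_normalCurvature hψ (isLocalImmersion_inCharts hψ hφ hf))
    fun _ hφ _ hx hfx => normalCurvature_eq hψ hf hφ hx hfx

lemma continuousOn_divAlong {V : S → E 4} (hV : ContMDiff (𝓡 2) (𝓡 4) ∞ V) :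
    ContinuousOn (divAlong ψ f V) (f ⁻¹' ψ.source) :=
  continuousOn_of_charts hf
    (fun _ hφ => (contDiffOn_surfDiv hψ (isLocalImmersion_inCharts hψ hφ hf)
      (contDiffOn_comp_symm hφ hV.contMDiffOn)).continuousOn)
    fun _ hφ _ hx hfx => divAlong_eq hψ hf hφ hx hfx hV

end

/-! ### The area measure in charts -/

lemma det_eq_jac (τ : E 2 → E 2) (t : E 2) : (fderiv ℝ τ t).det = jac τ t := by
  let b := (EuclideanSpace.basisFun (Fin 2) ℝ).toBasis
  have h1 : (fderiv ℝ τ t).det = LinearMap.det (fderiv ℝ τ t : E 2 →ₗ[ℝ] E 2) := rfl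
  rw [h1, ← LinearMap.det_toMatrix b, Matrix.det_fin_two]
  have h : ∀ i j, LinearMap.toMatrix b b (fderiv ℝ τ t : E 2 →ₗ[ℝ] E 2) i j =
      fderiv ℝ τ t (e j) i := by
    intro i j
    rw [LinearMap.toMatrix_apply]
    simp [b, e]
  rw [h, h, h, h, jac]
  ring

section

variable {M : Type*} [TopologicalSpace M] [ChartedSpace (E 4) M] [IsManifold (𝓡 4) ∞ M]
  [RiemannianBundle (fun x : M => TangentSpace (𝓡 4) x)]
  {ψ : OpenPartialHomeomorph M (E 4)}

omit [IsManifold (𝓡 4) ∞ M] in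
/-- The inner products at two equal points agree; the tangent spaces are all definitionally `E 4`. -/
lemma inner_congr_base {q q' : M} (h : q = q') (v w : E 4) :
    @inner ℝ (TangentSpace (𝓡 4) q) _ v w = @inner ℝ (TangentSpace (𝓡 4) q') _ v w := by
  subst h
  rfl

lemma chartMetric_fderiv_comp (hψ : ψ ∈ IsManifold.maximalAtlas (𝓡 4) ∞ M) {g : E 2 → M}
    {t : E 2} (hg : MDifferentiableAt (𝓡 2) (𝓡 4) g t) (hgt : g t ∈ ψ.source) (a b : E 2) :
    chartMetric ψ (ψ (g t)) (fderiv ℝ (fun r => ψ (g r)) t a) (fderiv ℝ (fun r => ψ (g r)) t b) =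
      inner ℝ (mfderiv (𝓡 2) (𝓡 4) g t a) (mfderiv (𝓡 2) (𝓡 4) g t b) := by
  have d1 : MDifferentiableAt (𝓡 4) (𝓡 4) ψ.symm (ψ (g t)) :=
    (mdifferentiable_of_mem_maximalAtlas hψ).mdifferentiableAt_symm (ψ.map_source hgt)
  have d2 : MDifferentiableAt (𝓡 4) (𝓡 4) ψ (g t) :=
    (mdifferentiable_of_mem_maximalAtlas hψ).mdifferentiableAt hgt
  have d3 : MDifferentiableAt (𝓡 2) (𝓡 4) (fun r => ψ (g r)) t := d2.comp t hg
  have hev : (fun r => ψ.symm (ψ (g r))) =ᶠ[𝓝 t] g := by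
    filter_upwards [hg.continuousAt.preimage_mem_nhds (ψ.open_source.mem_nhds hgt)] with r hr
    exact ψ.left_inv hr
  have hd : ∀ a : E 2, (mfderiv (𝓡 4) (𝓡 4) ψ.symm (ψ (g t)) (fderiv ℝ (fun r => ψ (g r)) t a) : E 4)
      = (mfderiv (𝓡 2) (𝓡 4) g t a : E 4) := by
    intro a
    have h1 : HasMFDerivAt (𝓡 2) (𝓡 4) (ψ.symm ∘ fun r => ψ (g r)) t _ :=
      d1.hasMFDerivAt.comp t d3.hasMFDerivAt
    have h2 : HasMFDerivAt (𝓡 2) (𝓡 4) g t _ := h1.congr_of_eventuallyEq hev.symm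
    have h3 := h2.mfderiv
    rw [mfderiv_eq_fderiv] at h3
    rw [h3]
    rfl
  unfold chartMetric
  refine Eq.trans ?_ (inner_congr_base (ψ.left_inv hgt) _ _)
  exact congrArg₂ (fun v w : TangentSpace (𝓡 4) (ψ.symm (ψ (g t))) => inner ℝ v w) (hd a) (hd b)

variable {S : Type*} [TopologicalSpace S] [ChartedSpace (E 2) S] [IsManifold (𝓡 2) ∞ S]
  {φ φ' : OpenPartialHomeomorph S (E 2)} {f : S → M}
  (hψ : ψ ∈ IsManifold.maximalAtlas (𝓡 4) ∞ M) (hf : IsSmoothImmersion f)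
include hψ hf

lemma areaDensity_eq (hφ : φ ∈ IsManifold.maximalAtlas (𝓡 2) ∞ S) {t : E 2}
    (ht : t ∈ paramDomain ψ φ f) :
    areaDensity f φ t = areaElement ψ (inCharts ψ φ f) t := by
  have hg : MDifferentiableAt (𝓡 2) (𝓡 4) (fun r => f (φ.symm r)) t :=
    MDifferentiableAt.comp t (hf.smooth.mdifferentiableAt (by simp))
      ((mdifferentiable_of_mem_maximalAtlas hφ).mdifferentiableAt_symm ht.1)
  have h := chartMetric_fderiv_comp hψ hg ht.2
  unfold areaDensity areaElement tangentVec
  simp only [← h]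
  rfl

omit hψ hf in
omit [ChartedSpace (E 2) S] [IsManifold (𝓡 2) ∞ S] in
lemma measurableSet_target_inter [MeasurableSpace S] [BorelSpace S]
    (φ : OpenPartialHomeomorph S (E 2)) {A : Set S} (hA : MeasurableSet A) :
    MeasurableSet (φ.target ∩ φ.symm ⁻¹' A) := by
  have h1 : Measurable (φ.target.domRestrict φ.symm) :=
    (continuousOn_iff_continuous_domRestrict.1 φ.continuousOn_symm).measurable
  have h2 : φ.target ∩ φ.symm ⁻¹' A =
      (fun y : φ.target => (y : E 2)) '' (φ.target.domRestrict φ.symm ⁻¹' A) := by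
    ext y
    simp [and_comm]
  rw [h2]
  exact φ.open_target.measurableSet.subtype_image (h1 hA)

/-- Change of variables between two charts of the surface; the second one need not cover `A`, whence
the inequality. -/
lemma lintegral_areaElement_le (hφ : φ ∈ IsManifold.maximalAtlas (𝓡 2) ∞ S)
    (hφ' : φ' ∈ IsManifold.maximalAtlas (𝓡 2) ∞ S) [MeasurableSpace S] [BorelSpace S]
    {A : Set S} (hA : MeasurableSet A) (hAW : A ⊆ φ.source ∩ f ⁻¹' ψ.source) :
    ∫⁻ t in φ'.target ∩ φ'.symm ⁻¹' A, ENNReal.ofReal (areaElement ψ (inCharts ψ φ' f) t) ≤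
      ∫⁻ t in φ.target ∩ φ.symm ⁻¹' A, ENNReal.ofReal (areaElement ψ (inCharts ψ φ f) t) := by
  set s := φ.target ∩ φ.symm ⁻¹' (A ∩ φ'.source) with hsdef
  have hs : MeasurableSet s :=
    measurableSet_target_inter φ (hA.inter φ'.open_source.measurableSet)
  have himage : φ'.target ∩ φ'.symm ⁻¹' A = (φ' ∘ φ.symm) '' s := by
    ext y
    constructor
    · rintro ⟨hy, hyA⟩
      have hyA : φ'.symm y ∈ A := hyA
      have hyφ := (hAW hyA).1
      refine ⟨φ (φ'.symm y), ⟨φ.map_source hyφ, ?_⟩, ?_⟩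
      · change φ.symm (φ (φ'.symm y)) ∈ A ∩ φ'.source
        rw [φ.left_inv hyφ]
        exact ⟨hyA, φ'.map_target hy⟩
      · rw [Function.comp_apply, φ.left_inv hyφ, φ'.right_inv hy]
    · rintro ⟨t, ⟨ht, htA, hts⟩, rfl⟩
      have hts : φ.symm t ∈ φ'.source := hts
      refine ⟨φ'.map_source hts, ?_⟩
      change φ'.symm (φ' (φ.symm t)) ∈ A
      rwa [φ'.left_inv hts]
  have hinj : InjOn (φ' ∘ φ.symm) s := by
    intro t ht r hr htr
    exact φ.symm.injOn ht.1 hr.1 (φ'.injOn ht.2.2 hr.2.2 htr)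
  have hdiff : ∀ t ∈ s, DifferentiableAt ℝ (φ' ∘ φ.symm) t := fun t ht => by
    have := (eventually_differentiableAt_transition (x := φ.symm t) hφ' hφ ht.2.2
      (φ.map_target ht.1)).self_of_nhds
    rwa [φ.right_inv ht.1] at this
  rw [himage, lintegral_image_eq_lintegral_abs_det_fderiv_mul volume hs
    (fun t ht => (hdiff t ht).hasFDerivAt.hasFDerivWithinAt) hinj]
  calc _ = ∫⁻ t in s, ENNReal.ofReal (areaElement ψ (inCharts ψ φ f) t) := by
        refine setLIntegral_congr_fun hs fun t ht => ?_
        have hev : inCharts ψ φ f =ᶠ[𝓝 t] inCharts ψ φ' f ∘ (φ' ∘ φ.symm) := by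
          have := eventuallyEq_comp_transition (x := φ.symm t) (φ := φ') (φ' := φ)
            (fun y => ψ (f y)) ht.2.2 (φ.map_target ht.1)
          rwa [φ.right_inv ht.1] at this
        have hmem : (φ' ∘ φ.symm) t ∈ paramDomain ψ φ' f :=
          mem_paramDomain ht.2.2 (hAW ht.2.1).2
        have h' := isLocalImmersion_inCharts hψ hφ' hf
        rw [areaElement_comp (hdiff t ht)
          ((h'.smooth.contDiffAt (h'.isOpen.mem_nhds hmem)).differentiableAt (by simp)) hev,
          ENNReal.ofReal_mul (abs_nonneg _), det_eq_jac]
    _ ≤ _ := lintegral_mono_set (inter_subset_inter_right _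
        (preimage_mono inter_subset_left))

section

variable [MeasurableSpace S] [BorelSpace S]

/-- The area of the part of the surface which is covered by the chart `φ` of the surface and the
chart `ψ` of the ambient manifold. -/
def localArea (ψ : OpenPartialHomeomorph M (E 4)) (φ : OpenPartialHomeomorph S (E 2)) (f : S → M) :
    Measure S :=
  ((volume.restrict (paramDomain ψ φ f)).withDensity
    fun t => ENNReal.ofReal (areaElement ψ (inCharts ψ φ f) t)).map φ.symm

omit hψ hf in
omit [ChartedSpace (E 2) S] [IsManifold (𝓡 2) ∞ S] in
lemma aemeasurable_symm (φ : OpenPartialHomeomorph S (E 2)) (ρ : E 2 → ℝ≥0∞) {O : Set (E 2)}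
    (hO : MeasurableSet O) (hOt : O ⊆ φ.target) :
    AEMeasurable φ.symm ((volume.restrict O).withDensity ρ) :=
  ((φ.continuousOn_symm.mono hOt).aemeasurable hO).mono_ac (withDensity_absolutelyContinuous _ _)

omit hψ hf in
omit [ChartedSpace (E 2) S] [IsManifold (𝓡 2) ∞ S] in
lemma map_symm_withDensity_apply (φ : OpenPartialHomeomorph S (E 2)) (ρ : E 2 → ℝ≥0∞)
    {O : Set (E 2)} (hO : MeasurableSet O) (hOt : O ⊆ φ.target) {A : Set S}
    (hA : MeasurableSet A) :
    ((volume.restrict O).withDensity ρ).map φ.symm A = ∫⁻ t in O ∩ φ.symm ⁻¹' A, ρ t := by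
  have hm : MeasurableSet (O ∩ φ.symm ⁻¹' A) := by
    have : O ∩ φ.symm ⁻¹' A = O ∩ (φ.target ∩ φ.symm ⁻¹' A) := by
      rw [← inter_assoc, inter_eq_left.2 hOt]
    rw [this]
    exact hO.inter (measurableSet_target_inter φ hA)
  have hzero : (volume.restrict O).withDensity ρ Oᶜ = 0 :=
    withDensity_absolutelyContinuous _ _ (by rw [Measure.restrict_apply hO.compl]; simp)
  rw [Measure.map_apply_of_aemeasurable (aemeasurable_symm φ ρ hO hOt) hA,
    ← measure_inter_add_sdiff₀ (s := φ.symm ⁻¹' A) (t := O) hO.nullMeasurableSet,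
    measure_mono_null (s := φ.symm ⁻¹' A \ O) (fun t ht => ht.2) hzero, add_zero, inter_comm, withDensity_apply _ hm,
    Measure.restrict_restrict hm, inter_right_comm, inter_self]

/-- On the part of the surface covered by a chart of the surface and a chart of the ambient
manifold, the area measure is given by the area element: there each of the measures in the supremum
defining the area measure is dominated by the one of that chart. -/
lemma areaMeasure_restrict (x : S) :
    (areaMeasure f).restrict ((chartAt (E 2) x).source ∩ f ⁻¹' ψ.source) =
      localArea ψ (chartAt (E 2) x) f := by
  set W := (chartAt (E 2) x).source ∩ f ⁻¹' ψ.source with hW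
  have hWm : MeasurableSet W := ((chartAt (E 2) x).open_source.inter
    (ψ.open_source.preimage hf.smooth.continuous)).measurableSet
  let μ : S → Measure S := fun x =>
    (((volume : Measure (E 2)).restrict (chartAt (E 2) x).target).withDensity
      fun t => ENNReal.ofReal (areaDensity f (chartAt (E 2) x) t)).map (chartAt (E 2) x).symm
  have harea : areaMeasure f = ⨆ y, μ y := rfl
  have hμ : ∀ (y : S) {A : Set S}, MeasurableSet A → A ⊆ W → μ y A =
      ∫⁻ t in (chartAt (E 2) y).target ∩ (chartAt (E 2) y).symm ⁻¹' A,
        ENNReal.ofReal (areaElement ψ (inCharts ψ (chartAt (E 2) y) f) t) := by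
    intro y A hA hAW
    refine (map_symm_withDensity_apply _ _ (chartAt (E 2) y).open_target.measurableSet
      subset_rfl hA).trans ?_
    refine setLIntegral_congr_fun (measurableSet_target_inter _ hA) fun t ht => ?_
    rw [areaDensity_eq hψ hf (IsManifold.chart_mem_maximalAtlas y) ⟨ht.1, (hAW ht.2).2⟩]
  have hle : ∀ (y : S) {A : Set S}, MeasurableSet A → A ⊆ W → μ y A ≤ μ x A := by
    intro y A hA hAW
    rw [hμ y hA hAW, hμ x hA hAW]
    exact lintegral_areaElement_le hψ hf (IsManifold.chart_mem_maximalAtlas x)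
      (IsManifold.chart_mem_maximalAtlas y) hA hAW
  have hsup : areaMeasure f ≤ (μ x).restrict W + (areaMeasure f).restrict Wᶜ := by
    rw [harea]
    refine iSup_le fun y => Measure.le_iff.2 fun A hA => ?_
    rw [Measure.add_apply, Measure.restrict_apply hA, Measure.restrict_apply hA,
      ← measure_inter_add_sdiff A hWm]
    refine add_le_add (hle y (hA.inter hWm) inter_subset_right) ?_
    exact (le_iSup μ y) _
  refine Measure.ext fun A hA => ?_
  have hAW : MeasurableSet (A ∩ W) := hA.inter hWm
  have h1 : areaMeasure f (A ∩ W) = μ x (A ∩ W) := by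
    refine le_antisymm ((hsup (A ∩ W)).trans ?_) ((le_iSup μ x) _)
    rw [Measure.add_apply, Measure.restrict_apply hAW, Measure.restrict_apply hAW]
    have h2 : A ∩ W ∩ Wᶜ = ∅ := by rw [inter_assoc, inter_compl_self, inter_empty]
    rw [h2, measure_empty, add_zero]
    exact measure_mono inter_subset_left
  rw [Measure.restrict_apply hA, h1, hμ x hAW inter_subset_right, localArea,
    map_symm_withDensity_apply _ _ (isOpen_paramDomain hf.smooth.continuous).measurableSet
      inter_subset_left hA]
  congr 2
  ext t
  constructor
  · rintro ⟨ht, htA, htW⟩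
    exact ⟨⟨ht, htW.2⟩, htA⟩
  · rintro ⟨⟨ht, htf⟩, htA⟩
    exact ⟨ht, htA, (chartAt (E 2) x).map_target ht, htf⟩

end

variable [IsContMDiffRiemannianBundle (𝓡 4) ∞ (E 4) (fun x : M => TangentSpace (𝓡 4) x)]

lemma setIntegral_areaMeasure [MeasurableSpace S] [BorelSpace S] (x : S) {g : S → ℝ}
    (hg : AEStronglyMeasurable g (areaMeasure f)) :
    ∫ y in (chartAt (E 2) x).source ∩ f ⁻¹' ψ.source, g y ∂(areaMeasure f) =
      ∫ t in paramDomain ψ (chartAt (E 2) x) f,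
        areaElement ψ (inCharts ψ (chartAt (E 2) x) f) t * g ((chartAt (E 2) x).symm t) := by
  have h := isLocalImmersion_inCharts hψ (IsManifold.chart_mem_maximalAtlas (n := ∞) x) hf
  have hm := h.isOpen.measurableSet
  have hr := areaMeasure_restrict hψ hf x
  have hg' : AEStronglyMeasurable g (localArea ψ (chartAt (E 2) x) f) := by
    rw [← hr]
    exact hg.restrict
  rw [hr, localArea] at *
  rw [integral_map (aemeasurable_symm _ _ hm inter_subset_left) hg',
    integral_withDensity_eq_integral_toReal_smul₀
      ((h.contDiffOn_areaElement hψ).continuousOn.aemeasurable hm).ennreal_ofReal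
      (by simp)]
  refine setIntegral_congr_fun hm fun t ht => ?_
  simp only [smul_eq_mul]
  rw [ENNReal.toReal_ofReal (h.areaElement_pos hψ ht).le]

end

/-! ### The divergence theorem on a superminimal surface -/

section

variable {M : Type*} [TopologicalSpace M] [ChartedSpace (E 4) M]
  [RiemannianBundle (fun x : M => TangentSpace (𝓡 4) x)]
  {S : Type*} [TopologicalSpace S] [ChartedSpace (E 2) S]
  {ψ : OpenPartialHomeomorph M (E 4)} {f : S → M}

lemma divAlong_eq_zero_of_notMem_tsupport {V : S → E 4} {x : S} (hx : x ∉ tsupport V) :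
    divAlong ψ f V x = 0 := by
  have hs := mem_chart_source (E 2) x
  have hev : (fun t => V ((chartAt (E 2) x).symm t)) =ᶠ[𝓝 (chartAt (E 2) x x)] fun _ => 0 := by
    have hc := (chartAt (E 2) x).continuousAt_symm ((chartAt (E 2) x).map_source hs)
    have : (tsupport V)ᶜ ∈ 𝓝 ((chartAt (E 2) x).symm (chartAt (E 2) x x)) := by
      rw [(chartAt (E 2) x).left_inv hs]
      exact (isClosed_tsupport V).isOpen_compl.mem_nhds hx
    filter_upwards [hc.preimage_mem_nhds this] with r hr
    exact image_eq_zero_of_notMem_tsupport hr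
  rw [divAlong, surfDiv_congr hev, surfDiv_zero]

variable [IsManifold (𝓡 4) ∞ M]
  [IsContMDiffRiemannianBundle (𝓡 4) ∞ (E 4) (fun x : M => TangentSpace (𝓡 4) x)]
  [IsManifold (𝓡 2) ∞ S]
  (hψ : ψ ∈ IsManifold.maximalAtlas (𝓡 4) ∞ M) (hf : IsSmoothImmersion f)
include hψ hf

lemma continuous_divAlong {V : S → E 4} (hV : ContMDiff (𝓡 2) (𝓡 4) ∞ V)
    (hVs : tsupport V ⊆ f ⁻¹' ψ.source) : Continuous (divAlong ψ f V) := by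
  refine continuous_iff_continuousAt.2 fun x => ?_
  by_cases hx : x ∈ tsupport V
  · exact (continuousOn_divAlong hψ hf hV).continuousAt
      ((ψ.open_source.preimage hf.smooth.continuous).mem_nhds (hVs hx))
  · refine (continuousAt_const (y := (0 : ℝ))).congr ?_
    filter_upwards [(isClosed_tsupport V).isOpen_compl.mem_nhds hx] with y hy
    exact (divAlong_eq_zero_of_notMem_tsupport hy).symm

omit [IsManifold (𝓡 4) ∞ M] hψ hf
  [IsContMDiffRiemannianBundle (𝓡 4) ∞ (E 4) (fun x : M => TangentSpace (𝓡 4) x)] in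
lemma divAlong_add {V V' : S → E 4} (hV : ContMDiff (𝓡 2) (𝓡 4) ∞ V)
    (hV' : ContMDiff (𝓡 2) (𝓡 4) ∞ V') (x : S) :
    divAlong ψ f (fun y => V y + V' y) x = divAlong ψ f V x + divAlong ψ f V' x := by
  have hd : ∀ {V : S → E 4}, ContMDiff (𝓡 2) (𝓡 4) ∞ V →
      DifferentiableAt ℝ (fun t => V ((chartAt (E 2) x).symm t)) (chartAt (E 2) x x) := fun hV =>
    ((contDiffOn_comp_symm (IsManifold.chart_mem_maximalAtlas x) hV.contMDiffOn
      (U := univ)).contDiffAt (((chartAt (E 2) x).isOpen_inter_preimage_symm isOpen_univ).mem_nhds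
        ⟨(chartAt (E 2) x).map_source (mem_chart_source _ x), mem_univ _⟩)).differentiableAt
          (by simp)
  exact surfDiv_add (hd hV) (hd hV')

omit [IsManifold (𝓡 4) ∞ M] hψ hf
  [IsContMDiffRiemannianBundle (𝓡 4) ∞ (E 4) (fun x : M => TangentSpace (𝓡 4) x)] in
lemma divAlong_sum {ι : Type*} (F : Finset ι) {V : ι → S → E 4}
    (hV : ∀ i, ContMDiff (𝓡 2) (𝓡 4) ∞ (V i)) (x : S) :
    divAlong ψ f (fun y => ∑ i ∈ F, V i y) x = ∑ i ∈ F, divAlong ψ f (V i) x := by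
  classical
  induction F using Finset.induction_on with
  | empty => simp [divAlong, surfDiv_zero]
  | insert i F hi ih =>
    simp only [Finset.sum_insert hi]
    rw [divAlong_add (hV i) (ContMDiff.sum fun j _ => hV j), ih]

variable [MeasurableSpace S] [BorelSpace S] [T2Space S] {s : ℝ}
  (hs : ∀ φ ∈ IsManifold.maximalAtlas (𝓡 2) ∞ S, ∀ t ∈ paramDomain ψ φ f,
    LiftParallelAt ψ (inCharts ψ φ f) s t)
include hs

omit [T2Space S] in
lemma integral_divAlong_eq_zero_of_chart {V : S → E 4} (hV : ContMDiff (𝓡 2) (𝓡 4) ∞ V)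
    (hVc : HasCompactSupport V) {x : S}
    (hVx : tsupport V ⊆ (chartAt (E 2) x).source ∩ f ⁻¹' ψ.source) :
    ∫ y, divAlong ψ f V y ∂(areaMeasure f) = 0 := by
  set φ := chartAt (E 2) x with hφdef
  have hφ : φ ∈ IsManifold.maximalAtlas (𝓡 2) ∞ S := IsManifold.chart_mem_maximalAtlas x
  have h := isLocalImmersion_inCharts hψ hφ hf
  have hzero : ∀ y ∉ φ.source ∩ f ⁻¹' ψ.source, divAlong ψ f V y = 0 := fun y hy =>
    divAlong_eq_zero_of_notMem_tsupport fun h => hy (hVx h)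
  have hcont := continuous_divAlong hψ hf hV fun y hy => (hVx hy).2
  rw [← setIntegral_eq_integral_of_forall_compl_eq_zero hzero,
    setIntegral_areaMeasure hψ hf x hcont.aestronglyMeasurable]
  -- The field in coordinates, extended by zero.
  let v : E 2 → E 4 := (paramDomain ψ φ f).indicator fun t => V (φ.symm t)
  have hK : IsCompact (φ '' tsupport V) :=
    hVc.image_of_continuousOn (φ.continuousOn.mono fun y hy => (hVx hy).1)
  have hKO : φ '' tsupport V ⊆ paramDomain ψ φ f := by
    rintro _ ⟨y, hy, rfl⟩
    exact mem_paramDomain (hVx hy).1 (hVx hy).2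
  have hvK : ∀ t ∉ φ '' tsupport V, v t = 0 := by
    intro t ht
    by_cases htO : t ∈ paramDomain ψ φ f
    · have : v t = V (φ.symm t) := indicator_of_mem htO _
      rw [this]
      exact image_eq_zero_of_notMem_tsupport fun h => ht ⟨_, h, φ.right_inv htO.1⟩
    · exact indicator_of_notMem htO _
  have hvs : tsupport v ⊆ φ '' tsupport V :=
    closure_minimal (fun t ht => by_contra fun h => ht (hvK t h)) hK.isClosed
  rw [← integral_surfDiv_eq_zero hψ h (hs φ hφ)
    ((contDiffOn_comp_symm hφ (hV.contMDiffOn (s := f ⁻¹' ψ.source))).congr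
      fun t ht => indicator_of_mem ht _) (HasCompactSupport.intro hK hvK) (hvs.trans hKO)]
  refine setIntegral_congr_fun h.isOpen.measurableSet fun t ht => ?_
  have h1 := divAlong_eq (x := φ.symm t) hψ hf hφ (φ.map_target ht.1) ht.2 hV
  rw [φ.right_inv ht.1] at h1
  rw [h1]
  congr 1
  refine surfDiv_congr ?_
  filter_upwards [h.isOpen.mem_nhds ht] with r hr
  have : v r = V (φ.symm r) := indicator_of_mem hr _
  exact this.symm

/-- The divergence theorem on a superminimal surface, by a partition of unity subordinate to the
charts of the surface. -/
theorem integral_divAlong_eq_zero [SecondCountableTopology S] [IsFiniteMeasure (areaMeasure f)]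
    {V : S → E 4} (hV : ContMDiff (𝓡 2) (𝓡 4) ∞ V) (hVc : HasCompactSupport V)
    (hVs : tsupport V ⊆ f ⁻¹' ψ.source) :
    ∫ y, divAlong ψ f V y ∂(areaMeasure f) = 0 := by
  have : LocallyCompactSpace S := ChartedSpace.locallyCompactSpace (E 2) S
  obtain ⟨ρ, hρ⟩ := SmoothPartitionOfUnity.exists_isSubordinate_chartAt_source (I := 𝓡 2) (M := S)
  have hfin := ρ.locallyFinite.finite_nonempty_inter_compact hVc
  have hsmooth : ∀ i, ContMDiff (𝓡 2) (𝓡 4) ∞ fun y => ρ i y • V y := fun i =>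
    (ρ i).contMDiff.smul hV
  have hsub : ∀ i, tsupport (fun y => ρ i y • V y) ⊆ tsupport V := fun i =>
    closure_mono fun y hy h0 => hy (by simp [h0])
  have hsub' : ∀ i, tsupport (fun y => ρ i y • V y) ⊆ (chartAt (E 2) i).source := fun i =>
    (closure_mono (Function.support_smul_subset_left (ρ i) V)).trans (hρ i)
  have hsum : V = fun y => ∑ i ∈ hfin.toFinset, ρ i y • V y := by
    funext y
    by_cases hy : y ∈ tsupport V
    · rw [← Finset.sum_smul]
      have h1 : ∑ᶠ i, ρ i y = 1 := ρ.sum_eq_one (mem_univ y)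
      rw [finsum_eq_sum_of_support_subset _ (s := hfin.toFinset)] at h1
      · rw [h1, one_smul]
      · intro i hi
        simp only [Finite.coe_toFinset, mem_ofPred_eq]
        exact ⟨y, hi, hy⟩
    · simp [image_eq_zero_of_notMem_tsupport hy]
  have hint : ∀ i, Integrable (divAlong ψ f fun y => ρ i y • V y) (areaMeasure f) := fun i =>
    (continuous_divAlong hψ hf (hsmooth i) ((hsub i).trans hVs)).integrable_of_hasCompactSupport
      (HasCompactSupport.intro (hVc.of_isClosed_subset (isClosed_tsupport _) (hsub i))
        fun y hy => divAlong_eq_zero_of_notMem_tsupport hy)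
  rw [hsum]
  simp only [divAlong_sum _ hsmooth]
  rw [integral_finsetSum _ fun i _ => hint i]
  refine Finset.sum_eq_zero fun i _ => integral_divAlong_eq_zero_of_chart hψ hf hs (hsmooth i)
    (hVc.of_isClosed_subset (isClosed_tsupport _) (hsub i)) (x := i) ?_
  exact subset_inter (hsub' i) ((hsub i).trans hVs)

end

/-! ### The logarithmic cut-off function -/

lemma exists_deriv_smoothTransition_bound : ∃ C : ℝ, 0 < C ∧ ∀ x,
    |deriv Real.smoothTransition x| ≤ C := by
  have hc : Continuous (deriv Real.smoothTransition) :=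
    (Real.smoothTransition.contDiff (n := 1)).continuous_deriv le_rfl
  obtain ⟨C, hC⟩ :=
    (isCompact_Icc (a := (0 : ℝ)) (b := 1)).exists_bound_of_continuousOn hc.continuousOn
  refine ⟨|C| + 1, by positivity, fun x => ?_⟩
  have habs := le_abs_self C
  by_cases hx : x ∈ Icc (0 : ℝ) 1
  · have := hC x hx
    rw [Real.norm_eq_abs] at this
    linarith
  · have h0 : deriv Real.smoothTransition x = 0 := by
      rw [mem_Icc, not_and_or, not_le, not_le] at hx
      rcases hx with hx | hx
      · have : Real.smoothTransition =ᶠ[𝓝 x] fun _ => 0 := by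
          filter_upwards [Iio_mem_nhds hx] with y hy
          exact Real.smoothTransition.zero_of_nonpos (le_of_lt hy)
        rw [this.deriv_eq, deriv_const]
      · have : Real.smoothTransition =ᶠ[𝓝 x] fun _ => 1 := by
          filter_upwards [Ioi_mem_nhds hx] with y hy
          exact Real.smoothTransition.one_of_one_le (le_of_lt hy)
        rw [this.deriv_eq, deriv_const]
    rw [h0, abs_zero]
    positivity

/-- The plane has vanishing capacity: there are cut-off functions of the squared distance `r` with
fixed support, equal to `1` near the centre, for which `r χ'(r)` is as small as desired. -/
lemma exists_log_cutoff {δ η : ℝ} (hδ : 0 < δ) (hη : 0 < η) :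
    ∃ ε : ℝ, 0 < ε ∧ ε ≤ δ ∧ ∃ χ : ℝ → ℝ, (∀ r, 0 ≤ r → ContDiffAt ℝ ∞ χ r) ∧ (∀ r, 0 ≤ χ r) ∧
      (∀ r, 0 ≤ r → r ≤ ε ^ 2 → χ r = 1) ∧ (∀ r, δ ^ 2 ≤ r → χ r = 0) ∧
      ∀ r, 0 ≤ r → |deriv χ r| * r ≤ η := by
  obtain ⟨C, hC0, hC⟩ := exists_deriv_smoothTransition_bound
  set l := C / η with hl
  have hl0 : 0 < l := by positivity
  -- With `ε² = a`, the argument of the transition function below falls from `1` at `r = a` to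
  -- `0` before `r = δ²`, at the rate `1 / (l (r + a))`.
  set a := δ ^ 2 * Real.exp (-l) / 2 with ha
  have ha0 : 0 < a := by positivity
  have hexp : Real.exp (-l) ≤ 1 := Real.exp_le_one_iff.2 (by linarith)
  have hlog : Real.log (2 * a) = Real.log (δ ^ 2) - l := by
    rw [ha, mul_div_cancel₀ _ two_ne_zero, Real.log_mul (by positivity) (by positivity),
      Real.log_exp]
    ring
  have hda : ∀ r, 0 ≤ r → HasDerivAt (fun r => (Real.log (δ ^ 2) - Real.log (r + a)) / l)
      (-(r + a)⁻¹ / l) r := fun r hr => by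
    have h1 : HasDerivAt (fun r => Real.log (r + a)) (r + a)⁻¹ r := by
      simpa using ((hasDerivAt_id r).add_const a).log (by simp only [id]; positivity)
    exact (h1.const_sub (Real.log (δ ^ 2))).div_const l
  refine ⟨√a, Real.sqrt_pos.2 ha0, ?_,
    fun r => Real.smoothTransition ((Real.log (δ ^ 2) - Real.log (r + a)) / l), ?_, ?_, ?_, ?_, ?_⟩
  · rw [Real.sqrt_le_left hδ.le, ha]
    nlinarith [sq_nonneg δ]
  · intro r hr
    refine Real.smoothTransition.contDiffAt.comp r ?_
    refine (contDiffAt_const.sub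
      (ContDiffAt.log (contDiffAt_id.add contDiffAt_const) ?_)).div_const l
    simp only [id]
    positivity
  · exact fun r => Real.smoothTransition.nonneg _
  · intro r hr hra
    rw [Real.sq_sqrt ha0.le] at hra
    refine Real.smoothTransition.one_of_one_le ?_
    rw [le_div_iff₀ hl0]
    have := Real.log_le_log (by positivity) (by linarith : r + a ≤ 2 * a)
    linarith
  · intro r hr
    refine Real.smoothTransition.zero_of_nonpos ?_
    have := Real.log_le_log (by positivity) (by linarith : δ ^ 2 ≤ r + a)
    exact div_nonpos_of_nonpos_of_nonneg (by linarith) hl0.le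
  · intro r hr
    have h1 : HasDerivAt Real.smoothTransition _ ((Real.log (δ ^ 2) - Real.log (r + a)) / l) :=
      ((Real.smoothTransition.contDiff (n := 1)).differentiable (by simp) _).hasDerivAt
    have h2 := h1.comp r (hda r hr)
    have h3 : deriv (fun r => Real.smoothTransition ((Real.log (δ ^ 2) - Real.log (r + a)) / l)) r =
      _ := h2.deriv
    rw [h3, abs_mul, abs_div, abs_neg, abs_inv, abs_of_pos hl0,
      abs_of_pos (by positivity : 0 < r + a)]
    have h4 : (r + a)⁻¹ * r ≤ 1 := by
      rw [inv_mul_le_iff₀ (by positivity)]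
      linarith
    have h5 : C / l = η := by
      rw [hl]
      field_simp
    calc _ ≤ C * ((r + a)⁻¹ / l) * r := by
          gcongr
          exact hC _
      _ = C / l * ((r + a)⁻¹ * r) := by ring
      _ ≤ C / l * 1 := by gcongr
      _ = η := by rw [mul_one, h5]

/-! ### Smallness of the area near the centre -/

section

variable {M : Type*} [TopologicalSpace M] [ChartedSpace (E 4) M]
  {ψ : OpenPartialHomeomorph M (E 4)} {p : M}

/-- The closed ball about `p` for the Euclidean norm of the coordinates `ψ`. -/
def coordBall (ψ : OpenPartialHomeomorph M (E 4)) (p : M) (δ : ℝ) : Set M :=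
  {q | q ∈ ψ.source ∧ ‖ψ q - ψ p‖ ≤ δ}

omit [ChartedSpace (E 4) M] in
lemma coordBall_eq_image {δ : ℝ} (hδ : Metric.closedBall (ψ p) δ ⊆ ψ.target) :
    coordBall ψ p δ = ψ.symm '' Metric.closedBall (ψ p) δ := by
  ext q
  constructor
  · rintro ⟨hq, hqδ⟩
    exact ⟨ψ q, by rwa [mem_closedBall_iff_norm], ψ.left_inv hq⟩
  · rintro ⟨y, hy, rfl⟩
    refine ⟨ψ.map_target (hδ hy), ?_⟩
    rw [ψ.right_inv (hδ hy)]
    rwa [mem_closedBall_iff_norm] at hy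

omit [ChartedSpace (E 4) M] in
lemma isCompact_coordBall {δ : ℝ} (hδ : Metric.closedBall (ψ p) δ ⊆ ψ.target) :
    IsCompact (coordBall ψ p δ) := by
  rw [coordBall_eq_image hδ]
  exact (isCompact_closedBall _ _).image_of_continuousOn (ψ.continuousOn_symm.mono hδ)

variable [RiemannianBundle (fun x : M => TangentSpace (𝓡 4) x)] [IsManifold (𝓡 4) ∞ M]
  [IsContMDiffRiemannianBundle (𝓡 4) ∞ (E 4) (fun x : M => TangentSpace (𝓡 4) x)]
  (hψ : ψ ∈ IsManifold.maximalAtlas (𝓡 4) ∞ M)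
include hψ

lemma exists_euclideanBall_subset (hp : p ∈ ψ.source) :
    ∃ Λ : ℝ, 0 < Λ ∧ ∀ ε, euclideanBall ψ p ε ⊆ coordBall ψ p (Λ * ε) := by
  obtain ⟨Λ, hΛ, -, hunit⟩ := exists_metricForm_bounds hψ (isCompact_singleton (x := ψ p))
    (singleton_subset_iff.2 (ψ.map_source hp))
  refine ⟨Λ, hΛ, fun ε q ⟨hq, hqε⟩ => ⟨hq, ?_⟩⟩
  set v := ψ q - ψ p
  rw [← metricForm_apply] at hqε
  rcases eq_or_ne v 0 with h0 | h0
  · rw [h0, norm_zero]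
    have := (Real.sqrt_nonneg _).trans hqε.le
    positivity
  · have hpos := metricForm_pos hψ (ψ.map_source hp) h0
    set m := √(metricForm ψ (ψ p) v v)
    have hm : 0 < m := Real.sqrt_pos.2 hpos
    have h1 := hunit (ψ p) rfl (m⁻¹ • v) (by
      simp only [map_smul, smul_apply, smul_eq_mul]
      rw [← mul_assoc, ← mul_inv, Real.mul_self_sqrt hpos.le, inv_mul_cancel₀ hpos.ne'])
    rw [norm_smul, norm_inv, Real.norm_of_nonneg hm.le, inv_mul_le_iff₀ hm] at h1
    calc ‖v‖ ≤ m * Λ := h1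
      _ ≤ Λ * ε := by rw [mul_comm]; gcongr

end

section

variable {M : Type*} [TopologicalSpace M] [T2Space M] [ChartedSpace (E 4) M]
  [RiemannianBundle (fun x : M => TangentSpace (𝓡 4) x)] [IsManifold (𝓡 4) ∞ M]
  [IsContMDiffRiemannianBundle (𝓡 4) ∞ (E 4) (fun x : M => TangentSpace (𝓡 4) x)]
  {ψ : OpenPartialHomeomorph M (E 4)} {p : M}
  (hψ : ψ ∈ IsManifold.maximalAtlas (𝓡 4) ∞ M)

/-- The cut-off radial field in the coordinates `ψ` centred at `p`, restricted to a surface and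
extended by zero outside the domain of `ψ`. -/
def radialField {S : Type*} (ψ : OpenPartialHomeomorph M (E 4)) (p : M) (χ : ℝ → ℝ) (f : S → M) :
    S → E 4 :=
  (f ⁻¹' ψ.source).indicator fun x => χ (‖ψ (f x) - ψ p‖ ^ 2) • (ψ (f x) - ψ p)

include hψ

/-- Near `p` the area of a superminimal surface, without boundary in a ball of radius `δ`, is
controlled by the bound `η` of `r χ'(r)`, where `χ` is a cut-off function of the squared distance.
This comes from integrating the divergence of the radial field. -/
lemma exists_area_bound {δ₀ : ℝ} (hδ₀ : Metric.closedBall (ψ p) δ₀ ⊆ ψ.target) :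
    ∃ C : ℝ, 0 < C ∧ ∀ {δ ε η : ℝ} {χ : ℝ → ℝ}, 0 < δ → δ ≤ δ₀ → C * δ ≤ 1 → ε ≤ δ →
      (∀ r, 0 ≤ r → ContDiffAt ℝ ∞ χ r) → (∀ r, 0 ≤ χ r) →
      (∀ r, 0 ≤ r → r ≤ ε ^ 2 → χ r = 1) → (∀ r, δ ^ 2 ≤ r → χ r = 0) →
      (∀ r, 0 ≤ r → |deriv χ r| * r ≤ η) →
      ∀ {S : Type*} [TopologicalSpace S] [T2Space S] [SecondCountableTopology S]
        [ChartedSpace (E 2) S] [IsManifold (𝓡 2) ∞ S] [MeasurableSpace S] [BorelSpace S]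
        {f : S → M} {s : ℝ}, IsSmoothImmersion f → IsFiniteMeasure (areaMeasure f) →
        (∀ φ ∈ IsManifold.maximalAtlas (𝓡 2) ∞ S, ∀ t ∈ paramDomain ψ φ f,
          LiftParallelAt ψ (inCharts ψ φ f) s t) →
        IsCompact (f ⁻¹' coordBall ψ p δ) →
        (areaMeasure f).real (f ⁻¹' coordBall ψ p ε) ≤ C * η * (areaMeasure f).real univ := by
  obtain ⟨C, hC0, hC⟩ := exists_surfDiv_radial_bound hψ (isCompact_closedBall (ψ p) δ₀) hδ₀ (ψ p)
  refine ⟨C + 1, by positivity, ?_⟩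
  intro δ ε η χ hδ hδδ₀ hCδ hεδ hχs hχ0 hχ1 hχδ hχη S _ _ _ _ _ _ _ f s hf hfin hs hcpt
  set V := radialField ψ p χ f with hVdef
  have hW : IsOpen (f ⁻¹' ψ.source) := ψ.open_source.preimage hf.smooth.continuous
  have hVeq : ∀ x, f x ∈ ψ.source → V x = χ (‖ψ (f x) - ψ p‖ ^ 2) • (ψ (f x) - ψ p) :=
    fun x hx => indicator_of_mem (s := f ⁻¹' ψ.source) hx _
  have hV0 : ∀ x ∉ f ⁻¹' coordBall ψ p δ, V x = 0 := by
    intro x hx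
    by_cases hfx : f x ∈ ψ.source
    · rw [hVeq x hfx, hχδ, zero_smul]
      have : δ < ‖ψ (f x) - ψ p‖ := not_le.1 fun h => hx ⟨hfx, h⟩
      gcongr
    · exact indicator_of_notMem (s := f ⁻¹' ψ.source) hfx _
  have hsupp : tsupport V ⊆ f ⁻¹' coordBall ψ p δ :=
    closure_minimal (fun x hx => by_contra fun h => hx (hV0 x h)) hcpt.isClosed
  have hVs : ContMDiff (𝓡 2) (𝓡 4) ∞ V := by
    intro x
    by_cases hx : f x ∈ ψ.source
    · have h1 : ContMDiffAt (𝓡 2) (𝓡 4) ∞ (fun x => ψ (f x)) x :=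
        (contMDiffOn_chart_comp hψ hf).contMDiffAt (hW.mem_nhds hx)
      have h2 : ContDiffAt ℝ ∞ (fun y : E 4 => χ (‖y - ψ p‖ ^ 2) • (y - ψ p)) (ψ (f x)) := by
        have h3 : ContDiffAt ℝ ∞ (fun y : E 4 => y - ψ p) (ψ (f x)) :=
          contDiffAt_id.sub contDiffAt_const
        exact ((hχs _ (by positivity)).comp _ (h3.norm_sq ℝ)).smul h3
      refine (h2.contMDiffAt.comp x h1).congr_of_eventuallyEq ?_
      filter_upwards [hW.mem_nhds hx] with y hy using hVeq y hy
    · refine (contMDiffAt_const (c := (0 : E 4))).congr_of_eventuallyEq ?_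
      filter_upwards [hcpt.isClosed.isOpen_compl.mem_nhds fun h : x ∈ _ => hx h.1] with y hy
      exact hV0 y hy
  have hVc : HasCompactSupport V := hcpt.of_isClosed_subset (isClosed_tsupport _) hsupp
  have hVsrc : tsupport V ⊆ f ⁻¹' ψ.source := hsupp.trans fun x hx => hx.1
  have hη0 : 0 ≤ η := by simpa using hχη 0 le_rfl
  have hlow : ∀ x, (f ⁻¹' coordBall ψ p ε).indicator (fun _ => (1 : ℝ)) x - (C + 1) * η ≤
      divAlong ψ f V x := by
    intro x
    by_cases hx : x ∈ f ⁻¹' coordBall ψ p δ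
    · have hφ := IsManifold.chart_mem_maximalAtlas (I := 𝓡 2) (n := ∞) x
      have hxs := mem_chart_source (E 2) x
      set φ := chartAt (E 2) x with hφdef
      have h := isLocalImmersion_inCharts hψ hφ hf
      have hmem : φ x ∈ paramDomain ψ φ f := mem_paramDomain hxs hx.1
      have hval : inCharts ψ φ f (φ x) = ψ (f x) := by simp [inCharts, φ.left_inv hxs]
      have hball : inCharts ψ φ f (φ x) ∈ Metric.closedBall (ψ p) δ₀ := by
        rw [hval, mem_closedBall_iff_norm]
        exact hx.2.trans hδδ₀
      have h1 := hC (inCharts ψ φ f) _ (φ x) χ h hmem hball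
        ((hχs _ (by positivity)).differentiableAt (by simp)) (hχ0 _)
      have h2 : divAlong ψ f V x = surfDiv ψ (inCharts ψ φ f)
          (fun r => χ (‖inCharts ψ φ f r - ψ p‖ ^ 2) • (inCharts ψ φ f r - ψ p)) (φ x) := by
        refine surfDiv_congr ?_
        filter_upwards [h.isOpen.mem_nhds hmem] with r hr using hVeq _ hr.2
      rw [h2]
      refine le_trans ?_ h1
      rw [hval]
      have hx2 : ‖ψ (f x) - ψ p‖ ≤ δ := hx.2
      have hn := norm_nonneg (ψ (f x) - ψ p)
      have h3 := hχη (‖ψ (f x) - ψ p‖ ^ 2) (by positivity)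
      have h4 : C * (|deriv χ (‖ψ (f x) - ψ p‖ ^ 2)| * ‖ψ (f x) - ψ p‖ ^ 2) ≤ (C + 1) * η := by
        gcongr
        linarith
      have h5 : C * ‖ψ (f x) - ψ p‖ ≤ 1 := by
        refine le_trans ?_ hCδ
        gcongr
        linarith
      have h6 : (f ⁻¹' coordBall ψ p ε).indicator (fun _ => (1 : ℝ)) x ≤
          χ (‖ψ (f x) - ψ p‖ ^ 2) := by
        by_cases hxε : x ∈ f ⁻¹' coordBall ψ p ε
        · rw [indicator_of_mem hxε, hχ1 _ (by positivity) (by gcongr; exact hxε.2)]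
        · rw [indicator_of_notMem hxε]
          exact hχ0 _
      have h7 := mul_le_mul_of_nonneg_right (by linarith : 1 ≤ 2 - C * ‖ψ (f x) - ψ p‖)
        (hχ0 (‖ψ (f x) - ψ p‖ ^ 2))
      linarith
    · have hxε : x ∉ f ⁻¹' coordBall ψ p ε := fun h => hx ⟨h.1, h.2.trans hεδ⟩
      rw [divAlong_eq_zero_of_notMem_tsupport fun h => hx (hsupp h), indicator_of_notMem hxε]
      have : 0 ≤ (C + 1) * η := by positivity
      linarith
  have hclosed : MeasurableSet (f ⁻¹' coordBall ψ p ε) :=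
    (((isCompact_coordBall ((Metric.closedBall_subset_closedBall (hεδ.trans hδδ₀)).trans
      hδ₀)).isClosed).preimage hf.smooth.continuous).measurableSet
  have hint : Integrable (divAlong ψ f V) (areaMeasure f) :=
    (continuous_divAlong hψ hf hVs hVsrc).integrable_of_hasCompactSupport
      (HasCompactSupport.intro hVc fun y hy => divAlong_eq_zero_of_notMem_tsupport hy)
  have hind : Integrable ((f ⁻¹' coordBall ψ p ε).indicator fun _ => (1 : ℝ)) (areaMeasure f) :=
    (integrable_const 1).indicator hclosed
  have := integral_mono (hind.sub (integrable_const ((C + 1) * η))) hint hlow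
  rw [integral_divAlong_eq_zero hψ hf hs hVs hVc hVsrc] at this
  simp only [Pi.sub_apply] at this
  rw [integral_sub hind (integrable_const _), integral_indicator_const _ hclosed, integral_const,
    smul_eq_mul, smul_eq_mul, mul_one] at this
  linarith

end

/-! ### Comparison of the two fallouts -/

section

variable {M : Type*} [EMetricSpace M] [ChartedSpace (E 4) M]
  [RiemannianBundle (fun x : M => TangentSpace (𝓡 4) x)]
  {S : ℕ → Type*} [∀ n, TopologicalSpace (S n)] [∀ n, ChartedSpace (E 2) (S n)]
  [∀ n, MeasurableSpace (S n)]
  {f : ∀ n, S n → M} {ψ : OpenPartialHomeomorph M (E 4)} {p : M}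

/-- Two fallouts combine to zero if the combined integrals over small balls become small. -/
lemma IsFallout.add_eq_zero {K K' : ∀ n, S n → ℝ} {k k' s : ℝ} (hK : IsFallout ψ p f K k)
    (hK' : IsFallout ψ p f K' k')
    (h : ∀ η > 0, ∀ᶠ ε in 𝓝[>] (0 : ℝ), ∀ᶠ n in atTop,
      |(∫ x in f n ⁻¹' euclideanBall ψ p ε, K n x ∂(areaMeasure (f n))) +
        s * ∫ x in f n ⁻¹' euclideanBall ψ p ε, K' n x ∂(areaMeasure (f n))| ≤ η) :
    k + s * k' = 0 := by
  obtain ⟨L, hL, hk⟩ := hK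
  obtain ⟨L', hL', hk'⟩ := hK'
  have h0 : Tendsto (fun ε => L ε + s * L' ε) (𝓝[>] (0 : ℝ)) (𝓝 0) := by
    refine Metric.tendsto_nhds.2 fun η hη => ?_
    filter_upwards [hL, hL', h (η / 2) (by positivity)] with ε h1 h2 h3
    have := le_of_tendsto (h1.add (h2.const_mul s)).abs h3
    rw [Real.dist_eq, sub_zero]
    linarith
  have h1 := hk.add (hk'.const_mul s)
  have h2 : Tendsto (fun ε => 1 / (2 * Real.pi) * (L ε + s * L' ε)) (𝓝[>] (0 : ℝ))
      (𝓝 (1 / (2 * Real.pi) * 0)) := h0.const_mul _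
  rw [mul_zero] at h2
  refine tendsto_nhds_unique (h1.congr fun ε => ?_) h2
  ring

end

section

variable {M : Type*} [TopologicalSpace M] [T2Space M] [ChartedSpace (E 4) M]
  [RiemannianBundle (fun x : M => TangentSpace (𝓡 4) x)] [IsManifold (𝓡 4) ∞ M]
  [IsContMDiffRiemannianBundle (𝓡 4) ∞ (E 4) (fun x : M => TangentSpace (𝓡 4) x)]
  {ψ : OpenPartialHomeomorph M (E 4)} {p : M}
  (hψ : ψ ∈ IsManifold.maximalAtlas (𝓡 4) ∞ M)
include hψ

/-- The integral of `K^T + s K^N` over a small ball is small, uniformly over the superminimal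
surfaces of bounded area without boundary near `p`. -/
lemma eventually_integral_curvature_le (hp : p ∈ ψ.source) {N : Set M} (hN : N ∈ 𝓝 p) {s : ℝ}
    (hs1 : |s| ≤ 1) {A : ℝ} {η : ℝ} (hη : 0 < η) :
    ∀ᶠ ε in 𝓝[>] (0 : ℝ), ∀ {S : Type*} [TopologicalSpace S] [T2Space S]
      [SecondCountableTopology S] [ChartedSpace (E 2) S] [IsManifold (𝓡 2) ∞ S]
      [MeasurableSpace S] [BorelSpace S] {f : S → M}, IsSmoothImmersion f →
      IsFiniteMeasure (areaMeasure f) → (areaMeasure f).real univ ≤ A →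
      (∀ φ ∈ IsManifold.maximalAtlas (𝓡 2) ∞ S, ∀ t ∈ paramDomain ψ φ f,
          LiftParallelAt ψ (inCharts ψ φ f) s t) →
      IsCompact (f ⁻¹' N) →
      |(∫ x in f ⁻¹' euclideanBall ψ p ε, tangentCurvature ψ f x ∂(areaMeasure f)) +
        s * ∫ x in f ⁻¹' euclideanBall ψ p ε, normalCurvature ψ f x ∂(areaMeasure f)| ≤ η := by
  have hp' : ψ p ∈ ψ.target := ψ.map_source hp
  have hnhds : ψ.target ∩ ψ.symm ⁻¹' N ∈ 𝓝 (ψ p) := by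
    refine inter_mem (ψ.open_target.mem_nhds hp') ((ψ.continuousAt_symm hp').preimage_mem_nhds ?_)
    rwa [ψ.left_inv hp]
  obtain ⟨δ₀, hδ₀, hball⟩ := Metric.nhds_basis_closedBall.mem_iff.1 hnhds
  have hδt : Metric.closedBall (ψ p) δ₀ ⊆ ψ.target := hball.trans inter_subset_left
  obtain ⟨C, hC0, hC⟩ := exists_area_bound hψ hδt
  obtain ⟨C', hC'0, hC'⟩ := exists_curvature_bound hψ (isCompact_closedBall (ψ p) δ₀) hδt hs1
  obtain ⟨Λ, hΛ, hsub⟩ := exists_euclideanBall_subset hψ hp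
  set δ := min δ₀ (1 / C) with hδdef
  have hδ : 0 < δ := lt_min hδ₀ (by positivity)
  have hCδ : C * δ ≤ 1 := by
    calc C * δ ≤ C * (1 / C) := by gcongr; exact min_le_right _ _
      _ = 1 := by field_simp
  obtain ⟨ε₁, hε₁, hε₁δ, χ, hχs, hχ0, hχ1, hχδ, hχη⟩ := exists_log_cutoff hδ
    (by positivity : 0 < η / ((C' + 1) * C * (|A| + 1)))
  have hΛε : 0 < ε₁ / Λ := by positivity
  filter_upwards [Ioo_mem_nhdsGT hΛε] with ε hε S _ _ _ _ _ _ _ f hf hfin hA hs hcpt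
  have hDsub : ∀ r ≤ δ₀, coordBall ψ p r ⊆ N := fun r hr q hq => by
    have := (hball (mem_closedBall_iff_norm.2 (hq.2.trans hr))).2
    rwa [mem_preimage, ψ.left_inv hq.1] at this
  have hDcpt : ∀ r ≤ δ₀, IsCompact (f ⁻¹' coordBall ψ p r) := fun r hr =>
    hcpt.of_isClosed_subset ((isCompact_coordBall ((Metric.closedBall_subset_closedBall hr).trans
      hδt)).isClosed.preimage hf.smooth.continuous) (preimage_mono (hDsub r hr))
  have harea := hC hδ (min_le_left _ _) hCδ hε₁δ hχs hχ0 hχ1 hχδ hχη hf hfin hs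
    (hDcpt δ (min_le_left _ _))
  have hBD : euclideanBall ψ p ε ⊆ coordBall ψ p ε₁ := fun q hq => by
    refine ⟨hq.1, (hsub ε hq).2.trans ?_⟩
    have := (lt_div_iff₀ hΛ).1 hε.2
    linarith
  have hε₁δ₀ : ε₁ ≤ δ₀ := hε₁δ.trans (min_le_left _ _)
  have hDK := hDcpt ε₁ hε₁δ₀
  have hint : ∀ {g : S → ℝ}, ContinuousOn g (f ⁻¹' ψ.source) →
      IntegrableOn g (f ⁻¹' euclideanBall ψ p ε) (areaMeasure f) := fun hg =>
    ((hg.mono fun x hx => hx.1).integrableOn_compact hDK).mono_set (preimage_mono hBD)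
  have hiT := hint (continuousOn_tangentCurvature_surface hψ hf)
  have hiN := hint (continuousOn_normalCurvature_surface hψ hf)
  rw [← integral_const_mul, ← integral_add hiT (hiN.const_mul s)]
  have hbound : ∀ x ∈ f ⁻¹' euclideanBall ψ p ε,
      ‖tangentCurvature ψ f x + s * normalCurvature ψ f x‖ ≤ C' := by
    intro x hx
    have hφ := IsManifold.chart_mem_maximalAtlas (I := 𝓡 2) (n := ∞) x
    have hxs := mem_chart_source (E 2) x
    have hmem := mem_paramDomain (ψ := ψ) (f := f) hxs hx.1
    refine hC' _ _ _ (isLocalImmersion_inCharts hψ hφ hf) hmem ?_ (hs _ hφ _ hmem)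
    have hval : inCharts ψ (chartAt (E 2) x) f (chartAt (E 2) x x) = ψ (f x) := by
      simp [inCharts, (chartAt (E 2) x).left_inv hxs]
    rw [hval, mem_closedBall_iff_norm]
    exact (hBD hx).2.trans hε₁δ₀
  have h1 := norm_setIntegral_le_of_norm_le_const (measure_lt_top (areaMeasure f) _) hbound
  rw [Real.norm_eq_abs] at h1
  refine h1.trans ?_
  have h2 : (areaMeasure f).real (f ⁻¹' euclideanBall ψ p ε) ≤
      (areaMeasure f).real (f ⁻¹' coordBall ψ p ε₁) := measureReal_mono (preimage_mono hBD)
  have hA0 : (areaMeasure f).real univ ≤ |A| := hA.trans (le_abs_self A)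
  calc C' * (areaMeasure f).real (f ⁻¹' euclideanBall ψ p ε)
      ≤ C' * (C * (η / ((C' + 1) * C * (|A| + 1))) * (areaMeasure f).real univ) := by
        gcongr
        exact h2.trans harea
    _ ≤ (C' + 1) * (C * (η / ((C' + 1) * C * (|A| + 1))) * (|A| + 1)) := by
        gcongr
        · linarith
        · linarith
    _ = η := by field_simp

end

section

variable {M : Type*} [EMetricSpace M] [ChartedSpace (E 4) M] [IsManifold (𝓡 4) ∞ M]
  [RiemannianBundle (fun x : M => TangentSpace (𝓡 4) x)]
  [IsContMDiffRiemannianBundle (𝓡 4) ∞ (E 4) (fun x : M => TangentSpace (𝓡 4) x)]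
  {S : ℕ → Type*} [∀ n, TopologicalSpace (S n)] [∀ n, T2Space (S n)]
  [∀ n, SecondCountableTopology (S n)] [∀ n, ChartedSpace (E 2) (S n)]
  [∀ n, IsManifold (𝓡 2) ∞ (S n)] [∀ n, MeasurableSpace (S n)] [∀ n, BorelSpace (S n)]

/-- The common form of both cases: `s = 1` for right and `s = -1` for left superminimal surfaces. -/
theorem fallout_add_eq_zero {o : OrientedAtlas M} {f : ∀ n, S n → M} {m : ℕ} {F : Fin m → ℂ → M}
    {p : M} (h : Degeneration p f F) {ψ : OpenPartialHomeomorph M (E 4)} (hψ : ψ ∈ o.charts)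
    (hp : p ∈ ψ.source) {kT kN s : ℝ} (hT : IsTangentFallout ψ p f kT)
    (hN : IsNormalFallout ψ p f kN) (hs1 : |s| ≤ 1) (hs : ∀ n, LiftParallel o s (f n)) :
    kT + s * kN = 0 := by
  obtain ⟨A, hA⟩ := h.area
  obtain ⟨N, hNp, hcpt⟩ := h.proper_near
  refine IsFallout.add_eq_zero hT hN fun η hη => ?_
  filter_upwards [eventually_integral_curvature_le (A := A) (o.smooth hψ) hp hNp hs1 hη] with ε hε
  filter_upwards [hcpt] with n hn
  have hfin : IsFiniteMeasure (areaMeasure (f n)) :=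
    ⟨(hA n).trans_lt ENNReal.coe_lt_top⟩
  refine hε (h.immersion n) hfin ?_ (fun φ hφ t ht => hs n φ hφ ψ hψ t ht.1 ht.2) hn
  exact ENNReal.toReal_le_coe_of_le_coe (hA n)

end

end SurfaceSequence

end

theorem proposition4 {M : Type*} [EMetricSpace M] [ChartedSpace (SurfaceSequence.E 4) M]
    [IsManifold (𝓡 4) ∞ M]
    [RiemannianBundle (fun x : M => TangentSpace (𝓡 4) x)]
    [IsContMDiffRiemannianBundle (𝓡 4) ∞ (SurfaceSequence.E 4)
      (fun x : M => TangentSpace (𝓡 4) x)]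
    [IsRiemannianManifold (𝓡 4) M]
    (o : SurfaceSequence.OrientedAtlas M)
    {S : ℕ → Type*} [∀ n, TopologicalSpace (S n)] [∀ n, T2Space (S n)]
    [∀ n, SecondCountableTopology (S n)]
    [∀ n, ChartedSpace (SurfaceSequence.E 2) (S n)] [∀ n, IsManifold (𝓡 2) ∞ (S n)]
    [∀ n, MeasurableSpace (S n)] [∀ n, BorelSpace (S n)]
    (f : ∀ n, S n → M) {m : ℕ} (F : Fin m → ℂ → M) (p : M)
    (h : SurfaceSequence.Degeneration p f F)
    (ψ : OpenPartialHomeomorph M (SurfaceSequence.E 4)) (hψ : ψ ∈ o.charts) (hp : p ∈ ψ.source)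
    (kT kN : ℝ) (hT : SurfaceSequence.IsTangentFallout ψ p f kT)
    (hN : SurfaceSequence.IsNormalFallout ψ p f kN) :
    ((∀ n, SurfaceSequence.RightSuperminimal o (f n)) → kT = -kN) ∧
      ((∀ n, SurfaceSequence.LeftSuperminimal o (f n)) → kT = kN) := by
  refine ⟨fun hs => ?_, fun hs => ?_⟩
  · have := SurfaceSequence.fallout_add_eq_zero h hψ hp hT hN (by simp) hs
    linarith
  · have := SurfaceSequence.fallout_add_eq_zero h hψ hp hT hN (by simp) hs
    linarith
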